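/- Let $0<T\le\infty$ and let $r(z,t)$ be of Schwartz class on $\Gamma=\{0<z<\infty,\ 0<t<T\}$ (that is, the restriction of a Schwartz function on $\mathbb R^2$) and satisfy there $$i r_t+r_{zz}+|r|^2r-i|r|^2r_z=0 .$$ **Lax pair.** Put $\lambda=\lambda(\varsigma)=\varsigma^2-\tfrac12$, $\sigma=\mathrm{diag}(1,-1)$, $R=\begin{pmatrix}0&r\\-\bar r&0\end{pmatrix}$, $e^{x\hat\sigma}M=e^{x\sigma}Me^{-x\sigma}$, $$A=\varsigma R+\tfrac i4R^2\sigma,\qquad B=-2\varsigma^3R-i\varsigma^2R^2\sigma+\varsigma\bigl(R+i\sigma R_z-\tfrac12R^3\bigr)-\tfrac i8R^4\sigma+\tfrac14(RR_z-R_zR),$$ let $\Theta=\Theta_1dz+\Theta_2dt$ be the closed 1-form with $\Theta_1=\tfrac14|r|^2$, $\Theta_2=\tfrac18|r|^4+\tfrac i4(\bar rr_z-r\bar r_z)$, and let $$A_1=e^{-i\int_{(0,0)}^{(z,t)}\Theta\,\hat\sigma}(A-i\Theta_1\sigma),\qquad B_1=e^{-i\int_{(0,0)}^{(z,t)}\Theta\,\hat\sigma}(B-i\Theta_2\sigma).$$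 **Eigenfunctions.** The columns $[H_j]_1,[H_j]_2$ of $H_1,H_2,H_3$ are the solutions of the corresponding columns of $$H_1(z,t,\varsigma)=I+\int_0^ze^{i\lambda(z-\zeta)\hat\sigma}(A_1H_1)(\zeta,t,\varsigma)\,d\zeta+e^{i\lambda z\hat\sigma}\int_0^te^{-2i\lambda^2(t-\tau)\hat\sigma}(B_1H_1)(0,\tau,\varsigma)\,d\tau,$$ $$H_2(z,t,\varsigma)=I+\int_0^ze^{i\lambda(z-\zeta)\hat\sigma}(A_1H_2)(\zeta,t,\varsigma)\,d\zeta-e^{i\lambda z\hat\sigma}\int_t^Te^{-2i\lambda^2(t-\tau)\hat\sigma}(B_1H_2)(0,\tau,\varsigma)\,d\tau,$$ $$H_3(z,t,\varsigma)=I-\int_z^\infty e^{i\lambda(z-\zeta)\hat\sigma}(A_1H_3)(\zeta,t,\varsigma)\,d\zeta$$ that are continuous in $z$ and, at $z=0$, in $t$ (those of $H_3$ bounded in $z$, those of $H_2$ bounded in $t$ at $z=0$), for those $\varsigma$ for which the column exists. **Spectral functions.** Let $(v,u)^T=[H_3]_2(0,0,\varsigma)$ and $(V,U)^T=[H_2]_2(0,0,\varsigma)$,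 and put $$\beta(\varsigma)=u(\varsigma)\overline{U(\bar\varsigma)}+v(\varsigma)\overline{V(\bar\varsigma)},\qquad \eta(\varsigma)=-\lambda z+2\lambda^2t .$$ With $\phi=i\lambda$ and $\psi=2i\lambda^2$ let $$D_1=\{\mathrm{Re}\,\phi<0,\mathrm{Re}\,\psi<0\},\quad D_2=\{\mathrm{Re}\,\phi<0,\mathrm{Re}\,\psi>0\},\quad D_3=\{\mathrm{Re}\,\phi>0,\mathrm{Re}\,\psi>0\},\quad D_4=\{\mathrm{Re}\,\phi>0,\mathrm{Re}\,\psi<0\},$$ and let $E=([E]_1,[E]_2)$ be $$E(z,t,\varsigma)=\begin{cases}\bigl([H_3]_1,\ [H_2]_2/\overline{\beta(\bar\varsigma)}\bigr),&\varsigma\in D_1,\\ \bigl([H_3]_1,\ [H_1]_2/\overline{u(\bar\varsigma)}\bigr),&\varsigma\in D_2,\\ \bigl([H_2]_1/\beta(\varsigma),\ [H_3]_2\bigr),&\varsigma\in D_3,\\ \bigl([H_1]_1/u(\varsigma),\ [H_3]_2\bigr),&\varsigma\in D_4.\end{cases}$$ **Assumption.** All zeros of $u$ in $D_4$ and all zeros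 of $\beta$ in $D_3$ are simple, and no zero of $\beta$ in $D_3$ is a zero of $u$. **Proposition 2.5.** Let $(z,t)\in\Gamma$, and let a dot denote $d/d\varsigma$. At every zero $\xi\in D_4$ of $u$, $[E]_1$ has a simple pole at $\xi$ and $[E]_2$ has a simple pole at $\bar\xi\in D_2$, with $$\mathrm{Res}\{[E]_1,\xi\}=\frac{e^{2i\eta(\xi)}}{v(\xi)\dot u(\xi)}[E(z,t,\xi)]_2,\qquad \mathrm{Res}\{[E]_2,\bar\xi\}=-\frac{e^{-2i\eta(\bar\xi)}}{\overline{v(\xi)}\,\overline{\dot u(\xi)}}[E(z,t,\bar\xi)]_1 .$$ At every zero $\mu\in D_3$ of $\beta$, $[E]_1$ has a simple pole at $\mu$ and $[E]_2$ has a simple pole at $\bar\mu\in D_1$, with $$\mathrm{Res}\{[E]_1,\mu\}=-\frac{\overline{V(\bar\mu)}}{u(\mu)\dot\beta(\mu)}e^{2i\eta(\mu)}[E(z,t,\mu)]_2,\qquad \mathrm{Res}\{[E]_2,\bar\mu\}=\frac{V(\bar\mu)}{\overline{u(\mu)}\,\overline{\dot\beta(\mu)}}e^{-2i\eta(\bar\mu)}[E(z,t,\bar\mu)]_1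 .$$ -/

import Mathlib

open Complex Set Filter Topology MeasureTheory Matrix
open scoped SchwartzMap ComplexConjugate

noncomputable section

namespace CLLNLS

/-! ### The equation

The potential is a complex function of `(z, t)` of Schwartz class.  Only its values on the closure
of the domain `0 < z < ∞`, `0 < t < T` (with `0 < T ≤ ∞`) enter; a function of Schwartz class on
that domain is the restriction of a Schwartz function on the plane. -/

/-- The partial derivative `r_z`. -/
def rz (r : 𝓢(ℝ × ℝ, ℂ)) (z t : ℝ) : ℂ := deriv (fun x : ℝ => r (x, t)) z

/-- The partial derivative `r_zz`. -/
def rzz (r : 𝓢(ℝ × ℝ, ℂ)) (z t : ℝ) : ℂ := deriv (fun x : ℝ => rz r x t) z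

/-- The partial derivative `r_t`. -/
def rt (r : 𝓢(ℝ × ℝ, ℂ)) (z t : ℝ) : ℂ := deriv (fun s : ℝ => r (z, s)) t

/-- The combined Chen-Lee-Liu and nonlinear Schrödinger equation
`i r_t + r_zz + |r|² r - i |r|² r_z = 0` on `0 < z < ∞`, `0 < t < T`. -/
def IsSolution (r : 𝓢(ℝ × ℝ, ℂ)) (T : EReal) : Prop :=
  ∀ z t : ℝ, 0 < z → 0 < t → (t : EReal) < T →
    I * rt r z t + rzz r z t + (‖r (z, t)‖ : ℂ) ^ 2 * r (z, t)
      - I * (‖r (z, t)‖ : ℂ) ^ 2 * rz r z t = 0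

/-! ### The Lax pair and its gauge-transformed form

`Ψ_z = (i (s² - 1/2) σ + A) Ψ` and `Ψ_t = (-2i (s² - 1/2)² σ + B) Ψ`. -/

/-- The matrix `σ = diag(1, -1)`. -/
def sigma : Matrix (Fin 2) (Fin 2) ℂ := !![1, 0; 0, -1]

/-- The matrix `R`. -/
def R (r : 𝓢(ℝ × ℝ, ℂ)) (z t : ℝ) : Matrix (Fin 2) (Fin 2) ℂ :=
  !![0, r (z, t); -conj (r (z, t)), 0]

/-- The matrix `R_z`. -/
def Rz (r : 𝓢(ℝ × ℝ, ℂ)) (z t : ℝ) : Matrix (Fin 2) (Fin 2) ℂ :=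
  !![0, rz r z t; -conj (rz r z t), 0]

/-- `λ(s) = s² - 1/2`, where `s` is the spectral parameter. -/
def lam (s : ℂ) : ℂ := s ^ 2 - 1 / 2

/-- `A = s R + (i/4) R² σ`. -/
def A (r : 𝓢(ℝ × ℝ, ℂ)) (z t : ℝ) (s : ℂ) : Matrix (Fin 2) (Fin 2) ℂ :=
  s • R r z t + (I / 4) • (R r z t ^ 2 * sigma)

/-- `B = -2 s³ R - i s² R² σ + s (R + i σ R_z - R³/2) - (i/8) R⁴ σ + (R R_z - R_z R)/4`. -/
def B (r : 𝓢(ℝ × ℝ, ℂ)) (z t : ℝ) (s : ℂ) : Matrix (Fin 2) (Fin 2) ℂ :=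
  (-2 * s ^ 3) • R r z t - (I * s ^ 2) • (R r z t ^ 2 * sigma)
    + s • (R r z t + I • (sigma * Rz r z t) - (1 / 2 : ℂ) • R r z t ^ 3)
    - (I / 8) • (R r z t ^ 4 * sigma)
    + (1 / 4 : ℂ) • (R r z t * Rz r z t - Rz r z t * R r z t)

/-- The `dz` coefficient of the closed 1-form `Θ`. -/
def Theta1 (r : 𝓢(ℝ × ℝ, ℂ)) (z t : ℝ) : ℂ := (1 / 4) * (‖r (z, t)‖ : ℂ) ^ 2

/-- The `dt` coefficient of the closed 1-form `Θ`. -/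
def Theta2 (r : 𝓢(ℝ × ℝ, ℂ)) (z t : ℝ) : ℂ :=
  (1 / 8) * (‖r (z, t)‖ : ℂ) ^ 4
    + (I / 4) * (conj (r (z, t)) * rz r z t - r (z, t) * conj (rz r z t))

/-- The integral of `Θ` from `(0, 0)` to `(z, t)`, along the path through `(0, t)`. -/
def theta (r : 𝓢(ℝ × ℝ, ℂ)) (z t : ℝ) : ℂ :=
  (∫ τ in (0 : ℝ)..t, Theta2 r 0 τ) + ∫ ζ in (0 : ℝ)..z, Theta1 r ζ t

/-- The matrix exponential `e^{x σ}`. -/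
def expSigma (x : ℂ) : Matrix (Fin 2) (Fin 2) ℂ := !![exp x, 0; 0, exp (-x)]

/-- The operator `e^{x σ̂} M = e^{x σ} M e^{-x σ}`. -/
def hatExp (x : ℂ) (M : Matrix (Fin 2) (Fin 2) ℂ) : Matrix (Fin 2) (Fin 2) ℂ :=
  expSigma x * M * expSigma (-x)

/-- The action of `e^{x σ̂}` on the `k`-th column: if `f` is the `k`-th column of `M`, then
`hatExpCol k x f` is the `k`-th column of `e^{x σ̂} M`. -/
def hatExpCol (k : Fin 2) (x : ℂ) (f : Fin 2 → ℂ) : Fin 2 → ℂ :=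
  exp (-(x * sigma k k)) • (expSigma x *ᵥ f)

theorem hatExpCol_eq (k : Fin 2) (x : ℂ) (M : Matrix (Fin 2) (Fin 2) ℂ) :
    hatExpCol k x (M.col k) = (hatExp x M).col k := by
  ext i
  simp only [hatExpCol, hatExp, expSigma, sigma, Matrix.mul_apply, Fin.sum_univ_two,
    Matrix.mulVec, dotProduct, Matrix.col_apply, Pi.smul_apply, smul_eq_mul]
  fin_cases k <;> fin_cases i <;> simp <;> ring

/-- `A₁ = e^{-i ∫Θ σ̂} (A - i Θ₁ σ)`. -/
def A₁ (r : 𝓢(ℝ × ℝ, ℂ)) (z t : ℝ) (s : ℂ) : Matrix (Fin 2) (Fin 2) ℂ :=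
  hatExp (-(I * theta r z t)) (A r z t s - (I * Theta1 r z t) • sigma)

/-- `B₁ = e^{-i ∫Θ σ̂} (B - i Θ₂ σ)`. -/
def B₁ (r : 𝓢(ℝ × ℝ, ℂ)) (z t : ℝ) (s : ℂ) : Matrix (Fin 2) (Fin 2) ℂ :=
  hatExp (-(I * theta r z t)) (B r z t s - (I * Theta2 r z t) • sigma)

/-! ### The eigenfunctions

Each column of `H₁`, `H₂`, `H₃` is the solution of its own Volterra equation, namely of that column
of `H_j = I + ∫_{(z_j, t_j)}^{(z, t)} e^{[iλ(z - ζ) - 2iλ²(t - τ)] σ̂} (A₁ dζ + B₁ dτ) H_j`, with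
`(z₁, t₁) = (0, 0)`, `(z₂, t₂) = (0, T)`, `(z₃, t₃) = (∞, t)`.  The paths to `(z, t)` used for
`H₁` and `H₂` go along the `t`-axis to `(0, t)` and then parallel to the `z`-axis.  The columns are
treated separately because a column may exist for values of `s` for which the other one does not. -/

/-- The `k`-th column of the identity matrix. -/
def unitCol (k : Fin 2) : Fin 2 → ℂ := (1 : Matrix (Fin 2) (Fin 2) ℂ).col k

/-- The times in `[0, T)`. -/
def timeSet (T : EReal) : Set ℝ := {t : ℝ | 0 ≤ t ∧ (t : EReal) < T}

/-- `f z t` is the `k`-th column of `H₁(z, t, s)`. -/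
structure IsH₁ (r : 𝓢(ℝ × ℝ, ℂ)) (s : ℂ) (k : Fin 2) (f : ℝ → ℝ → Fin 2 → ℂ) : Prop where
  continuousOn_z : ∀ t, 0 ≤ t → ContinuousOn (fun z => f z t) (Ici 0)
  continuousOn_t : ContinuousOn (fun t => f 0 t) (Ici 0)
  equation : ∀ z t : ℝ, 0 ≤ z → 0 ≤ t →
    f z t = unitCol k
      + (∫ ζ in (0 : ℝ)..z, hatExpCol k (I * lam s * (z - ζ)) (A₁ r ζ t s *ᵥ f ζ t))
      + hatExpCol k (I * lam s * z)
          (∫ τ in (0 : ℝ)..t, hatExpCol k (-(2 * I * lam s ^ 2 * (t - τ))) (B₁ r 0 τ s *ᵥ f 0 τ))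

/-- `f z t` is the `k`-th column of `H₂(z, t, s)`, where `0 ≤ t < T`. -/
structure IsH₂ (r : 𝓢(ℝ × ℝ, ℂ)) (T : EReal) (s : ℂ) (k : Fin 2)
    (f : ℝ → ℝ → Fin 2 → ℂ) : Prop where
  continuousOn_z : ∀ t ∈ timeSet T, ContinuousOn (fun z => f z t) (Ici 0)
  continuousOn_t : ContinuousOn (fun t => f 0 t) (timeSet T)
  bounded_t : ∃ C : ℝ, ∀ t ∈ timeSet T, ‖f 0 t‖ ≤ C
  equation : ∀ z t : ℝ, 0 ≤ z → t ∈ timeSet T →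
    f z t = unitCol k
      + (∫ ζ in (0 : ℝ)..z, hatExpCol k (I * lam s * (z - ζ)) (A₁ r ζ t s *ᵥ f ζ t))
      - hatExpCol k (I * lam s * z)
          (∫ τ in {τ : ℝ | t < τ ∧ (τ : EReal) < T},
            hatExpCol k (-(2 * I * lam s ^ 2 * (t - τ))) (B₁ r 0 τ s *ᵥ f 0 τ))

/-- For the given `t`, `f z` is the `k`-th column of `H₃(z, t, s)`. -/
structure IsH₃ (r : 𝓢(ℝ × ℝ, ℂ)) (s : ℂ) (k : Fin 2) (t : ℝ) (f : ℝ → Fin 2 → ℂ) : Prop where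
  continuousOn_z : ContinuousOn f (Ici 0)
  bounded_z : ∃ C : ℝ, ∀ z, 0 ≤ z → ‖f z‖ ≤ C
  equation : ∀ z : ℝ, 0 ≤ z →
    f z = unitCol k
      - ∫ ζ in Ioi z, hatExpCol k (I * lam s * (z - ζ)) (A₁ r ζ t s *ᵥ f ζ)

/-- The `k`-th column of `H₁(z, t, s)`: the solution of its integral equation. -/
def H₁ (r : 𝓢(ℝ × ℝ, ℂ)) (z t : ℝ) (s : ℂ) (k : Fin 2) : Fin 2 → ℂ :=
  Classical.epsilon (IsH₁ r s k) z t

/-- The `k`-th column of `H₂(z, t, s)`: the solution of its integral equation. -/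
def H₂ (r : 𝓢(ℝ × ℝ, ℂ)) (T : EReal) (z t : ℝ) (s : ℂ) (k : Fin 2) : Fin 2 → ℂ :=
  Classical.epsilon (IsH₂ r T s k) z t

/-- The `k`-th column of `H₃(z, t, s)`: the solution of its integral equation. -/
def H₃ (r : 𝓢(ℝ × ℝ, ℂ)) (z t : ℝ) (s : ℂ) (k : Fin 2) : Fin 2 → ℂ :=
  Classical.epsilon (IsH₃ r s k t) z

/-! ### The domains in the plane of the spectral parameter -/

/-- `φ(s) = i (s² - 1/2)`. -/
def phi (s : ℂ) : ℂ := I * lam s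

/-- `ψ(s) = 2i (s² - 1/2)²`. -/
def psi (s : ℂ) : ℂ := 2 * I * lam s ^ 2

def D₁ : Set ℂ := {s | (phi s).re < 0 ∧ (psi s).re < 0}

def D₂ : Set ℂ := {s | (phi s).re < 0 ∧ 0 < (psi s).re}

def D₃ : Set ℂ := {s | 0 < (phi s).re ∧ 0 < (psi s).re}

def D₄ : Set ℂ := {s | 0 < (phi s).re ∧ (psi s).re < 0}

/-! ### The spectral functions

`w(s) = H₃(0, 0, s)` has second column `(v, u)`, and `W(s) = H₂(0, 0, s)` has second column
`(V, U)`. -/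

def v (r : 𝓢(ℝ × ℝ, ℂ)) (s : ℂ) : ℂ := H₃ r 0 0 s 1 0

def u (r : 𝓢(ℝ × ℝ, ℂ)) (s : ℂ) : ℂ := H₃ r 0 0 s 1 1

def V (r : 𝓢(ℝ × ℝ, ℂ)) (T : EReal) (s : ℂ) : ℂ := H₂ r T 0 0 s 1 0

def U (r : 𝓢(ℝ × ℝ, ℂ)) (T : EReal) (s : ℂ) : ℂ := H₂ r T 0 0 s 1 1

/-- `β(s) = u(s) conj(U(conj s)) + v(s) conj(V(conj s))`. -/
def β (r : 𝓢(ℝ × ℝ, ℂ)) (T : EReal) (s : ℂ) : ℂ :=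
  u r s * conj (U r T (conj s)) + v r s * conj (V r T (conj s))

/-- `η(s) = -(s² - 1/2) z + 2 (s² - 1/2)² t`. -/
def η (z t : ℝ) (s : ℂ) : ℂ := -(lam s * z) + 2 * lam s ^ 2 * t

/-- The matrix with columns `a` and `b`. -/
def ofCols (a b : Fin 2 → ℂ) : Matrix (Fin 2) (Fin 2) ℂ := (Matrix.of ![a, b])ᵀ

open Classical in
/-- The sectionally meromorphic matrix `E(z, t, s)`, with the irrelevant value `0` on the curves
that separate the four domains. -/
def E (r : 𝓢(ℝ × ℝ, ℂ)) (T : EReal) (z t : ℝ) (s : ℂ) : Matrix (Fin 2) (Fin 2) ℂ :=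
  if s ∈ D₁ then ofCols (H₃ r z t s 0) ((conj (β r T (conj s)))⁻¹ • H₂ r T z t s 1)
  else if s ∈ D₂ then ofCols (H₃ r z t s 0) ((conj (u r (conj s)))⁻¹ • H₁ r z t s 1)
  else if s ∈ D₃ then ofCols ((β r T s)⁻¹ • H₂ r T z t s 0) (H₃ r z t s 1)
  else if s ∈ D₄ then ofCols ((u r s)⁻¹ • H₁ r z t s 0) (H₃ r z t s 1)
  else 0

/-- The zeros of `u` in `D₄` and of `β` in `D₃` are simple, and `u` and `β` have no common zero. -/
structure SimpleZeros (r : 𝓢(ℝ × ℝ, ℂ)) (T : EReal) : Prop where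
  u_simple : ∀ ξ ∈ D₄, u r ξ = 0 → deriv (u r) ξ ≠ 0
  β_simple : ∀ μ ∈ D₃, β r T μ = 0 → deriv (β r T) μ ≠ 0
  disjoint : ∀ μ ∈ D₃, β r T μ = 0 → u r μ ≠ 0

/-- `f` has a (genuine) simple pole at `p`, with residue `c`. -/
structure HasSimplePoleWithResidue (f : ℂ → Fin 2 → ℂ) (p : ℂ) (c : Fin 2 → ℂ) : Prop where
  meromorphicAt : MeromorphicAt f p
  order_eq : meromorphicOrderAt f p = ((-1 : ℤ) : WithTop ℤ)
  residue : Tendsto (fun s => (s - p) • f s) (𝓝[≠] p) (𝓝 c)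

end CLLNLS

end

open CLLNLS

noncomputable section

namespace CLLNLS

/-! ### Volterra equations on a half-line -/

section Volterra

variable {F : Type*} [NormedAddCommGroup F] [NormedSpace ℂ F]

/-! Near a zero of `u` or `β` the singular column of `E` is a holomorphic column divided by a scalar
with a simple zero. The pole is therefore simple, with residue the value of the numerator divided by
the derivative of the scalar, as soon as that numerator is nonzero
(`hasSimplePoleWithResidue_of_eventuallyEq`). What has to be shown is that at such a zero the
numerator, the first column of `H₁` or `H₂`, is a nonzero multiple of the second column of `H₃`, the
factor being a constant times `exp (2iη)`.

At the origin this is linear algebra. The first column of `H₁` is `(1, 0)` there and the second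
column of `H₃` is `(v, u)`, so they are parallel when `u = 0`. The function `β` is the determinant
of the first column of `H₂` and the second column of `H₃` at the origin (`β_eq`), so its zeros make
these two parallel. None of the columns can vanish, since a zero would propagate and contradict the
integral equation (`sol3_ne_zero`, `bd2_ne_zero`).

Proportionality at the origin spreads to all `(z, t)` because, after removal of exponentials and of
the gauge factor, the columns should solve one and the same Lax pair. This is not immediate: `H₁`
and `H₂` satisfy the `t`-equation by definition only on `z = 0`, and `H₃` is defined time by time
through its behaviour at `z = ∞`. The equation for `r` makes the curvature vanish
(`IsSolution.zero_curvature`), and a Volterra argument for the defect then extends the `t`-equation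
of `H₁` and `H₂` to `z > 0` (`zeroCurvature_propagation`). Multiplied by `exp (-2iη)`, the column
satisfies the `z`-equation of a second column. At `t = 0` it is the multiple of `H₃` fixed at the
origin; its `t`-equation keeps it bounded in `z`, and the decay of `r` keeps the limit of its second
entry at `z = ∞` unchanged. These properties characterize the column of `H₃` (`isH₃_of_ode`), which
gives `IsSolution.extendZ_eq_smul_sol3`.

Existence, uniqueness and holomorphy in the spectral parameter come from a single theory of Volterra
equations on half-lines, to which every column equation is brought by a cut-off and, for integrals
starting at `0`, by the reflection `x ↦ -x`. Uniqueness also identifies the eigenfunctions, defined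
by choice, with the Neumann series. Only first columns of `H₁`, `H₂` and second columns of `H₃` are
treated this way; the remaining ones, living at the conjugate parameter, follow from the symmetry
`reflectCol`, which also carries each pole to its conjugate. -/

theorem differentiableOn_integral_of_dominated [CompleteSpace F] {α : Type*} [MeasurableSpace α] {μ : Measure α}
    {Ω : Set ℂ} (hΩ : IsOpen Ω) {f : ℂ → α → F} {bound : α → ℝ}
    (hmeas : ∀ s ∈ Ω, AEStronglyMeasurable (f s) μ)
    (hf : ∀ᵐ a ∂μ, DifferentiableOn ℂ (fun s => f s a) Ω)
    (hb : ∀ᵐ a ∂μ, ∀ s ∈ Ω, ‖f s a‖ ≤ bound a) (hint : Integrable bound μ) :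
    DifferentiableOn ℂ (fun s => ∫ a, f s a ∂μ) Ω := by
  intro s₀ hs₀
  obtain ⟨ε, hε, hball⟩ := Metric.isOpen_iff.1 hΩ s₀ hs₀
  have hmem : ∀ᶠ s in 𝓝 s₀, s ∈ Ω := hΩ.mem_nhds hs₀
  -- Measurability of the derivative is not assumed: it is an a.e. limit of difference quotients
  -- along a sequence that stays in `Ω`.
  have hdmeas : AEStronglyMeasurable (fun a => deriv (fun s => f s a) s₀) μ := by
    have hseq : Tendsto (fun n : ℕ => s₀ + (((n : ℝ) + 1)⁻¹ * (ε / 2) : ℝ)) atTop (𝓝[≠] s₀) := by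
      refine tendsto_nhdsWithin_iff.2 ⟨?_, Eventually.of_forall fun n => ?_⟩
      · have h1 : Tendsto (fun n : ℕ => ((n : ℝ) + 1)⁻¹ * (ε / 2)) atTop (𝓝 (0 * (ε / 2))) :=
          (tendsto_inv_atTop_zero.comp
            (tendsto_atTop_add_const_right _ _ tendsto_natCast_atTop_atTop)).mul_const _
        rw [zero_mul] at h1
        have h2 := (Complex.continuous_ofReal.tendsto 0).comp h1
        simpa using h2.const_add s₀
      · have : (0 : ℝ) < ((n : ℝ) + 1)⁻¹ * (ε / 2) := by positivity
        simp only [mem_compl_iff, mem_singleton_iff, add_eq_left]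
        exact_mod_cast this.ne'
    refine aestronglyMeasurable_of_tendsto_ae atTop
      (f := fun (n : ℕ) a => slope (fun s => f s a) s₀ (s₀ + (((n : ℝ) + 1)⁻¹ * (ε / 2) : ℝ)))
      (fun n => ?_) ?_
    · have hn : s₀ + ((((n : ℕ) : ℝ) + 1)⁻¹ * (ε / 2) : ℝ) ∈ Ω := by
        apply hball
        rw [Metric.mem_ball, dist_eq_norm, add_sub_cancel_left, Complex.norm_real, Real.norm_eq_abs,
          abs_of_pos (by positivity)]
        have : ((n : ℝ) + 1)⁻¹ ≤ 1 := inv_le_one_of_one_le₀ (by linarith [n.cast_nonneg (α := ℝ)])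
        nlinarith
      simp only [slope, vsub_eq_sub]
      exact ((hmeas _ hn).sub (hmeas _ hs₀)).const_smul _
    · filter_upwards [hf] with a ha
      exact (hasDerivAt_iff_tendsto_slope.1
        (ha.differentiableAt (hΩ.mem_nhds hs₀)).hasDerivAt).comp hseq
  -- Cauchy's estimate on circles of radius `ε / 4` about points of the ball of radius `ε / 2`
  -- bounds the derivative; these circles stay inside the ball of radius `ε`.
  have key := hasDerivAt_integral_of_dominated_loc_of_deriv_le (μ := μ) (x₀ := s₀)
    (F := f) (F' := fun s a => deriv (fun s => f s a) s) (s := Metric.ball s₀ (ε / 2))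
    (bound := fun a => bound a / (ε / 4)) (Metric.ball_mem_nhds _ (by positivity))
    (hmem.mono fun s hs => hmeas s hs)
    (hint.mono' (hmeas _ hs₀) (hb.mono fun a ha => ha _ hs₀)) hdmeas ?_ (hint.div_const _) ?_
  · exact key.2.differentiableAt.differentiableWithinAt
  · filter_upwards [hf, hb] with a ha hba s hs
    have hsub : Metric.closedBall s (ε / 4) ⊆ Ω := by
      intro w hw
      apply hball
      rw [Metric.mem_closedBall] at hw
      rw [Metric.mem_ball] at hs ⊢
      linarith [dist_triangle w s s₀]
    refine norm_deriv_le_of_forall_mem_sphere_norm_le (by positivity) ?_ fun w hw =>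
      hba w (hsub (Metric.sphere_subset_closedBall hw))
    exact (ha.mono hsub).diffContOnCl_ball Subset.rfl
  · filter_upwards [hf] with a ha s hs
    have : s ∈ Ω := hball (Metric.ball_subset_ball (by linarith) hs)
    exact (ha.differentiableAt (hΩ.mem_nhds this)).hasDerivAt

/-- The integral of `m` over `(x, ∞)`. -/
def tailIntegral (m : ℝ → ℝ) (x : ℝ) : ℝ := ∫ ξ in Ioi x, m ξ

theorem hasDerivAt_tailIntegral {m : ℝ → ℝ} (hm : Continuous m) (hi : Integrable m) (x : ℝ) :
    HasDerivAt (tailIntegral m) (-m x) x := by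
  have h1 : tailIntegral m = fun x => (∫ ξ in Ioi (0 : ℝ), m ξ) - ∫ ξ in (0 : ℝ)..x, m ξ := by
    funext y
    rw [← intervalIntegral.integral_interval_add_Ioi (a := 0) (b := y) hi.integrableOn
      hi.integrableOn, tailIntegral]
    ring
  rw [h1]
  exact (hm.integral_hasStrictDerivAt 0 x).hasDerivAt.const_sub _

theorem tendsto_tailIntegral {m : ℝ → ℝ} (hi : Integrable m) :
    Tendsto (tailIntegral m) atTop (𝓝 0) := by
  have h1 : tailIntegral m = fun x => (∫ ξ in Ioi (0 : ℝ), m ξ) - ∫ ξ in (0 : ℝ)..x, m ξ := by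
    funext y
    rw [← intervalIntegral.integral_interval_add_Ioi (a := 0) (b := y) hi.integrableOn
      hi.integrableOn, tailIntegral]
    ring
  rw [h1]
  simpa using (intervalIntegral_tendsto_integral_Ioi 0 hi.integrableOn tendsto_id).const_sub
    (∫ ξ in Ioi (0 : ℝ), m ξ)

theorem tailIntegral_nonneg {m : ℝ → ℝ} (h0 : ∀ x, 0 ≤ m x) (x : ℝ) : 0 ≤ tailIntegral m x :=
  integral_nonneg h0

theorem tailIntegral_le {m : ℝ → ℝ} (h0 : ∀ x, 0 ≤ m x) (hi : Integrable m) (x : ℝ) :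
    tailIntegral m x ≤ ∫ ξ, m ξ :=
  setIntegral_le_integral hi (Eventually.of_forall h0)

/-- The integrand is, up to the constant `C`, minus the derivative of `tailIntegral m ^ (n + 1) / (n
+ 1)!`, which tends to `0` at infinity. This is what produces the factorials in the Neumann series.
-/
theorem integral_mul_tailIntegral_pow {m : ℝ → ℝ} (hm : Continuous m) (hi : Integrable m)
    (h0 : ∀ x, 0 ≤ m x) (C : ℝ) (n : ℕ) (x : ℝ) :
    IntegrableOn (fun ξ => m ξ * (C * (tailIntegral m ξ ^ n / n.factorial))) (Ioi x) ∧
    ∫ ξ in Ioi x, m ξ * (C * (tailIntegral m ξ ^ n / n.factorial)) =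
      C * (tailIntegral m x ^ (n + 1) / (n + 1).factorial) := by
  have hd : ∀ ξ ∈ Ici x, HasDerivAt (fun ξ => -(tailIntegral m ξ ^ (n + 1) / (n + 1).factorial))
      (m ξ * (tailIntegral m ξ ^ n / n.factorial)) ξ := by
    intro ξ _
    refine ((((hasDerivAt_tailIntegral hm hi ξ).pow (n + 1)).div_const
      ((n + 1).factorial : ℝ)).neg).congr_deriv ?_
    rw [Nat.factorial_succ]
    push_cast
    field_simp
  have hpos : ∀ ξ ∈ Ioi x, 0 ≤ m ξ * (tailIntegral m ξ ^ n / n.factorial) := fun ξ _ =>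
    mul_nonneg (h0 ξ) (div_nonneg (pow_nonneg (tailIntegral_nonneg h0 ξ) _) (by positivity))
  have hlim : Tendsto (fun ξ => -(tailIntegral m ξ ^ (n + 1) / (n + 1).factorial)) atTop (𝓝 0) := by
    simpa using (((tendsto_tailIntegral hi).pow (n + 1)).div_const ((n + 1).factorial : ℝ)).neg
  have e : (fun ξ => m ξ * (C * (tailIntegral m ξ ^ n / n.factorial))) =
      fun ξ => C * (m ξ * (tailIntegral m ξ ^ n / n.factorial)) := by
    funext ξ; ring
  rw [e]
  refine ⟨(integrableOn_Ioi_deriv_of_nonneg' hd hpos hlim).const_mul C, ?_⟩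
  rw [integral_const_mul, integral_Ioi_of_hasDerivAt_of_nonneg' hd hpos hlim]
  ring

/-- The Picard iterates of the Volterra equation `f x = g x + ∫_x^∞ K x ξ (f ξ) dξ`. -/
def volterraIter (K : ℝ → ℝ → F →L[ℂ] F) (g : ℝ → F) : ℕ → ℝ → F
  | 0 => g
  | n + 1 => fun x => ∫ ξ in Ioi x, K x ξ (volterraIter K g n ξ)

/-- The Neumann series of the Volterra equation `f x = g x + ∫_x^∞ K x ξ (f ξ) dξ`. -/
def volterraSol (K : ℝ → ℝ → F →L[ℂ] F) (g : ℝ → F) (x : ℝ) : F := ∑' n, volterraIter K g n x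

/-- A continuous, integrable and nonnegative weight. -/
structure IsWeight (m : ℝ → ℝ) : Prop where
  continuous : Continuous m
  integrable : Integrable m
  nonneg : ∀ x, 0 ≤ m x

variable {m : ℝ → ℝ} {K : ℝ → ℝ → F →L[ℂ] F} {g : ℝ → F} {C : ℝ}

theorem norm_volterraIter_le (hm : IsWeight m) (hK : ∀ x ξ, x < ξ → ‖K x ξ‖ ≤ m ξ)
    (hg : ∀ x, ‖g x‖ ≤ C) (n : ℕ) (x : ℝ) :
    ‖volterraIter K g n x‖ ≤ C * (tailIntegral m x ^ n / n.factorial) := by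
  induction n generalizing x with
  | zero => simpa [volterraIter] using hg x
  | succ n ih =>
    obtain ⟨h1, h2⟩ := integral_mul_tailIntegral_pow hm.continuous hm.integrable hm.nonneg C n x
    rw [← h2]
    refine norm_integral_le_of_norm_le h1 ?_
    refine (ae_restrict_mem measurableSet_Ioi).mono fun ξ hξ => ?_
    exact ((K x ξ).le_opNorm _).trans (mul_le_mul (hK x ξ hξ) (ih ξ) (norm_nonneg _) (hm.nonneg ξ))

theorem summable_const_mul_pow_div_factorial (C M : ℝ) :
    Summable fun n : ℕ => C * (M ^ n / n.factorial) :=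
  (Real.summable_pow_div_factorial M).mul_left C

theorem norm_volterraIter_le_integral (hm : IsWeight m) (hK : ∀ x ξ, x < ξ → ‖K x ξ‖ ≤ m ξ)
    (hg : ∀ x, ‖g x‖ ≤ C) (n : ℕ) (x : ℝ) :
    ‖volterraIter K g n x‖ ≤ C * ((∫ ξ, m ξ) ^ n / n.factorial) := by
  refine (norm_volterraIter_le hm hK hg n x).trans ?_
  have hC : 0 ≤ C := (norm_nonneg _).trans (hg 0)
  have := tailIntegral_nonneg hm.nonneg x
  have := tailIntegral_le hm.nonneg hm.integrable x
  gcongr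

/-- Bounded solutions of the homogeneous Volterra equation vanish. -/
theorem eq_zero_of_volterra (hm : IsWeight m) (hK : ∀ x ξ, x < ξ → ‖K x ξ‖ ≤ m ξ) {a : ℝ}
    {d : ℝ → F} (hd : ∀ x, a ≤ x → d x = ∫ ξ in Ioi x, K x ξ (d ξ))
    (hC : ∀ x, a ≤ x → ‖d x‖ ≤ C) {x : ℝ} (hx : a ≤ x) : d x = 0 := by
  have key : ∀ (n : ℕ) (x : ℝ), a ≤ x → ‖d x‖ ≤ C * (tailIntegral m x ^ n / n.factorial) := by
    intro n
    induction n with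
    | zero => simpa using hC
    | succ n ih =>
      intro x hx
      obtain ⟨h1, h2⟩ := integral_mul_tailIntegral_pow hm.continuous hm.integrable hm.nonneg C n x
      rw [← h2, hd x hx]
      refine norm_integral_le_of_norm_le h1 ?_
      refine (ae_restrict_mem measurableSet_Ioi).mono fun ξ hξ => ?_
      exact ((K x ξ).le_opNorm _).trans (mul_le_mul (hK x ξ hξ) (ih ξ (hx.trans (le_of_lt hξ)))
        (norm_nonneg _) (hm.nonneg ξ))
  have hlim := (summable_const_mul_pow_div_factorial C (tailIntegral m x)).tendsto_atTop_zero
  exact norm_le_zero_iff.1 (ge_of_tendsto' hlim fun n => key n x hx)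

/-- A family of Volterra kernels dominated by a weight `m`. -/
structure IsVolterraKernel {P : Type*} [TopologicalSpace P] (m : ℝ → ℝ)
    (K : P → ℝ → ℝ → F →L[ℂ] F) : Prop where
  continuous : ∀ ξ, Continuous fun q : P × ℝ => K q.1 q.2 ξ
  aestronglyMeasurable : ∀ p x, AEStronglyMeasurable (K p x) volume
  norm_le : ∀ p x ξ, x < ξ → ‖K p x ξ‖ ≤ m ξ

section Family

variable {P : Type*} [TopologicalSpace P] {KP : P → ℝ → ℝ → F →L[ℂ] F} {gP : P → ℝ → F}

theorem aestronglyMeasurable_clm_apply {α : Type*} [MeasurableSpace α] {μ : Measure α}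
    {L : α → F →L[ℂ] F} {f : α → F} (hL : AEStronglyMeasurable L μ)
    (hf : AEStronglyMeasurable f μ) : AEStronglyMeasurable (fun x => L x (f x)) μ :=
  (ContinuousLinearMap.id ℂ (F →L[ℂ] F)).aestronglyMeasurable_comp₂ hL hf

theorem continuous_volterraIter [FirstCountableTopology P] (hm : IsWeight m)
    (hK : IsVolterraKernel m KP) (hg : Continuous fun q : P × ℝ => gP q.1 q.2)
    (hC : ∀ p x, ‖gP p x‖ ≤ C) (n : ℕ) :
    Continuous fun q : P × ℝ => volterraIter (KP q.1) (gP q.1) n q.2 := by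
  induction n with
  | zero => exact hg
  | succ n ih =>
    -- The domain of integration moves with `x`; an indicator fixes it, so that dominated
    -- convergence applies.
    have e : (fun q : P × ℝ => volterraIter (KP q.1) (gP q.1) (n + 1) q.2) = fun q : P × ℝ =>
        ∫ ξ, (Ioi q.2).indicator (fun ξ => KP q.1 q.2 ξ (volterraIter (KP q.1) (gP q.1) n ξ)) ξ := by
      funext q
      rw [integral_indicator measurableSet_Ioi]
      rfl
    rw [e, continuous_iff_continuousAt]
    intro q₀
    refine continuousAt_of_dominated
      (bound := fun ξ => m ξ * (C * ((∫ ξ, m ξ) ^ n / n.factorial)))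
      (Eventually.of_forall fun q => ?_) (Eventually.of_forall fun q => ae_of_all _ fun ξ => ?_)
      (hm.integrable.mul_const _) ?_
    · refine AEStronglyMeasurable.indicator ?_ measurableSet_Ioi
      exact aestronglyMeasurable_clm_apply (hK.aestronglyMeasurable _ _)
        (ih.comp (Continuous.prodMk_right q.1)).aestronglyMeasurable
    · by_cases h : ξ ∈ Ioi q.2
      · rw [indicator_of_mem h]
        exact ((KP q.1 q.2 ξ).le_opNorm _).trans (mul_le_mul (hK.norm_le _ _ _ h)
          (norm_volterraIter_le_integral hm (hK.norm_le _) (hC _) _ _) (norm_nonneg _)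
          (hm.nonneg ξ))
      · rw [indicator_of_notMem h, norm_zero]
        have : ‖volterraIter (KP q.1) (gP q.1) n ξ‖ ≤ _ :=
          norm_volterraIter_le_integral hm (hK.norm_le _) (hC _) _ _
        exact mul_nonneg (hm.nonneg ξ) ((norm_nonneg _).trans this)
    -- The indicator jumps only at `ξ = q₀.2`, a null set.
    · have hne : ∀ᵐ ξ : ℝ, ξ ≠ q₀.2 := by
        simp [ae_iff, measure_singleton]
      filter_upwards [hne] with ξ hξ
      have hcont : Continuous fun q : P × ℝ =>
          KP q.1 q.2 ξ (volterraIter (KP q.1) (gP q.1) n ξ) :=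
        (hK.continuous ξ).clm_apply (ih.comp (continuous_fst.prodMk continuous_const))
      rcases lt_or_gt_of_ne hξ with h | h
      · refine (continuousAt_const (y := (0 : F))).congr ?_
        have : ∀ᶠ q : P × ℝ in 𝓝 q₀, ξ < q.2 := continuousAt_snd.eventually (lt_mem_nhds h)
        filter_upwards [this] with q hq
        rw [indicator_of_notMem (by simpa using hq.le)]
      · refine hcont.continuousAt.congr ?_
        have : ∀ᶠ q : P × ℝ in 𝓝 q₀, q.2 < ξ := continuousAt_snd.eventually (gt_mem_nhds h)
        filter_upwards [this] with q hq
        rw [indicator_of_mem (by simpa using hq)]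

theorem norm_volterraSol_le (hm : IsWeight m) (hK : ∀ x ξ, x < ξ → ‖K x ξ‖ ≤ m ξ)
    (hg : ∀ x, ‖g x‖ ≤ C) (x : ℝ) :
    ‖volterraSol K g x‖ ≤ ∑' n : ℕ, C * ((∫ ξ, m ξ) ^ n / n.factorial) :=
  tsum_of_norm_bounded (summable_const_mul_pow_div_factorial C _).hasSum
    fun n => norm_volterraIter_le_integral hm hK hg n x

variable [CompleteSpace F]

theorem continuous_volterraSol [FirstCountableTopology P] (hm : IsWeight m)
    (hK : IsVolterraKernel m KP) (hg : Continuous fun q : P × ℝ => gP q.1 q.2)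
    (hC : ∀ p x, ‖gP p x‖ ≤ C) :
    Continuous fun q : P × ℝ => volterraSol (KP q.1) (gP q.1) q.2 :=
  continuous_tsum (continuous_volterraIter hm hK hg hC)
    (summable_const_mul_pow_div_factorial C (∫ ξ, m ξ))
    fun n _ => norm_volterraIter_le_integral hm (hK.norm_le _) (hC _) n _

theorem volterraSol_eq [FirstCountableTopology P] (hm : IsWeight m)
    (hK : IsVolterraKernel m KP) (hg : Continuous fun q : P × ℝ => gP q.1 q.2)
    (hC : ∀ p x, ‖gP p x‖ ≤ C) (p : P) (x : ℝ) :
    volterraSol (KP p) (gP p) x =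
      gP p x + ∫ ξ in Ioi x, KP p x ξ (volterraSol (KP p) (gP p) ξ) := by
  have hb := norm_volterraIter_le_integral hm (hK.norm_le p) (hC p)
  have hsum : ∀ x, Summable fun n => volterraIter (KP p) (gP p) n x := fun x =>
    Summable.of_norm_bounded (summable_const_mul_pow_div_factorial C (∫ ξ, m ξ)) fun n => hb n x
  have hmeas : ∀ n, AEStronglyMeasurable
      (fun ξ => KP p x ξ (volterraIter (KP p) (gP p) n ξ)) (volume.restrict (Ioi x)) := fun n =>
    aestronglyMeasurable_clm_apply (hK.aestronglyMeasurable _ _).restrict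
      ((continuous_volterraIter hm hK hg hC n).comp
        (Continuous.prodMk_right p)).aestronglyMeasurable
  have hbound : ∀ n, ∀ᵐ ξ ∂(volume.restrict (Ioi x)),
      ‖KP p x ξ (volterraIter (KP p) (gP p) n ξ)‖ ≤
        m ξ * (C * ((∫ ξ, m ξ) ^ n / n.factorial)) := fun n =>
    (ae_restrict_mem measurableSet_Ioi).mono fun ξ hξ =>
      ((KP p x ξ).le_opNorm _).trans (mul_le_mul (hK.norm_le _ _ _ hξ) (hb n ξ) (norm_nonneg _)
        (hm.nonneg ξ))
  have hint : ∀ n, IntegrableOn (fun ξ => KP p x ξ (volterraIter (KP p) (gP p) n ξ)) (Ioi x) :=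
    fun n => Integrable.mono' (hm.integrable.integrableOn.mul_const _) (hmeas n) (hbound n)
  have hswap := hasSum_integral_of_summable_integral_norm hint
    (Summable.of_nonneg_of_le (fun n => integral_nonneg fun _ => norm_nonneg _)
      (fun n => integral_mono_ae (hint n).norm (hm.integrable.integrableOn.mul_const _) (hbound n))
      (by
        simp_rw [integral_mul_const]
        exact (summable_const_mul_pow_div_factorial C _).mul_left _))
  rw [volterraSol, (hsum x).tsum_eq_zero_add]
  congr 1
  rw [show (fun n => volterraIter (KP p) (gP p) (n + 1) x) =
    fun n => ∫ ξ in Ioi x, KP p x ξ (volterraIter (KP p) (gP p) n ξ) from rfl, hswap.tsum_eq]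
  congr 1
  funext ξ
  rw [volterraSol, (KP p x ξ).map_tsum (hsum ξ)]

/-- Each Picard iterate is holomorphic by differentiation under the integral, and the factorial
bounds are uniform on `Ω`, so the Weierstrass theorem passes holomorphy to the sum. -/
theorem differentiableOn_volterraSol {Ω : Set ℂ} (hΩ : IsOpen Ω) {K : ℂ → ℝ → ℝ → F →L[ℂ] F}
    {g : ℂ → ℝ → F} (hm : IsWeight m) (hK : IsVolterraKernel m fun s : Ω => K s)
    (hKd : ∀ x ξ, DifferentiableOn ℂ (fun s => K s x ξ) Ω)
    (hg : Continuous fun q : Ω × ℝ => g q.1 q.2) (hC : ∀ s ∈ Ω, ∀ x, ‖g s x‖ ≤ C)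
    (hgd : ∀ x, DifferentiableOn ℂ (fun s => g s x) Ω) (x : ℝ) :
    DifferentiableOn ℂ (fun s => volterraSol (K s) (g s) x) Ω := by
  have hb : ∀ s ∈ Ω, ∀ n x, ‖volterraIter (K s) (g s) n x‖ ≤ _ := fun s hs =>
    norm_volterraIter_le_integral hm (hK.norm_le ⟨s, hs⟩) (hC s hs)
  refine Complex.differentiableOn_tsum_of_summable_norm
    (summable_const_mul_pow_div_factorial C (∫ ξ, m ξ)) (fun n => ?_) hΩ
    fun n s hs => hb s hs n x
  induction n generalizing x with
  | zero => exact hgd x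
  | succ n ih =>
    refine differentiableOn_integral_of_dominated hΩ
      (bound := fun ξ => m ξ * (C * ((∫ ξ, m ξ) ^ n / n.factorial))) (fun s hs => ?_)
      (ae_of_all _ fun ξ => (hKd x ξ).clm_apply (ih ξ)) ?_
      (hm.integrable.integrableOn.mul_const _)
    · exact aestronglyMeasurable_clm_apply (hK.aestronglyMeasurable ⟨s, hs⟩ _).restrict
        ((continuous_volterraIter hm hK hg (fun s x => hC s s.2 x) n).comp
          (Continuous.prodMk_right (⟨s, hs⟩ : Ω))).aestronglyMeasurable
    · refine (ae_restrict_mem measurableSet_Ioi).mono fun ξ hξ s hs => ?_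
      exact ((K s x ξ).le_opNorm _).trans (mul_le_mul (hK.norm_le ⟨s, hs⟩ _ _ hξ)
        (hb s hs n ξ) (norm_nonneg _) (hm.nonneg ξ))

end Family

end Volterra

/-! ### The jets of a Schwartz function -/

section Jets

open scoped LineDeriv

variable (r : 𝓢(ℝ × ℝ, ℂ))

theorem hasDerivAt_schwartz_fst (f : 𝓢(ℝ × ℝ, ℂ)) (z t : ℝ) :
    HasDerivAt (fun x => f (x, t)) (∂_{((1 : ℝ), (0 : ℝ))} f (z, t)) z := by
  rw [SchwartzMap.lineDerivOp_apply_eq_fderiv]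
  exact (f.hasFDerivAt (z, t)).comp_hasDerivAt z ((hasDerivAt_id z).prodMk (hasDerivAt_const z t))

theorem hasDerivAt_schwartz_snd (f : 𝓢(ℝ × ℝ, ℂ)) (z t : ℝ) :
    HasDerivAt (fun x => f (z, x)) (∂_{((0 : ℝ), (1 : ℝ))} f (z, t)) t := by
  rw [SchwartzMap.lineDerivOp_apply_eq_fderiv]
  exact (f.hasFDerivAt (z, t)).comp_hasDerivAt t ((hasDerivAt_const t z).prodMk (hasDerivAt_id t))

/-- `r_z` as a Schwartz function. -/
def rzS : 𝓢(ℝ × ℝ, ℂ) := ∂_{((1 : ℝ), (0 : ℝ))} r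

/-- `r_zz` as a Schwartz function. -/
def rzzS : 𝓢(ℝ × ℝ, ℂ) := ∂_{((1 : ℝ), (0 : ℝ))} (rzS r)

/-- `r_t` as a Schwartz function. -/
def rtS : 𝓢(ℝ × ℝ, ℂ) := ∂_{((0 : ℝ), (1 : ℝ))} r

theorem rz_eq (z t : ℝ) : rz r z t = rzS r (z, t) := (hasDerivAt_schwartz_fst r z t).deriv

theorem rzz_eq (z t : ℝ) : rzz r z t = rzzS r (z, t) := by
  simp only [rzz, rz_eq]
  exact (hasDerivAt_schwartz_fst (rzS r) z t).deriv

theorem rt_eq (z t : ℝ) : rt r z t = rtS r (z, t) := (hasDerivAt_schwartz_snd r z t).deriv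

theorem hasDerivAt_r_fst (z t : ℝ) : HasDerivAt (fun x => r (x, t)) (rz r z t) z := by
  rw [rz_eq]; exact hasDerivAt_schwartz_fst r z t

theorem hasDerivAt_rz_fst (z t : ℝ) : HasDerivAt (fun x => rz r x t) (rzz r z t) z := by
  simp only [rz_eq, rzz_eq]; exact hasDerivAt_schwartz_fst (rzS r) z t

theorem hasDerivAt_r_snd (z t : ℝ) : HasDerivAt (fun x => r (z, x)) (rt r z t) t := by
  rw [rt_eq]; exact hasDerivAt_schwartz_snd r z t

theorem hasDerivAt_conj {f : ℝ → ℂ} {f' : ℂ} {x : ℝ} (h : HasDerivAt f f' x) :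
    HasDerivAt (fun x => conj (f x)) (conj f') x :=
  Complex.conjCLE.toContinuousLinearMap.hasFDerivAt.comp_hasDerivAt x h

theorem norm_sq_eq_mul_conj (w : ℂ) : (‖w‖ : ℂ) ^ 2 = w * conj w := (Complex.mul_conj' w).symm

end Jets

/-! ### The phase -/

section Phase

variable (r : 𝓢(ℝ × ℝ, ℂ))

theorem Theta1_eq (z t : ℝ) : Theta1 r z t = (1 / 4) * (r (z, t) * conj (r (z, t))) := by
  rw [Theta1, norm_sq_eq_mul_conj]

theorem Theta2_eq (z t : ℝ) : Theta2 r z t = (1 / 8) * (r (z, t) * conj (r (z, t))) ^ 2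
    + (I / 4) * (conj (r (z, t)) * rz r z t - r (z, t) * conj (rz r z t)) := by
  rw [Theta2, ← norm_sq_eq_mul_conj]; ring

theorem continuous_Theta1 : Continuous fun p : ℝ × ℝ => Theta1 r p.1 p.2 := by
  simp only [Theta1_eq]
  have := r.continuous
  have := Complex.continuous_conj
  fun_prop

theorem continuous_Theta2 : Continuous fun p : ℝ × ℝ => Theta2 r p.1 p.2 := by
  simp only [Theta2_eq, rz_eq]
  have := r.continuous
  have := (rzS r).continuous
  have := Complex.continuous_conj
  fun_prop

theorem conj_Theta1 (z t : ℝ) : conj (Theta1 r z t) = Theta1 r z t := by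
  simp only [Theta1, map_mul, map_pow, conj_ofReal, map_div₀, map_one, map_ofNat]

theorem conj_Theta2 (z t : ℝ) : conj (Theta2 r z t) = Theta2 r z t := by
  simp only [Theta2, map_add, map_mul, map_pow, map_sub, map_div₀, conj_ofReal, conj_I, conj_conj,
    map_one, map_ofNat]
  ring

theorem conj_theta (z t : ℝ) : conj (theta r z t) = theta r z t := by
  have h : ∀ (f : ℝ → ℂ) (b : ℝ), (∀ x, conj (f x) = f x) →
      conj (∫ x in (0 : ℝ)..b, f x) = ∫ x in (0 : ℝ)..b, f x := by
    intro f b hf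
    simp only [intervalIntegral, map_sub, ← integral_conj, hf]
  rw [theta, map_add, h _ _ (conj_Theta2 r 0), h _ _ fun ζ => conj_Theta1 r ζ t]

theorem theta_im (z t : ℝ) : (theta r z t).im = 0 := Complex.conj_eq_iff_im.1 (conj_theta r z t)

/-- The phase is real, so the gauge factors are unimodular and leave all decay estimates intact. -/
theorem norm_exp_I_mul_theta (c z t : ℝ) : ‖exp (c * (I * theta r z t))‖ = 1 := by
  simp [Complex.norm_exp, theta_im]

theorem continuous_theta : Continuous fun p : ℝ × ℝ => theta r p.1 p.2 := by
  have h1 : Continuous (Function.uncurry fun (_ : ℝ × ℝ) (τ : ℝ) => Theta2 r 0 τ) :=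
    (continuous_Theta2 r).comp (f := fun q : (ℝ × ℝ) × ℝ => ((0 : ℝ), q.2)) (by fun_prop)
  have h2 : Continuous (Function.uncurry fun (p : ℝ × ℝ) (ζ : ℝ) => Theta1 r ζ p.2) :=
    (continuous_Theta1 r).comp (f := fun q : (ℝ × ℝ) × ℝ => (q.2, q.1.2)) (by fun_prop)
  unfold theta
  exact (intervalIntegral.continuous_parametric_intervalIntegral_of_continuous h1
    continuous_snd).add
    (intervalIntegral.continuous_parametric_intervalIntegral_of_continuous h2 continuous_fst)

theorem hasDerivAt_theta_fst (z t : ℝ) :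
    HasDerivAt (fun x => theta r x t) (Theta1 r z t) z := by
  have hc : Continuous fun ζ => Theta1 r ζ t :=
    (continuous_Theta1 r).comp (f := fun ζ : ℝ => (ζ, t)) (by fun_prop)
  unfold theta
  exact (hc.integral_hasStrictDerivAt 0 z).hasDerivAt.const_add _

/-- The path of integration ends with a segment parallel to the `z`-axis, so the `t`-derivative can
be read off directly only on `z = 0`. For `z > 0` the closedness of the form is needed; see
`IsSolution.exp_theta_eq`. -/
theorem hasDerivAt_theta_zero_snd (t : ℝ) :
    HasDerivAt (fun x => theta r 0 x) (Theta2 r 0 t) t := by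
  have hc : Continuous fun τ => Theta2 r 0 τ :=
    (continuous_Theta2 r).comp (f := fun τ : ℝ => ((0 : ℝ), τ)) (by fun_prop)
  have h := (hc.integral_hasStrictDerivAt 0 t).hasDerivAt
  have e : (fun x => theta r 0 x) = fun x => ∫ τ in (0 : ℝ)..x, Theta2 r 0 τ := by
    funext x
    rw [theta, intervalIntegral.integral_same, add_zero]
  rw [e]
  exact h

theorem theta_zero_zero : theta r 0 0 = 0 := by simp [theta]

end Phase

/-! ### The coefficients of the Lax pair -/

section Coefficients

/-- The decay rate `(1 + ‖p‖)⁻²`. -/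
def decay (p : ℝ × ℝ) : ℝ := ((1 + ‖p‖) ^ 2)⁻¹

theorem decay_nonneg (p : ℝ × ℝ) : 0 ≤ decay p := by unfold decay; positivity

theorem decay_le_one (p : ℝ × ℝ) : decay p ≤ 1 :=
  inv_le_one_of_one_le₀ (one_le_pow₀ (by linarith [norm_nonneg p]))

theorem decay_le_of_abs_le {p : ℝ × ℝ} {x : ℝ} (h : |x| ≤ ‖p‖) : decay p ≤ (1 + x ^ 2)⁻¹ := by
  refine inv_anti₀ (by positivity) ?_
  rw [← sq_abs x]
  nlinarith [abs_nonneg x]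

theorem decay_le_fst (z t : ℝ) : decay (z, t) ≤ (1 + z ^ 2)⁻¹ :=
  decay_le_of_abs_le (norm_fst_le (z, t))

theorem decay_le_snd (z t : ℝ) : decay (z, t) ≤ (1 + t ^ 2)⁻¹ :=
  decay_le_of_abs_le (norm_snd_le (z, t))

/-- A function of `(z, t)` and the spectral parameter that is continuous, entire in the spectral
parameter and decays in `(z, t)`, locally uniformly in the spectral parameter. -/
structure IsCoeff (Q : ℝ × ℝ → ℂ → ℂ) : Prop where
  continuous : Continuous fun q : (ℝ × ℝ) × ℂ => Q q.1 q.2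
  differentiable : ∀ p, Differentiable ℂ (Q p)
  bound : ∀ ρ : ℝ, ∃ C, 0 ≤ C ∧ ∀ p s, ‖s‖ ≤ ρ → ‖Q p s‖ ≤ C * decay p

theorem isCoeff_schwartz (f : 𝓢(ℝ × ℝ, ℂ)) : IsCoeff fun p _ => f p where
  continuous := f.continuous.comp continuous_fst
  differentiable p := differentiable_const _
  bound ρ := by
    have h := fun p => SchwartzMap.one_add_le_sup_seminorm_apply (𝕜 := ℂ) (m := (2, 0)) le_rfl
      le_rfl f p
    simp only [norm_iteratedFDeriv_zero] at h
    refine ⟨_, (mul_nonneg (by positivity) (norm_nonneg _)).trans (h 0), fun p s _ => ?_⟩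
    rw [decay, ← div_eq_mul_inv, le_div_iff₀ (by positivity), mul_comm]
    exact h p

variable {Q Q' : ℝ × ℝ → ℂ → ℂ}

theorem IsCoeff.add (h : IsCoeff Q) (h' : IsCoeff Q') : IsCoeff fun p s => Q p s + Q' p s where
  continuous := h.continuous.add h'.continuous
  differentiable p := (h.differentiable p).add (h'.differentiable p)
  bound ρ := by
    obtain ⟨C, hC, hb⟩ := h.bound ρ
    obtain ⟨C', hC', hb'⟩ := h'.bound ρ
    refine ⟨C + C', by positivity, fun p s hs => (norm_add_le _ _).trans ?_⟩
    linarith [hb p s hs, hb' p s hs]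

theorem IsCoeff.bounded_mul (h : IsCoeff Q) {c : ℝ × ℝ → ℂ → ℂ}
    (hc : Continuous fun q : (ℝ × ℝ) × ℂ => c q.1 q.2) (hd : ∀ p, Differentiable ℂ (c p))
    (hb : ∀ ρ : ℝ, ∃ C, ∀ p s, ‖s‖ ≤ ρ → ‖c p s‖ ≤ C) : IsCoeff fun p s => c p s * Q p s where
  continuous := hc.mul h.continuous
  differentiable p := (hd p).mul (h.differentiable p)
  bound ρ := by
    obtain ⟨C, hC, hQ⟩ := h.bound ρ
    obtain ⟨C', hC'⟩ := hb ρ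
    refine ⟨max C' 0 * C, by positivity, fun p s hs => ?_⟩
    rw [norm_mul, mul_assoc]
    exact mul_le_mul ((hC' p s hs).trans (le_max_left _ _)) (hQ p s hs) (norm_nonneg _)
      (le_max_right _ _)

theorem IsCoeff.mul (h : IsCoeff Q) (h' : IsCoeff Q') : IsCoeff fun p s => Q p s * Q' p s :=
  h'.bounded_mul h.continuous h.differentiable fun ρ => by
    obtain ⟨C, hC, hb⟩ := h.bound ρ
    exact ⟨C, fun p s hs => (hb p s hs).trans (mul_le_of_le_one_right hC (decay_le_one p))⟩

theorem IsCoeff.entire_mul (h : IsCoeff Q) {c : ℂ → ℂ} (hc : Differentiable ℂ c) :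
    IsCoeff fun p s => c s * Q p s :=
  h.bounded_mul (hc.continuous.comp continuous_snd) (fun _ => hc) fun ρ => by
    obtain ⟨C, hC⟩ := (isCompact_closedBall (0 : ℂ) ρ).exists_bound_of_continuousOn
      hc.continuous.continuousOn
    exact ⟨C, fun p s hs => hC s (by simpa using hs)⟩

theorem IsCoeff.const_mul (h : IsCoeff Q) (c : ℂ) : IsCoeff fun p s => c * Q p s :=
  h.entire_mul (differentiable_const c)

theorem IsCoeff.neg (h : IsCoeff Q) : IsCoeff fun p s => -Q p s := by
  simpa using h.const_mul (-1)

theorem IsCoeff.sub (h : IsCoeff Q) (h' : IsCoeff Q') : IsCoeff fun p s => Q p s - Q' p s := by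
  simpa [sub_eq_add_neg] using h.add h'.neg

theorem IsCoeff.conj_const {f : ℝ × ℝ → ℂ} (h : IsCoeff fun p _ => f p) :
    IsCoeff fun p _ => conj (f p) where
  continuous := Complex.continuous_conj.comp h.continuous
  differentiable p := differentiable_const _
  bound ρ := by simpa using h.bound ρ

theorem IsCoeff.exp_mul (h : IsCoeff Q) (r : 𝓢(ℝ × ℝ, ℂ)) (c : ℝ) :
    IsCoeff fun p s => exp (c * (I * theta r p.1 p.2)) * Q p s := by
  refine h.bounded_mul ?_ (fun p => differentiable_const _) fun ρ => ⟨1, fun p s _ => ?_⟩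
  · have := (continuous_theta r).comp (continuous_fst (X := ℝ × ℝ) (Y := ℂ))
    fun_prop
  · rw [norm_exp_I_mul_theta]

variable (r : 𝓢(ℝ × ℝ, ℂ))

/-- `|r|²` as a polynomial in `r` and its conjugate. -/
def nr (z t : ℝ) : ℂ := r (z, t) * conj (r (z, t))

/-- The square of `R` is scalar, so all powers of `R` in the Lax pair reduce to multiples of `1` and
`R`. -/
theorem R_sq (z t : ℝ) : R r z t ^ 2 = (-nr r z t) • (1 : Matrix (Fin 2) (Fin 2) ℂ) := by
  ext i j
  fin_cases i <;> fin_cases j <;>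
    simp [R, nr, pow_two, Matrix.mul_apply, Fin.sum_univ_two, mul_comm]

/-- The off-diagonal entry of `B`. -/
def bOff (z t : ℝ) (s : ℂ) : ℂ :=
  -2 * s ^ 3 * r (z, t) + s * (r (z, t) + I * rz r z t + 1 / 2 * nr r z t * r (z, t))

/-- The other off-diagonal entry of `B`. -/
def bOff' (z t : ℝ) (s : ℂ) : ℂ :=
  2 * s ^ 3 * conj (r (z, t)) + s * (-conj (r (z, t)) + I * conj (rz r z t)
    - 1 / 2 * nr r z t * conj (r (z, t)))

/-- The diagonal entry of `B`. -/
def bDiag (z t : ℝ) (s : ℂ) : ℂ :=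
  I * s ^ 2 * nr r z t - I / 8 * nr r z t ^ 2
    + 1 / 4 * (conj (r (z, t)) * rz r z t - r (z, t) * conj (rz r z t))

theorem A_eq (z t : ℝ) (s : ℂ) : A r z t s =
    !![-(I / 4) * nr r z t, s * r (z, t); -s * conj (r (z, t)), I / 4 * nr r z t] := by
  rw [A, R_sq]
  ext i j
  fin_cases i <;> fin_cases j <;> simp [R, sigma]

theorem B_eq (z t : ℝ) (s : ℂ) : B r z t s =
    !![bDiag r z t s, bOff r z t s; bOff' r z t s, -bDiag r z t s] := by
  have h3 : R r z t ^ 3 = (-nr r z t) • R r z t := by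
    rw [pow_succ, R_sq, Matrix.smul_mul, Matrix.one_mul]
  have h4 : R r z t ^ 4 = (nr r z t ^ 2) • (1 : Matrix (Fin 2) (Fin 2) ℂ) := by
    rw [show 4 = 2 * 2 by rfl, pow_mul, R_sq, smul_pow, one_pow, neg_sq]
  rw [B, h3, h4, R_sq]
  ext i j
  fin_cases i <;> fin_cases j <;>
    simp [R, Rz, sigma, bDiag, bOff, bOff'] <;> first | ring1 | (left; ring1)

theorem hatExp_eq (x : ℂ) (M : Matrix (Fin 2) (Fin 2) ℂ) : hatExp x M =
    !![M 0 0, exp (2 * x) * M 0 1; exp (-2 * x) * M 1 0, M 1 1] := by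
  have h1 : exp x * exp x = exp (2 * x) := by rw [← Complex.exp_add]; ring_nf
  have h2 : exp (-x) * exp (-x) = exp (-2 * x) := by rw [← Complex.exp_add]; ring_nf
  have h3 : exp x * exp (-x) = 1 := by rw [← Complex.exp_add]; simp
  ext i j
  fin_cases i <;> fin_cases j <;>
    simp [hatExp, expSigma, Matrix.mul_apply, Matrix.vecMul, dotProduct, Fin.sum_univ_two]
  · linear_combination M 0 0 * h3
  · linear_combination M 0 1 * h1
  · rw [← neg_mul]; linear_combination M 1 0 * h2
  · linear_combination M 1 1 * h3

theorem isCoeff_r : IsCoeff fun p _ => r p := isCoeff_schwartz r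

theorem isCoeff_rz : IsCoeff fun p _ => rz r p.1 p.2 := by
  simp only [rz_eq]
  exact isCoeff_schwartz (rzS r)

theorem isCoeff_nr : IsCoeff fun p _ => nr r p.1 p.2 := (isCoeff_r r).mul (isCoeff_r r).conj_const

theorem isCoeff_A (i j : Fin 2) : IsCoeff fun p s => A r p.1 p.2 s i j := by
  simp only [A_eq]
  fin_cases i <;> fin_cases j
  · exact (isCoeff_nr r).const_mul _
  · exact (isCoeff_r r).entire_mul differentiable_id
  · exact (isCoeff_r r).conj_const.entire_mul differentiable_id.neg
  · exact (isCoeff_nr r).const_mul _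

theorem isCoeff_B (i j : Fin 2) : IsCoeff fun p s => B r p.1 p.2 s i j := by
  have h := isCoeff_r r
  have hz := isCoeff_rz r
  have hn := isCoeff_nr r
  have hd : IsCoeff fun p s => bDiag r p.1 p.2 s := by
    unfold bDiag
    refine ((hn.entire_mul (c := fun s => I * s ^ 2) (by fun_prop)).sub ?_).add
      (((h.conj_const.mul hz).sub (h.mul hz.conj_const)).const_mul _)
    simp only [pow_two (nr _ _ _)]
    exact (hn.mul hn).const_mul _
  simp only [B_eq]
  fin_cases i <;> fin_cases j
  · exact hd
  · exact (h.entire_mul (c := fun s => -2 * s ^ 3) (by fun_prop)).add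
      (((h.add (hz.const_mul _)).add ((hn.const_mul _).mul h)).entire_mul differentiable_id)
  · exact (h.conj_const.entire_mul (c := fun s => 2 * s ^ 3) (by fun_prop)).add
      (((h.conj_const.neg.add (hz.conj_const.const_mul _)).sub
        ((hn.const_mul _).mul h.conj_const)).entire_mul differentiable_id)
  · exact hd.neg

theorem isCoeff_Theta1 : IsCoeff fun p _ => Theta1 r p.1 p.2 := by
  simp only [Theta1_eq]
  exact (isCoeff_nr r).const_mul _

theorem isCoeff_Theta2 : IsCoeff fun p _ => Theta2 r p.1 p.2 := by
  have h := isCoeff_r r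
  have hz := isCoeff_rz r
  simp only [Theta2_eq]
  refine IsCoeff.add ?_ (((h.conj_const.mul hz).sub (h.mul hz.conj_const)).const_mul _)
  simp only [pow_two]
  exact ((isCoeff_nr r).mul (isCoeff_nr r)).const_mul _

/-- Conjugation by `e^{-i θ σ}` of a trace-corrected coefficient matrix. -/
theorem isCoeff_gauge {M : ℝ × ℝ → ℂ → Matrix (Fin 2) (Fin 2) ℂ} {Θ : ℝ × ℝ → ℂ}
    (hM : ∀ i j, IsCoeff fun p s => M p s i j) (hΘ : IsCoeff fun p _ => Θ p) (i j : Fin 2) :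
    IsCoeff fun p s =>
      hatExp (-(I * theta r p.1 p.2)) (M p s - (I * Θ p) • sigma) i j := by
  have h : ∀ i j, IsCoeff fun p s => (M p s - (I * Θ p) • sigma) i j := by
    intro i j
    simp only [Matrix.sub_apply, Matrix.smul_apply, smul_eq_mul]
    refine (hM i j).sub ?_
    simpa [mul_comm, mul_left_comm, mul_assoc] using hΘ.const_mul (I * sigma i j)
  simp only [hatExp_eq]
  fin_cases i <;> fin_cases j
  · exact h 0 0
  · simpa [mul_assoc] using (h 0 1).exp_mul r (-2)
  · simpa [mul_assoc] using (h 1 0).exp_mul r 2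
  · exact h 1 1

theorem isCoeff_A₁ (i j : Fin 2) : IsCoeff fun p s => A₁ r p.1 p.2 s i j :=
  isCoeff_gauge r (isCoeff_A r) (isCoeff_Theta1 r) i j

theorem isCoeff_B₁ (i j : Fin 2) : IsCoeff fun p s => B₁ r p.1 p.2 s i j :=
  isCoeff_gauge r (isCoeff_B r) (isCoeff_Theta2 r) i j

theorem exists_forall_bound {M : ℝ × ℝ → ℂ → Matrix (Fin 2) (Fin 2) ℂ}
    (hM : ∀ i j, IsCoeff fun p s => M p s i j) (ρ : ℝ) :
    ∃ C, 0 ≤ C ∧ ∀ p s, ‖s‖ ≤ ρ → ∀ i j, ‖M p s i j‖ ≤ C * decay p := by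
  choose C hC hb using fun i j => (hM i j).bound ρ
  refine ⟨∑ i, ∑ j, C i j, Finset.sum_nonneg fun i _ => Finset.sum_nonneg fun j _ => hC i j,
    fun p s hs i j => (hb i j p s hs).trans ?_⟩
  refine mul_le_mul_of_nonneg_right ?_ (decay_nonneg p)
  exact (Finset.single_le_sum (f := fun j => C i j) (fun j _ => hC i j) (Finset.mem_univ j)).trans
    (Finset.single_le_sum (f := fun i => ∑ j, C i j)
      (fun i _ => Finset.sum_nonneg fun j _ => hC i j) (Finset.mem_univ i))

end Coefficients

/-! ### Volterra equations for the columns -/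

section Columns

/-- On a `k`-th column the conjugation is diagonal: row `k` carries no exponential, and the other
row carries `exp (2x)` or `exp (-2x)`. A column equation therefore needs only one sign condition on
its exponent. -/
theorem hatExpCol_apply (k : Fin 2) (x : ℂ) (f : Fin 2 → ℂ) (i : Fin 2) :
    hatExpCol k x f i = exp (x * (sigma i i - sigma k k)) * f i := by
  rw [mul_sub, sub_eq_add_neg, Complex.exp_add]
  fin_cases i <;>
    simp [hatExpCol, expSigma, sigma, dotProduct, Fin.sum_univ_two] <;> ring

theorem hatExpCol_hatExpCol (k : Fin 2) (x y : ℂ) (f : Fin 2 → ℂ) :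
    hatExpCol k x (hatExpCol k y f) = hatExpCol k (x + y) f := by
  ext i
  rw [hatExpCol_apply, hatExpCol_apply, hatExpCol_apply, add_mul, Complex.exp_add, mul_assoc]

theorem hatExpCol_zero (k : Fin 2) (f : Fin 2 → ℂ) : hatExpCol k 0 f = f := by
  ext i; simp [hatExpCol_apply]

theorem hatExpCol_unitCol (k : Fin 2) (x : ℂ) : hatExpCol k x (unitCol k) = unitCol k := by
  ext i
  rw [hatExpCol_apply]
  fin_cases k <;> fin_cases i <;> simp [unitCol]

/-- The action of `e^{x σ̂}` on a column, as a continuous linear equivalence. -/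
def hatExpColEquiv (k : Fin 2) (x : ℂ) : (Fin 2 → ℂ) ≃L[ℂ] (Fin 2 → ℂ) :=
  LinearEquiv.toContinuousLinearEquiv
    { toFun := hatExpCol k x
      invFun := hatExpCol k (-x)
      map_add' := fun f g => by ext i; simp only [hatExpCol_apply, Pi.add_apply]; ring
      map_smul' := fun c f => by
        ext i; simp only [hatExpCol_apply, Pi.smul_apply, smul_eq_mul, RingHom.id_apply]; ring
      left_inv := fun f => by rw [hatExpCol_hatExpCol, neg_add_cancel, hatExpCol_zero]
      right_inv := fun f => by rw [hatExpCol_hatExpCol, add_neg_cancel, hatExpCol_zero] }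

theorem hatExpCol_integral (k : Fin 2) (x : ℂ) {α : Type*} [MeasurableSpace α] (μ : Measure α)
    (f : α → Fin 2 → ℂ) : hatExpCol k x (∫ a, f a ∂μ) = ∫ a, hatExpCol k x (f a) ∂μ :=
  ((hatExpColEquiv k x).integral_comp_comm f).symm

theorem hatExpCol_add (k : Fin 2) (x : ℂ) (f g : Fin 2 → ℂ) :
    hatExpCol k x (f + g) = hatExpCol k x f + hatExpCol k x g :=
  (hatExpColEquiv k x).map_add f g

theorem hatExpCol_sub (k : Fin 2) (x : ℂ) (f g : Fin 2 → ℂ) :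
    hatExpCol k x (f - g) = hatExpCol k x f - hatExpCol k x g :=
  (hatExpColEquiv k x).map_sub f g

theorem hatExpCol_smul (k : Fin 2) (x c : ℂ) (f : Fin 2 → ℂ) :
    hatExpCol k x (c • f) = c • hatExpCol k x f :=
  (hatExpColEquiv k x).map_smul c f

theorem hatExpCol_intervalIntegral (k : Fin 2) (x : ℂ) (a b : ℝ) (f : ℝ → Fin 2 → ℂ) :
    hatExpCol k x (∫ y in a..b, f y) = ∫ y in a..b, hatExpCol k x (f y) := by
  simp only [intervalIntegral, hatExpCol_sub, hatExpCol_integral]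

/-- Matrices as continuous linear maps. -/
def matCLM : (Fin 2 → Fin 2 → ℂ) →L[ℂ] ((Fin 2 → ℂ) →L[ℂ] (Fin 2 → ℂ)) :=
  LinearMap.toContinuousLinearMap
    (LinearMap.toContinuousLinearMap.toLinearMap ∘ₗ
      (Matrix.toLin' : Matrix (Fin 2) (Fin 2) ℂ ≃ₗ[ℂ] _).toLinearMap)

theorem matCLM_apply (M : Matrix (Fin 2) (Fin 2) ℂ) (f : Fin 2 → ℂ) : matCLM M f = M *ᵥ f := rfl

theorem norm_mulVec_le {M : Matrix (Fin 2) (Fin 2) ℂ} {C : ℝ} (hM : ∀ i j, ‖M i j‖ ≤ C)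
    (f : Fin 2 → ℂ) : ‖M *ᵥ f‖ ≤ 2 * C * ‖f‖ := by
  have hC : 0 ≤ C := (norm_nonneg _).trans (hM 0 0)
  refine (pi_norm_le_iff_of_nonneg (by positivity)).2 fun i => ?_
  simp only [Matrix.mulVec, dotProduct, Fin.sum_univ_two]
  refine (norm_add_le _ _).trans ?_
  rw [norm_mul, norm_mul]
  have h0 := mul_le_mul (hM i 0) (norm_le_pi_norm f 0) (norm_nonneg _) hC
  have h1 := mul_le_mul (hM i 1) (norm_le_pi_norm f 1) (norm_nonneg _) hC
  linarith

/-- The kernel `f ↦ e^{x σ̂} M f` acting on `k`-th columns. -/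
def colKernel (k : Fin 2) (x : ℂ) (M : Matrix (Fin 2) (Fin 2) ℂ) :
    (Fin 2 → ℂ) →L[ℂ] (Fin 2 → ℂ) :=
  matCLM fun i j => exp (x * (sigma i i - sigma k k)) * M i j

theorem colKernel_apply (k : Fin 2) (x : ℂ) (M : Matrix (Fin 2) (Fin 2) ℂ) (f : Fin 2 → ℂ) :
    colKernel k x M f = hatExpCol k x (M *ᵥ f) := by
  ext i
  refine (congrFun (matCLM_apply _ f) i).trans ?_
  rw [hatExpCol_apply]
  simp only [Matrix.mulVec, dotProduct, Fin.sum_univ_two]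
  ring

theorem norm_colKernel_le {k : Fin 2} {x : ℂ} {M : Matrix (Fin 2) (Fin 2) ℂ} {C : ℝ}
    (hx : ∀ i, (x * (sigma i i - sigma k k)).re ≤ 0) (hM : ∀ i j, ‖M i j‖ ≤ C) :
    ‖colKernel k x M‖ ≤ 2 * C := by
  have hC : 0 ≤ C := (norm_nonneg _).trans (hM 0 0)
  refine ContinuousLinearMap.opNorm_le_bound _ (by positivity) fun f => ?_
  refine (congrArg norm (matCLM_apply _ f)).trans_le (norm_mulVec_le (fun i j => ?_) f)
  rw [norm_mul, Complex.norm_exp]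
  exact (mul_le_of_le_one_left (norm_nonneg _) (Real.exp_le_one_iff.2 (hx i))).trans (hM i j)

/-- The weight `C / (1 + x²)`. -/
def ratWeight (C x : ℝ) : ℝ := C * (1 + x ^ 2)⁻¹

theorem isWeight_ratWeight {C : ℝ} (hC : 0 ≤ C) : IsWeight (ratWeight C) where
  continuous := by
    refine continuous_const.mul (Continuous.inv₀ (by fun_prop) fun x => ?_)
    positivity
  integrable := integrable_inv_one_add_sq.const_mul C
  nonneg x := by unfold ratWeight; positivity

/-- Matrix coefficients depending on a point and on the spectral parameter. -/
abbrev Coeffs := ℝ × ℝ → ℂ → Matrix (Fin 2) (Fin 2) ℂ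

/-- The coefficient matrix of a column equation: `ε Q` along the path `γ`, cut off to `S`. -/
def colMat (Q : Coeffs) (γ : ℝ → ℝ × ℝ) (S : Set ℝ) (ε s : ℂ) (ξ : ℝ) : Matrix (Fin 2) (Fin 2) ℂ :=
  S.indicator (fun ξ => ε • Q (γ ξ) s) ξ

/-- The solution of `f x = g x + ε ∫_{ξ > x, ξ ∈ S} e^{a (x - ξ) σ̂} Q(γ ξ, s) f ξ`. -/
def colSol (k : Fin 2) (a : ℂ) (Q : Coeffs) (γ : ℝ → ℝ × ℝ) (S : Set ℝ) (ε s : ℂ)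
    (g : ℝ → Fin 2 → ℂ) : ℝ → Fin 2 → ℂ :=
  volterraSol (fun x ξ => colKernel k (a * (x - ξ)) (colMat Q γ S ε s ξ)) g

/-- The structural hypotheses on the data of a family of column equations. -/
structure IsColFamily {P : Type*} [TopologicalSpace P] (k : Fin 2) (a : P → ℂ) (Q : Coeffs)
    (γ : P → ℝ → ℝ × ℝ) (S : Set ℝ) (s : P → ℂ) (ρ : ℝ) : Prop where
  coeff : ∀ i j, IsCoeff fun p s => Q p s i j
  continuous_a : Continuous a
  continuous_s : Continuous s
  norm_s : ∀ p, ‖s p‖ ≤ ρ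
  continuous_γ : Continuous fun q : P × ℝ => γ q.1 q.2
  decay_γ : ∀ p ξ, decay (γ p ξ) ≤ (1 + ξ ^ 2)⁻¹
  measurableSet : MeasurableSet S
  sign : ∀ p i, 0 ≤ (a p * (sigma i i - sigma k k)).re

theorem colMat_apply (Q : Coeffs) (γ : ℝ → ℝ × ℝ) (S : Set ℝ) (ε s : ℂ) (ξ : ℝ) (i j : Fin 2) :
    colMat Q γ S ε s ξ i j = S.indicator (fun ξ => ε * Q (γ ξ) s i j) ξ := by
  by_cases h : ξ ∈ S <;> simp [colMat, h]

section Family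

variable {P : Type*} [TopologicalSpace P] {k : Fin 2} {a : P → ℂ} {Q : Coeffs}
  {γ : P → ℝ → ℝ × ℝ} {S : Set ℝ} {s : P → ℂ} {ρ : ℝ}

/-- For `x < ξ` the sign hypothesis makes the exponentials at most `1` in modulus, and along the
path the coefficients are `O(1 / (1 + ξ²))` uniformly for spectral parameters of norm at most `ρ`.
One weight thus serves the whole family. -/
theorem IsColFamily.exists_kernel (h : IsColFamily k a Q γ S s ρ) (ε : ℂ) :
    ∃ C, 0 ≤ C ∧ IsVolterraKernel (ratWeight C)
      fun p x ξ => colKernel k (a p * (x - ξ)) (colMat Q (γ p) S ε (s p) ξ) := by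
  obtain ⟨C, hC, hb⟩ := exists_forall_bound h.coeff ρ
  have hentry : ∀ p ξ i j, ‖colMat Q (γ p) S ε (s p) ξ i j‖ ≤ ‖ε‖ * C * (1 + ξ ^ 2)⁻¹ := by
    intro p ξ i j
    rw [colMat_apply]
    refine (norm_indicator_le_norm_self _ _).trans ?_
    rw [norm_mul, mul_assoc]
    exact mul_le_mul_of_nonneg_left ((hb _ _ (h.norm_s p) i j).trans
      (mul_le_mul_of_nonneg_left (h.decay_γ p ξ) hC)) (norm_nonneg _)
  have hcont : ∀ i j, Continuous fun q : P × ℝ => ε * Q (γ q.1 q.2) (s q.1) i j := fun i j =>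
    continuous_const.mul ((h.coeff i j).continuous.comp
      (h.continuous_γ.prodMk (h.continuous_s.comp continuous_fst)))
  refine ⟨2 * (‖ε‖ * C), by positivity, ⟨fun ξ => ?_, fun p x => ?_, fun p x ξ hx => ?_⟩⟩
  · refine matCLM.continuous.comp (continuous_pi fun i => continuous_pi fun j => ?_)
    refine Continuous.mul ?_ ?_
    · have := h.continuous_a
      fun_prop
    · simp only [colMat_apply]
      by_cases hξ : ξ ∈ S
      · simp only [hξ, indicator_of_mem]
        exact (hcont i j).comp (continuous_fst.prodMk continuous_const)
      · simp only [hξ, not_false_eq_true, indicator_of_notMem]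
        exact continuous_const
  · refine matCLM.continuous.comp_aestronglyMeasurable (Measurable.aestronglyMeasurable ?_)
    refine measurable_pi_lambda _ fun i => measurable_pi_lambda _ fun j => ?_
    refine Measurable.mul ?_ ?_
    · exact Continuous.measurable (by fun_prop)
    · simp only [colMat_apply]
      exact ((hcont i j).comp (Continuous.prodMk_right p)).measurable.indicator h.measurableSet
  · have e : ratWeight (2 * (‖ε‖ * C)) ξ = 2 * (‖ε‖ * C * (1 + ξ ^ 2)⁻¹) := by
      rw [ratWeight]; ring
    rw [e]
    refine norm_colKernel_le (fun i => ?_) (hentry p ξ)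
    have e' : a p * (x - ξ) * (sigma i i - sigma k k) =
        ((x - ξ : ℝ) : ℂ) * (a p * (sigma i i - sigma k k)) := by push_cast; ring
    rw [e', Complex.re_ofReal_mul]
    exact mul_nonpos_of_nonpos_of_nonneg (by linarith) (h.sign p i)

variable {g : P → ℝ → Fin 2 → ℂ} {C : ℝ}

theorem IsColFamily.continuous_colSol [FirstCountableTopology P] (h : IsColFamily k a Q γ S s ρ) (ε : ℂ)
    (hg : Continuous fun q : P × ℝ => g q.1 q.2) (hC : ∀ p x, ‖g p x‖ ≤ C) :
    Continuous fun q : P × ℝ => colSol k (a q.1) Q (γ q.1) S ε (s q.1) (g q.1) q.2 := by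
  obtain ⟨C', hC', hK⟩ := h.exists_kernel ε
  exact continuous_volterraSol (isWeight_ratWeight hC') hK hg hC

theorem IsColFamily.exists_bound_colSol (h : IsColFamily k a Q γ S s ρ) (ε : ℂ)
    (hC : ∀ p x, ‖g p x‖ ≤ C) :
    ∃ B, ∀ p x, ‖colSol k (a p) Q (γ p) S ε (s p) (g p) x‖ ≤ B := by
  obtain ⟨C', hC', hK⟩ := h.exists_kernel ε
  exact ⟨_, fun p x => norm_volterraSol_le (isWeight_ratWeight hC') (hK.norm_le p) (hC p) x⟩

theorem setIntegral_colKernel (hS : MeasurableSet S) (k : Fin 2) (a : ℂ) (Q : Coeffs)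
    (γ : ℝ → ℝ × ℝ) (ε s : ℂ) (f : ℝ → Fin 2 → ℂ) (x : ℝ) :
    ∫ ξ in Ioi x, colKernel k (a * (x - ξ)) (colMat Q γ S ε s ξ) (f ξ) =
      ε • ∫ ξ in Ioi x ∩ S, hatExpCol k (a * (x - ξ)) (Q (γ ξ) s *ᵥ f ξ) := by
  rw [← setIntegral_indicator hS, ← integral_smul]
  congr 1
  funext ξ
  rw [colKernel_apply]
  by_cases hξ : ξ ∈ S
  · simp only [colMat, hξ, indicator_of_mem, Matrix.smul_mulVec, hatExpCol_smul]
  · simp only [colMat, hξ, not_false_eq_true, indicator_of_notMem, Matrix.zero_mulVec, smul_zero]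
    ext i
    simp [hatExpCol_apply]

theorem IsColFamily.colSol_eq [FirstCountableTopology P] (h : IsColFamily k a Q γ S s ρ) (ε : ℂ)
    (hg : Continuous fun q : P × ℝ => g q.1 q.2) (hC : ∀ p x, ‖g p x‖ ≤ C) (p : P) (x : ℝ) :
    colSol k (a p) Q (γ p) S ε (s p) (g p) x = g p x + ε • ∫ ξ in Ioi x ∩ S,
      hatExpCol k (a p * (x - ξ))
        (Q (γ p ξ) (s p) *ᵥ colSol k (a p) Q (γ p) S ε (s p) (g p) ξ) := by
  obtain ⟨C', hC', hK⟩ := h.exists_kernel ε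
  rw [← setIntegral_colKernel h.measurableSet]
  exact volterraSol_eq (isWeight_ratWeight hC') hK hg hC p x

/-- Uniqueness of bounded solutions of a column equation. -/
theorem IsColFamily.eq_zero (h : IsColFamily k a Q γ S s ρ) (ε : ℂ) (p : P) {x₀ : ℝ}
    {d : ℝ → Fin 2 → ℂ} (hd : ∀ x, x₀ ≤ x → d x = ε • ∫ ξ in Ioi x ∩ S,
      hatExpCol k (a p * (x - ξ)) (Q (γ p ξ) (s p) *ᵥ d ξ))
    (hC : ∀ x, x₀ ≤ x → ‖d x‖ ≤ C) {x : ℝ} (hx : x₀ ≤ x) : d x = 0 := by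
  obtain ⟨C', hC', hK⟩ := h.exists_kernel ε
  refine eq_zero_of_volterra (isWeight_ratWeight hC') (hK.norm_le p) (fun x hx => ?_) hC hx
  rw [setIntegral_colKernel h.measurableSet]
  exact hd x hx

/-- Integrability of the integrand of a column equation. -/
theorem IsColFamily.integrableOn (h : IsColFamily k a Q γ S s ρ) (p : P) {x : ℝ}
    {f : ℝ → Fin 2 → ℂ} (hf : ContinuousOn f (Ioi x ∩ S)) (hC : ∀ ξ ∈ Ioi x ∩ S, ‖f ξ‖ ≤ C) :
    IntegrableOn (fun ξ : ℝ => hatExpCol k (a p * (x - ξ)) (Q (γ p ξ) (s p) *ᵥ f ξ)) (Ioi x ∩ S) := by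
  obtain ⟨C', hC', hK⟩ := h.exists_kernel 1
  have hmeas : MeasurableSet (Ioi x ∩ S) := measurableSet_Ioi.inter h.measurableSet
  have hcongr : ∀ ξ ∈ Ioi x ∩ S, colKernel k (a p * (x - ξ)) (colMat Q (γ p) S 1 (s p) ξ) (f ξ) =
      hatExpCol k (a p * (x - ξ)) (Q (γ p ξ) (s p) *ᵥ f ξ) := by
    intro ξ hξ
    rw [colKernel_apply, colMat, indicator_of_mem hξ.2, one_smul]
  refine IntegrableOn.congr_fun ?_ hcongr hmeas
  refine Integrable.mono' ((isWeight_ratWeight hC').integrable.integrableOn.mul_const C) ?_ ?_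
  · exact aestronglyMeasurable_clm_apply (hK.aestronglyMeasurable p x).restrict
      (hf.aestronglyMeasurable hmeas)
  · refine (ae_restrict_mem hmeas).mono fun ξ hξ => ?_
    exact (ContinuousLinearMap.le_opNorm _ _).trans (mul_le_mul (hK.norm_le p x ξ hξ.1) (hC ξ hξ)
      (norm_nonneg _) ((isWeight_ratWeight hC').nonneg ξ))

end Family

theorem differentiableOn_colSol {k : Fin 2} {a : ℂ → ℂ} {Q : Coeffs} {γ : ℝ → ℝ × ℝ} {S : Set ℝ}
    {ρ C : ℝ} {Ω : Set ℂ} (hΩ : IsOpen Ω)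
    (h : IsColFamily k (fun s : Ω => a s) Q (fun _ => γ) S (fun s : Ω => (s : ℂ)) ρ) (ε : ℂ)
    (ha : Differentiable ℂ a) {g : ℂ → ℝ → Fin 2 → ℂ}
    (hg : Continuous fun q : Ω × ℝ => g q.1 q.2) (hC : ∀ s ∈ Ω, ∀ x, ‖g s x‖ ≤ C)
    (hgd : ∀ x, DifferentiableOn ℂ (fun s => g s x) Ω) (x : ℝ) :
    DifferentiableOn ℂ (fun s => colSol k (a s) Q γ S ε s (g s) x) Ω := by
  obtain ⟨C', hC', hK⟩ := h.exists_kernel ε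
  refine differentiableOn_volterraSol hΩ (isWeight_ratWeight hC') hK (fun x ξ => ?_) hg hC hgd x
  refine (matCLM.differentiable.comp ?_).differentiableOn
  refine differentiable_pi.2 fun i => differentiable_pi.2 fun j => ?_
  refine Differentiable.mul (by fun_prop) ?_
  simp only [colMat_apply]
  by_cases hξ : ξ ∈ S
  · simp only [hξ, indicator_of_mem]
    exact ((h.coeff i j).differentiable _).const_mul ε
  · simp only [hξ, not_false_eq_true, indicator_of_notMem]
    exact differentiable_const _

end Columns

/-! ### Uniqueness and reflection -/

section Reflection

variable {P : Type*} [TopologicalSpace P] {k : Fin 2} {a : P → ℂ} {Q : Coeffs}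
  {γ : P → ℝ → ℝ × ℝ} {S : Set ℝ} {s : P → ℂ} {ρ : ℝ}

/-- The difference, extended by zero off `S`, solves the homogeneous equation on the whole
half-line: since `S` is a lower set, nothing of `S` lies beyond a point outside it. Continuity and
boundedness provide the integrability needed to subtract the two integrals. -/
theorem IsColFamily.unique (h : IsColFamily k a Q γ S s ρ) (hS : IsLowerSet S) (ε : ℂ) (p : P)
    {x₀ : ℝ} {g f f' : ℝ → Fin 2 → ℂ} {C C' : ℝ}
    (hf : ∀ x, x₀ ≤ x → x ∈ S → f x = g x + ε • ∫ ξ in Ioi x ∩ S,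
      hatExpCol k (a p * (x - ξ)) (Q (γ p ξ) (s p) *ᵥ f ξ))
    (hf' : ∀ x, x₀ ≤ x → x ∈ S → f' x = g x + ε • ∫ ξ in Ioi x ∩ S,
      hatExpCol k (a p * (x - ξ)) (Q (γ p ξ) (s p) *ᵥ f' ξ))
    (hc : ContinuousOn f (Ici x₀ ∩ S)) (hc' : ContinuousOn f' (Ici x₀ ∩ S))
    (hC : ∀ x, x₀ ≤ x → x ∈ S → ‖f x‖ ≤ C) (hC' : ∀ x, x₀ ≤ x → x ∈ S → ‖f' x‖ ≤ C')
    {x : ℝ} (hx : x₀ ≤ x) (hxS : x ∈ S) : f x = f' x := by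
  have hmain : ∀ x, x₀ ≤ x → S.indicator (f - f') x = 0 := by
    intro x hx
    refine h.eq_zero ε p (x₀ := x₀) (C := max (C + C') 0) (fun x hx => ?_) (fun x hx => ?_) hx
    · have hmeas : MeasurableSet (Ioi x ∩ S) := measurableSet_Ioi.inter h.measurableSet
      by_cases hxS : x ∈ S
      · have hsub : Ioi x ∩ S ⊆ Ici x₀ ∩ S :=
          inter_subset_inter_left _ fun ξ hξ => hx.trans (le_of_lt hξ)
        rw [indicator_of_mem hxS, Pi.sub_apply, hf x hx hxS, hf' x hx hxS, add_sub_add_left_eq_sub,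
          ← smul_sub, ← integral_sub
            (h.integrableOn p (hc.mono hsub) fun ξ hξ => hC ξ (hsub hξ).1 hξ.2)
            (h.integrableOn p (hc'.mono hsub) fun ξ hξ => hC' ξ (hsub hξ).1 hξ.2)]
        congr 1
        refine setIntegral_congr_fun hmeas fun ξ hξ => ?_
        simp only [indicator_of_mem hξ.2, Pi.sub_apply, Matrix.mulVec_sub, hatExpCol_sub]
      · have hempty : Ioi x ∩ S = ∅ := by
          refine eq_empty_of_forall_notMem fun ξ hξ => hxS (hS (le_of_lt hξ.1) hξ.2)
        rw [indicator_of_notMem hxS, hempty]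
        simp
    · by_cases hxS : x ∈ S
      · rw [indicator_of_mem hxS, Pi.sub_apply]
        exact ((norm_sub_le _ _).trans (add_le_add (hC x hx hxS) (hC' x hx hxS))).trans
          (le_max_left _ 0)
      · rw [indicator_of_notMem hxS, norm_zero]
        exact le_max_right _ _
  have := hmain x hx
  rwa [indicator_of_mem hxS, Pi.sub_apply, sub_eq_zero] at this

theorem setIntegral_Ioi_inter_Iio_zero {f : ℝ → Fin 2 → ℂ} {t : ℝ} (ht : 0 ≤ t) :
    ∫ ξ in Ioi (-t) ∩ Iio 0, f ξ = ∫ τ in (0 : ℝ)..t, f (-τ) := by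
  rw [intervalIntegral.integral_comp_neg (fun x => f x), neg_zero,
    intervalIntegral.integral_of_le (by linarith), integral_Ioc_eq_integral_Ioo]
  rfl

/-- The substitution `ξ = -τ` turns an equation integrated from `0` to `t` into one integrated from
`-t` upwards, cut off at `0`. The exponent changes sign, which exchanges the half-planes where the
equation is well behaved. -/
theorem setIntegral_reflected (k : Fin 2) (a : ℂ) (Q : Coeffs) (γ : ℝ → ℝ × ℝ) (s : ℂ)
    (f : ℝ → Fin 2 → ℂ) {t : ℝ} (ht : 0 ≤ t) :
    ∫ ξ in Ioi (-t) ∩ Iio 0, hatExpCol k (a * ((-t : ℝ) - ξ)) (Q (γ ξ) s *ᵥ f (-ξ)) =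
      ∫ τ in (0 : ℝ)..t, hatExpCol k (-a * (t - τ)) (Q (γ (-τ)) s *ᵥ f τ) := by
  rw [setIntegral_Ioi_inter_Iio_zero ht]
  congr 1
  funext τ
  rw [neg_neg]
  congr 1
  push_cast
  ring

theorem IsColFamily.reflected_eq [FirstCountableTopology P]
    (h : IsColFamily k a Q γ (Iio 0) s ρ) {g : P → ℝ → Fin 2 → ℂ} {C : ℝ}
    (hg : Continuous fun q : P × ℝ => g q.1 q.2) (hC : ∀ p x, ‖g p x‖ ≤ C) (p : P) {t : ℝ}
    (ht : 0 ≤ t) :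
    colSol k (a p) Q (γ p) (Iio 0) 1 (s p) (g p) (-t) = g p (-t) + ∫ τ in (0 : ℝ)..t,
      hatExpCol k (-a p * (t - τ))
        (Q (γ p (-τ)) (s p) *ᵥ colSol k (a p) Q (γ p) (Iio 0) 1 (s p) (g p) (-τ)) := by
  rw [h.colSol_eq 1 hg hC p (-t), one_smul]
  congr 1
  rw [← setIntegral_reflected _ _ _ _ _
    (fun τ => colSol k (a p) Q (γ p) (Iio 0) 1 (s p) (g p) (-τ)) ht]
  simp only [neg_neg]

theorem IsColFamily.reflected_unique (h : IsColFamily k a Q γ (Iio 0) s ρ) (p : P)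
    {g f f' : ℝ → Fin 2 → ℂ}
    (hf : ∀ t, 0 ≤ t → f t = g t + ∫ τ in (0 : ℝ)..t,
      hatExpCol k (-a p * (t - τ)) (Q (γ p (-τ)) (s p) *ᵥ f τ))
    (hf' : ∀ t, 0 ≤ t → f' t = g t + ∫ τ in (0 : ℝ)..t,
      hatExpCol k (-a p * (t - τ)) (Q (γ p (-τ)) (s p) *ᵥ f' τ))
    (hc : ContinuousOn f (Ici 0)) (hc' : ContinuousOn f' (Ici 0)) {t : ℝ} (ht : 0 ≤ t) :
    f t = f' t := by
  -- The endpoint is separate because `0` does not belong to the cut-off set `Iio 0`.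
  rcases ht.eq_or_lt with rfl | ht'
  · rw [hf 0 le_rfl, hf' 0 le_rfl, intervalIntegral.integral_same, intervalIntegral.integral_same]
  -- No global bound is required: only the compact interval `[0, t]` enters, so continuity suffices.
  have hbound : ∀ f : ℝ → Fin 2 → ℂ, ContinuousOn f (Ici 0) →
      ∃ C, ∀ x, -t ≤ x → x ∈ Iio (0 : ℝ) → ‖f (-x)‖ ≤ C := by
    intro f hc
    obtain ⟨C, hC⟩ := (isCompact_Icc (a := (0 : ℝ)) (b := t)).exists_bound_of_continuousOn
      (hc.mono Icc_subset_Ici_self)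
    exact ⟨C, fun x hx hx0 => hC _ ⟨by linarith [mem_Iio.1 hx0], by linarith⟩⟩
  have heq : ∀ f : ℝ → Fin 2 → ℂ, (∀ t, 0 ≤ t → f t = g t + ∫ τ in (0 : ℝ)..t,
      hatExpCol k (-a p * (t - τ)) (Q (γ p (-τ)) (s p) *ᵥ f τ)) →
      ∀ x, -t ≤ x → x ∈ Iio (0 : ℝ) → f (-x) = g (-x) + (1 : ℂ) • ∫ ξ in Ioi x ∩ Iio 0,
        hatExpCol k (a p * (x - ξ)) (Q (γ p ξ) (s p) *ᵥ f (-ξ)) := by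
    intro f hf x _ hx0
    have h0 : 0 ≤ -x := by linarith [mem_Iio.1 hx0]
    rw [hf (-x) h0, one_smul, ← setIntegral_reflected _ _ _ _ _ f h0, neg_neg]
  have hcont : ∀ f : ℝ → Fin 2 → ℂ, ContinuousOn f (Ici 0) →
      ContinuousOn (fun x => f (-x)) (Ici (-t) ∩ Iio 0) := fun f hc =>
    hc.comp continuous_neg.continuousOn fun x hx => by
      simpa using (mem_Iio.1 hx.2).le
  obtain ⟨C, hC⟩ := hbound f hc
  obtain ⟨C', hC'⟩ := hbound f' hc'
  have := h.unique (isLowerSet_Iio 0) 1 p (heq f hf) (heq f' hf') (hcont f hc) (hcont f' hc')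
    hC hC' (x := -t) le_rfl (by simpa using ht')
  simpa using this

end Reflection

/-! ### The three families of columns -/

section Eigenfunctions

variable (r : 𝓢(ℝ × ℝ, ℂ)) (T : EReal)

/-- `A₁` as a coefficient matrix. -/
def coeffA₁ : Coeffs := fun p s => A₁ r p.1 p.2 s

/-- `B₁` as a coefficient matrix. -/
def coeffB₁ : Coeffs := fun p s => B₁ r p.1 p.2 s

/-- The second column of `H₃` at time `t`. -/
def sol3 (s : ℂ) (t : ℝ) : ℝ → Fin 2 → ℂ :=
  colSol 1 (phi s) (coeffA₁ r) (fun ξ => (ξ, t)) univ (-1) s fun _ => unitCol 1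

/-- The first column of `H₂` on the line `z = 0`. -/
def bd2 (s : ℂ) : ℝ → Fin 2 → ℂ :=
  colSol 0 (-psi s) (coeffB₁ r) (fun ξ => (0, ξ)) {τ : ℝ | (τ : EReal) < T} (-1) s
    fun _ => unitCol 0

/-- The first column of `H₁` on the line `z = 0`. -/
def bd1 (s : ℂ) (t : ℝ) : Fin 2 → ℂ :=
  colSol 0 (psi s) (coeffB₁ r) (fun ξ => (0, -ξ)) (Iio 0) 1 s (fun _ => unitCol 0) (-t)

/-- The inhomogeneous term of the (reflected) equation for `extendZ`. -/
def inhomZ (s : ℂ) (c : Fin 2 → ℂ) (x : ℝ) : Fin 2 → ℂ :=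
  -- Only `x ≤ 0`, that is `z = -x ≥ 0`, matters. The maximum freezes the exponent beyond, where the
  -- exponential could grow, so that the inhomogeneity is bounded on the whole line.
  hatExpCol 0 (phi s * ((max (-x) 0 : ℝ) : ℂ)) c

/-- The solution of the `z`-part of the equation for a first column, with value `c` at `z = 0`. -/
def extendZ (s : ℂ) (t : ℝ) (c : Fin 2 → ℂ) (z : ℝ) : Fin 2 → ℂ :=
  colSol 0 (-phi s) (coeffA₁ r) (fun ξ => (-ξ, t)) (Iio 0) 1 s (inhomZ s c) (-z)

theorem differentiable_phi : Differentiable ℂ phi := by unfold phi lam; fun_prop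

theorem differentiable_psi : Differentiable ℂ psi := by unfold psi lam; fun_prop

section Families

variable {P : Type*} [TopologicalSpace P] {σ : P → ℂ} {ρ : ℝ}

/-- The nontrivial exponent is `±2a`, so each family asks for one half-plane: `Re φ ≥ 0` for `sol3`
and `extendZ`, `Re ψ ≥ 0` for `bd2`, `Re ψ ≤ 0` for `bd1`. The combinations give the closed
conditions behind `D₃` and `D₄`. -/
theorem isColFamily_sol3 (hσ : Continuous σ) (hρ : ∀ p, ‖σ p‖ ≤ ρ) (h : ∀ p, 0 ≤ (phi (σ p)).re)
    (t : ℝ) : IsColFamily 1 (fun p => phi (σ p)) (coeffA₁ r) (fun _ ξ => (ξ, t)) univ σ ρ where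
  coeff := isCoeff_A₁ r
  continuous_a := differentiable_phi.continuous.comp hσ
  continuous_s := hσ
  norm_s := hρ
  continuous_γ := by fun_prop
  decay_γ _ ξ := decay_le_fst ξ t
  measurableSet := MeasurableSet.univ
  sign p i := by
    have := h p
    fin_cases i <;> simp [sigma]
    linarith

theorem isColFamily_bd2 (hσ : Continuous σ) (hρ : ∀ p, ‖σ p‖ ≤ ρ) (h : ∀ p, 0 ≤ (psi (σ p)).re) :
    IsColFamily 0 (fun p => -psi (σ p)) (coeffB₁ r) (fun _ ξ => (0, ξ)) {τ : ℝ | (τ : EReal) < T}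
      σ ρ where
  coeff := isCoeff_B₁ r
  continuous_a := (differentiable_psi.continuous.comp hσ).neg
  continuous_s := hσ
  norm_s := hρ
  continuous_γ := by fun_prop
  decay_γ _ ξ := decay_le_snd 0 ξ
  measurableSet := measurableSet_lt measurable_coe_real_ereal measurable_const
  sign p i := by
    have := h p
    fin_cases i <;> simp [sigma]
    linarith

theorem isColFamily_bd1 (hσ : Continuous σ) (hρ : ∀ p, ‖σ p‖ ≤ ρ) (h : ∀ p, (psi (σ p)).re ≤ 0) :
    IsColFamily 0 (fun p => psi (σ p)) (coeffB₁ r) (fun _ ξ => (0, -ξ)) (Iio 0) σ ρ where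
  coeff := isCoeff_B₁ r
  continuous_a := differentiable_psi.continuous.comp hσ
  continuous_s := hσ
  norm_s := hρ
  continuous_γ := by fun_prop
  decay_γ _ ξ := by simpa using decay_le_snd 0 (-ξ)
  measurableSet := measurableSet_Iio
  sign p i := by
    have := h p
    fin_cases i <;> simp [sigma]
    linarith

theorem isColFamily_extendZ (hσ : Continuous σ) (hρ : ∀ p, ‖σ p‖ ≤ ρ)
    (h : ∀ p, 0 ≤ (phi (σ p)).re) {τ : P → ℝ} (hτ : Continuous τ) :
    IsColFamily 0 (fun p => -phi (σ p)) (coeffA₁ r) (fun p ξ => (-ξ, τ p)) (Iio 0) σ ρ where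
  coeff := isCoeff_A₁ r
  continuous_a := (differentiable_phi.continuous.comp hσ).neg
  continuous_s := hσ
  norm_s := hρ
  continuous_γ := by fun_prop
  decay_γ p ξ := by simpa using decay_le_fst (-ξ) (τ p)
  measurableSet := measurableSet_Iio
  sign p i := by
    have := h p
    fin_cases i <;> simp [sigma]
    linarith

end Families

theorem norm_hatExpCol_le {k : Fin 2} {x : ℂ} (hx : ∀ i, (x * (sigma i i - sigma k k)).re ≤ 0)
    (f : Fin 2 → ℂ) : ‖hatExpCol k x f‖ ≤ ‖f‖ := by
  refine (pi_norm_le_iff_of_nonneg (norm_nonneg _)).2 fun i => ?_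
  rw [hatExpCol_apply, norm_mul, Complex.norm_exp]
  exact (mul_le_of_le_one_left (norm_nonneg _) (Real.exp_le_one_iff.2 (hx i))).trans
    (norm_le_pi_norm f i)

theorem norm_inhomZ_le {s : ℂ} (hs : 0 ≤ (phi s).re) (c : Fin 2 → ℂ) (x : ℝ) :
    ‖inhomZ s c x‖ ≤ ‖c‖ := by
  refine norm_hatExpCol_le (fun i => ?_) c
  rw [mul_right_comm, Complex.re_mul_ofReal]
  refine mul_nonpos_of_nonpos_of_nonneg ?_ (le_max_right _ _)
  fin_cases i <;> simp [sigma]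
  linarith

theorem continuous_inhomZ {P : Type*} [TopologicalSpace P] {σ : P → ℂ} (hσ : Continuous σ)
    {c : P → Fin 2 → ℂ} (hc : Continuous c) :
    Continuous fun q : P × ℝ => inhomZ (σ q.1) (c q.1) q.2 := by
  refine continuous_pi fun i => ?_
  simp only [inhomZ, hatExpCol_apply]
  have h := differentiable_phi.continuous.comp hσ
  have hmax : Continuous fun q : P × ℝ => ((max (-q.2) 0 : ℝ) : ℂ) :=
    Complex.continuous_ofReal.comp (continuous_snd.neg.max continuous_const)
  exact (Complex.continuous_exp.comp (((h.comp continuous_fst).mul hmax).mul continuous_const)).mul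
    ((continuous_apply i).comp (hc.comp continuous_fst))

end Eigenfunctions

/-! ### Existence, uniqueness and analyticity of the columns -/

section Existence

variable (r : 𝓢(ℝ × ℝ, ℂ)) (T : EReal) {s : ℂ}

theorem continuous_sol3 (hs : 0 ≤ (phi s).re) (t : ℝ) : Continuous (sol3 r s t) :=
  ((isColFamily_sol3 r (P := Unit) (σ := fun _ => s) continuous_const (fun _ => le_rfl)
    (fun _ => hs) t).continuous_colSol (-1) (g := fun _ _ => unitCol 1) continuous_const
    fun _ _ => le_rfl).comp (Continuous.prodMk_right ())

theorem isH₃_sol3 (hs : 0 ≤ (phi s).re) (t : ℝ) : IsH₃ r s 1 t (sol3 r s t) := by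
  have h := isColFamily_sol3 r (P := Unit) (σ := fun _ => s) continuous_const (fun _ => le_rfl)
    (fun _ => hs) t
  refine ⟨(continuous_sol3 r hs t).continuousOn, ?_, fun z _ => ?_⟩
  · obtain ⟨B, hB⟩ := h.exists_bound_colSol (-1) (g := fun _ _ => unitCol 1) fun _ _ => le_rfl
    exact ⟨B, fun z _ => hB () z⟩
  · have := h.colSol_eq (-1) (g := fun _ _ => unitCol 1) continuous_const (fun _ _ => le_rfl) () z
    rw [inter_univ, neg_one_smul, ← sub_eq_add_neg] at this
    exact this

variable {r} in
theorem IsH₃.eq_sol3 (hs : 0 ≤ (phi s).re) {t : ℝ} {f : ℝ → Fin 2 → ℂ} (hf : IsH₃ r s 1 t f)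
    {z : ℝ} (hz : 0 ≤ z) : f z = sol3 r s t z := by
  have h := isColFamily_sol3 r (P := Unit) (σ := fun _ => s) continuous_const (fun _ => le_rfl)
    (fun _ => hs) t
  have heq : ∀ {f : ℝ → Fin 2 → ℂ}, IsH₃ r s 1 t f → ∀ x : ℝ, 0 ≤ x → x ∈ univ →
      f x = unitCol 1 + (-1 : ℂ) • ∫ ξ in Ioi x ∩ univ,
        hatExpCol 1 (phi s * (x - ξ)) (coeffA₁ r (ξ, t) s *ᵥ f ξ) := by
    intro f hf x hx _
    rw [inter_univ, neg_one_smul, ← sub_eq_add_neg]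
    exact hf.equation x hx
  have h' := isH₃_sol3 r hs t
  obtain ⟨C, hC⟩ := hf.bounded_z
  obtain ⟨C', hC'⟩ := h'.bounded_z
  exact h.unique isLowerSet_univ (-1) () (heq hf) (heq h')
    (hf.continuousOn_z.mono inter_subset_left) (h'.continuousOn_z.mono inter_subset_left)
    (fun x hx _ => hC x hx) (fun x hx _ => hC' x hx) hz (mem_univ z)

/-- The definition chooses some solution; existence shows that the choice is one, and uniqueness
identifies it with the Neumann series for `z ≥ 0`. -/
theorem H₃_eq_sol3 (hs : 0 ≤ (phi s).re) {z t : ℝ} (hz : 0 ≤ z) : H₃ r z t s 1 = sol3 r s t z :=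
  (Classical.epsilon_spec ⟨_, isH₃_sol3 r hs t⟩ : IsH₃ r s 1 t _).eq_sol3 hs hz

theorem differentiableAt_sol3 (hs : 0 < (phi s).re) (t z : ℝ) :
    DifferentiableAt ℂ (fun s => sol3 r s t z) s := by
  -- Strict positivity is an open condition, and the norm bound supplies the uniform `ρ` of
  -- `IsColFamily`.
  have hev : ∀ᶠ w in 𝓝 s, 0 < (phi w).re ∧ ‖w‖ < ‖s‖ + 1 :=
    ((Complex.continuous_re.comp differentiable_phi.continuous).continuousAt.eventually
      (lt_mem_nhds hs)).and (continuous_norm.continuousAt.eventually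
        (gt_mem_nhds (lt_add_one ‖s‖)))
  obtain ⟨Ω, hΩ, hopen, hmem⟩ := eventually_nhds_iff.1 hev
  have hfam := isColFamily_sol3 r (P := Ω) (σ := fun p => (p : ℂ)) (ρ := ‖s‖ + 1)
    continuous_subtype_val (fun p => (hΩ p p.2).2.le) (fun p => (hΩ p p.2).1.le) t
  have h := differentiableOn_colSol hopen hfam (-1) differentiable_phi
    (g := fun _ _ => unitCol 1) (C := ‖unitCol 1‖) continuous_const
    (fun _ _ _ => le_rfl) (fun x => differentiableOn_const _) z
  exact h.differentiableAt (hopen.mem_nhds hmem)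

/-- Here time is the parameter of the family. The joint continuity in `(t, z)` is what the
propagation of the `t`-equation requires. -/
theorem continuous_extendZ (hs : 0 ≤ (phi s).re) {c : ℝ → Fin 2 → ℂ} (hc : Continuous c) {C : ℝ}
    (hC : ∀ t, ‖c t‖ ≤ C) : Continuous fun q : ℝ × ℝ => extendZ r s q.1 (c q.1) q.2 :=
  ((isColFamily_extendZ r (P := ℝ) (σ := fun _ => s) continuous_const (fun _ => le_rfl)
    (fun _ => hs) continuous_id).continuous_colSol 1 (g := fun t => inhomZ s (c t))
    (continuous_inhomZ continuous_const hc)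
    fun t x => (norm_inhomZ_le hs (c t) x).trans (hC t)).comp
    (continuous_fst.prodMk continuous_snd.neg)

theorem extendZ_eq (hs : 0 ≤ (phi s).re) (t : ℝ) (c : Fin 2 → ℂ) {z : ℝ} (hz : 0 ≤ z) :
    extendZ r s t c z = hatExpCol 0 (phi s * z) c + ∫ ζ in (0 : ℝ)..z,
      hatExpCol 0 (phi s * (z - ζ)) (A₁ r ζ t s *ᵥ extendZ r s t c ζ) := by
  have := (isColFamily_extendZ r (P := Unit) (σ := fun _ => s) continuous_const (fun _ => le_rfl)
    (fun _ => hs) (τ := fun _ => t) continuous_const).reflected_eq (g := fun _ => inhomZ s c)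
    (continuous_inhomZ continuous_const continuous_const) (fun _ x => norm_inhomZ_le hs c x) () hz
  simp only [neg_neg] at this
  have e : inhomZ s c (-z) = hatExpCol 0 (phi s * z) c := by
    rw [inhomZ, neg_neg, max_eq_left hz]
  rw [e] at this
  exact this

theorem extendZ_zero (hs : 0 ≤ (phi s).re) (t : ℝ) (c : Fin 2 → ℂ) : extendZ r s t c 0 = c := by
  rw [extendZ_eq r hs t c le_rfl, intervalIntegral.integral_same, Complex.ofReal_zero, mul_zero,
    hatExpCol_zero, add_zero]

/-- The equation integrates from `0` to `z`, so after reflection it has a unique continuous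
solution, without any growth condition at infinity. -/
theorem eq_extendZ (hs : 0 ≤ (phi s).re) {t : ℝ} {f : ℝ → Fin 2 → ℂ} (hc : ContinuousOn f (Ici 0))
    (hf : ∀ z : ℝ, 0 ≤ z → f z = hatExpCol 0 (phi s * z) (f 0) + ∫ ζ in (0 : ℝ)..z,
      hatExpCol 0 (phi s * (z - ζ)) (A₁ r ζ t s *ᵥ f ζ)) {z : ℝ} (hz : 0 ≤ z) :
    f z = extendZ r s t (f 0) z := by
  refine (isColFamily_extendZ r (P := Unit) (σ := fun _ => s) continuous_const (fun _ => le_rfl)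
    (fun _ => hs) (τ := fun _ => t) continuous_const).reflected_unique ()
    (g := fun z => hatExpCol 0 (phi s * z) (f 0)) (fun z hz => ?_) (fun z hz => ?_) hc
    ((continuous_extendZ r hs continuous_const fun _ => le_rfl).comp
      (Continuous.prodMk_right t)).continuousOn hz
  · simp only [neg_neg]
    exact hf z hz
  · simp only [neg_neg]
    exact extendZ_eq r hs t (f 0) hz

theorem differentiableAt_extendZ (hs : 0 < (phi s).re) {c : ℂ → Fin 2 → ℂ}
    (hc : ∀ᶠ w in 𝓝 s, DifferentiableAt ℂ c w) (t z : ℝ) :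
    DifferentiableAt ℂ (fun s => extendZ r s t (c s) z) s := by
  have hev : ∀ᶠ w in 𝓝 s, (0 < (phi w).re ∧ ‖w‖ < ‖s‖ + 1) ∧
      DifferentiableAt ℂ c w ∧ ‖c w‖ < ‖c s‖ + 1 :=
    (((Complex.continuous_re.comp differentiable_phi.continuous).continuousAt.eventually
      (lt_mem_nhds hs)).and (continuous_norm.continuousAt.eventually
        (gt_mem_nhds (lt_add_one ‖s‖)))).and
      (hc.and (hc.self_of_nhds.continuousAt.norm.eventually (gt_mem_nhds (lt_add_one ‖c s‖))))
  obtain ⟨Ω, hΩ, hopen, hmem⟩ := eventually_nhds_iff.1 hev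
  have hcd : DifferentiableOn ℂ c Ω := fun w hw => (hΩ w hw).2.1.differentiableWithinAt
  have hfam := isColFamily_extendZ r (P := Ω) (σ := fun p => (p : ℂ)) (ρ := ‖s‖ + 1)
    continuous_subtype_val (fun p => (hΩ p p.2).1.2.le) (fun p => (hΩ p p.2).1.1.le)
    (τ := fun _ => t) continuous_const
  have hg : ∀ x, DifferentiableOn ℂ (fun s => inhomZ s (c s) x) Ω := fun x => ?_
  · have h := differentiableOn_colSol hopen hfam 1 (a := fun s => -phi s) differentiable_phi.neg
      (g := fun s => inhomZ s (c s)) (C := ‖c s‖ + 1)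
      (continuous_inhomZ continuous_subtype_val hcd.continuousOn.domRestrict)
      (fun w hw x => (norm_inhomZ_le (hΩ w hw).1.1.le _ x).trans (hΩ w hw).2.2.le) hg (-z)
    exact h.differentiableAt (hopen.mem_nhds hmem)
  refine differentiableOn_pi.2 fun i => ?_
  simp only [inhomZ, hatExpCol_apply]
  refine DifferentiableOn.mul (Differentiable.differentiableOn ?_) (differentiableOn_pi.1 hcd i)
  have := differentiable_phi
  fun_prop

/-! ### The first column of `H₁`. -/

section H1

theorem continuous_bd1 (hs : (psi s).re ≤ 0) : Continuous (bd1 r s) :=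
  ((isColFamily_bd1 r (P := Unit) (σ := fun _ => s) continuous_const (fun _ => le_rfl)
    (fun _ => hs)).continuous_colSol 1 (g := fun _ _ => unitCol 0) continuous_const
    fun _ _ => le_rfl).comp ((Continuous.prodMk_right ()).comp continuous_neg)

theorem exists_bound_bd1 (hs : (psi s).re ≤ 0) : ∃ C, ∀ t, ‖bd1 r s t‖ ≤ C := by
  obtain ⟨B, hB⟩ := (isColFamily_bd1 r (P := Unit) (σ := fun _ => s) continuous_const
    (fun _ => le_rfl) (fun _ => hs)).exists_bound_colSol 1 (g := fun _ _ => unitCol 0)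
    fun _ _ => le_rfl
  exact ⟨B, fun t => hB () (-t)⟩

theorem neg_psi_mul (s : ℂ) (t τ : ℝ) :
    -psi s * (t - τ) = -(2 * I * lam s ^ 2 * (t - τ)) := neg_mul _ _

theorem bd1_eq (hs : (psi s).re ≤ 0) {t : ℝ} (ht : 0 ≤ t) :
    bd1 r s t = unitCol 0 + ∫ τ in (0 : ℝ)..t,
      hatExpCol 0 (-psi s * (t - τ)) (B₁ r 0 τ s *ᵥ bd1 r s τ) := by
  have := (isColFamily_bd1 r (P := Unit) (σ := fun _ => s) continuous_const (fun _ => le_rfl)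
    (fun _ => hs)).reflected_eq (g := fun _ _ => unitCol 0) continuous_const
    (fun _ _ => le_rfl) () ht
  simp only [neg_neg] at this
  exact this

theorem eq_bd1 (hs : (psi s).re ≤ 0) {f : ℝ → Fin 2 → ℂ} (hc : ContinuousOn f (Ici 0))
    (hf : ∀ t : ℝ, 0 ≤ t → f t = unitCol 0 + ∫ τ in (0 : ℝ)..t,
      hatExpCol 0 (-psi s * (t - τ)) (B₁ r 0 τ s *ᵥ f τ)) {t : ℝ} (ht : 0 ≤ t) :
    f t = bd1 r s t := by
  refine (isColFamily_bd1 r (P := Unit) (σ := fun _ => s) continuous_const (fun _ => le_rfl)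
    (fun _ => hs)).reflected_unique () (g := fun _ => unitCol 0) (fun t ht => ?_) (fun t ht => ?_)
    hc (continuous_bd1 r hs).continuousOn ht
  · simp only [neg_neg]
    exact hf t ht
  · simp only [neg_neg]
    exact bd1_eq r hs ht

/-- The conjugation fixes the unit column, so the two-variable equation splits into the `t`-equation
for the value at `z = 0` and the `z`-equation starting from `e^{φ z σ̂}` applied to that value. -/
theorem isH₁_extendZ (hφ : 0 ≤ (phi s).re) (hψ : (psi s).re ≤ 0) :
    IsH₁ r s 0 fun z t => extendZ r s t (bd1 r s t) z := by
  refine ⟨fun t _ => ?_, ?_, fun z t hz ht => ?_⟩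
  · exact ((continuous_extendZ r hφ continuous_const fun _ => le_rfl).comp
      (Continuous.prodMk_right t)).continuousOn
  · simp only [extendZ_zero r hφ]
    exact (continuous_bd1 r hψ).continuousOn
  · simp only [extendZ_zero r hφ, ← neg_psi_mul]
    conv_lhs => rw [extendZ_eq r hφ t _ hz, bd1_eq r hψ ht, hatExpCol_add, hatExpCol_unitCol,
      ← bd1_eq r hψ ht]
    simp only [phi]
    abel

variable {r} in
theorem IsH₁.eq_extendZ (hφ : 0 ≤ (phi s).re) (hψ : (psi s).re ≤ 0) {f : ℝ → ℝ → Fin 2 → ℂ}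
    (hf : IsH₁ r s 0 f) {z t : ℝ} (hz : 0 ≤ z) (ht : 0 ≤ t) :
    f z t = extendZ r s t (bd1 r s t) z := by
  have h0 : ∀ t : ℝ, 0 ≤ t → f 0 t = unitCol 0 + ∫ τ in (0 : ℝ)..t,
      hatExpCol 0 (-psi s * (t - τ)) (B₁ r 0 τ s *ᵥ f 0 τ) := by
    intro t ht
    have := hf.equation 0 t le_rfl ht
    rw [intervalIntegral.integral_same, add_zero, Complex.ofReal_zero, mul_zero,
      hatExpCol_zero] at this
    simpa only [neg_psi_mul] using this
  rw [← eq_bd1 r hψ hf.continuousOn_t h0 ht]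
  refine CLLNLS.eq_extendZ r hφ (f := fun z => f z t) (hf.continuousOn_z t ht) (fun z hz => ?_) hz
  have := hf.equation z t hz ht
  rw [h0 t ht, hatExpCol_add, hatExpCol_unitCol]
  simp only [neg_psi_mul]
  rw [this]
  simp only [phi]
  abel

theorem H₁_eq_extendZ (hφ : 0 ≤ (phi s).re) (hψ : (psi s).re ≤ 0) {z t : ℝ} (hz : 0 ≤ z)
    (ht : 0 ≤ t) : H₁ r z t s 0 = extendZ r s t (bd1 r s t) z :=
  (Classical.epsilon_spec ⟨_, isH₁_extendZ r hφ hψ⟩ : IsH₁ r s 0 _).eq_extendZ hφ hψ hz ht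

theorem differentiableAt_bd1 (hs : (psi s).re < 0) (t : ℝ) :
    DifferentiableAt ℂ (fun s => bd1 r s t) s := by
  have hev : ∀ᶠ w in 𝓝 s, (psi w).re < 0 ∧ ‖w‖ < ‖s‖ + 1 :=
    ((Complex.continuous_re.comp differentiable_psi.continuous).continuousAt.eventually
      (gt_mem_nhds hs)).and (continuous_norm.continuousAt.eventually
        (gt_mem_nhds (lt_add_one ‖s‖)))
  obtain ⟨Ω, hΩ, hopen, hmem⟩ := eventually_nhds_iff.1 hev
  have hfam := isColFamily_bd1 r (P := Ω) (σ := fun p => (p : ℂ)) (ρ := ‖s‖ + 1)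
    continuous_subtype_val (fun p => (hΩ p p.2).2.le) (fun p => (hΩ p p.2).1.le)
  have h := differentiableOn_colSol hopen hfam 1 differentiable_psi
    (g := fun _ _ => unitCol 0) (C := ‖unitCol 0‖) continuous_const
    (fun _ _ _ => le_rfl) (fun x => differentiableOn_const _) (-t)
  exact h.differentiableAt (hopen.mem_nhds hmem)

theorem differentiableAt_H₁ (hφ : 0 < (phi s).re) (hψ : (psi s).re < 0) {z t : ℝ} (hz : 0 ≤ z)
    (ht : 0 ≤ t) : DifferentiableAt ℂ (fun s => H₁ r z t s 0) s := by
  have hφ' := (Complex.continuous_re.comp differentiable_phi.continuous).continuousAt.eventually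
    (lt_mem_nhds hφ)
  have hψ' := (Complex.continuous_re.comp differentiable_psi.continuous).continuousAt.eventually
    (gt_mem_nhds hψ)
  refine (differentiableAt_extendZ r hφ (c := fun s => bd1 r s t)
    (hψ'.mono fun w hw => differentiableAt_bd1 r hw t) t z).congr_of_eventuallyEq ?_
  filter_upwards [hφ', hψ'] with w hw hw'
  exact H₁_eq_extendZ r (le_of_lt hw) (le_of_lt hw') hz ht

end H1

/-! ### The first column of `H₂`. -/

section H2

theorem continuous_bd2 (hs : 0 ≤ (psi s).re) : Continuous (bd2 r T s) :=
  ((isColFamily_bd2 r T (P := Unit) (σ := fun _ => s) continuous_const (fun _ => le_rfl)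
    (fun _ => hs)).continuous_colSol (-1) (g := fun _ _ => unitCol 0) continuous_const
    fun _ _ => le_rfl).comp (Continuous.prodMk_right ())

theorem exists_bound_bd2 (hs : 0 ≤ (psi s).re) : ∃ C, ∀ t, ‖bd2 r T s t‖ ≤ C := by
  obtain ⟨B, hB⟩ := (isColFamily_bd2 r T (P := Unit) (σ := fun _ => s) continuous_const
    (fun _ => le_rfl) (fun _ => hs)).exists_bound_colSol (-1) (g := fun _ _ => unitCol 0)
    fun _ _ => le_rfl
  exact ⟨B, fun t => hB () t⟩

theorem Ioi_inter_lt (t : ℝ) :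
    Ioi t ∩ {τ : ℝ | (τ : EReal) < T} = {τ : ℝ | t < τ ∧ (τ : EReal) < T} := rfl

theorem bd2_eq (hs : 0 ≤ (psi s).re) (t : ℝ) :
    bd2 r T s t = unitCol 0 - ∫ τ in {τ : ℝ | t < τ ∧ (τ : EReal) < T},
      hatExpCol 0 (-psi s * (t - τ)) (B₁ r 0 τ s *ᵥ bd2 r T s τ) := by
  have := (isColFamily_bd2 r T (P := Unit) (σ := fun _ => s) continuous_const (fun _ => le_rfl)
    (fun _ => hs)).colSol_eq (-1) (g := fun _ _ => unitCol 0) continuous_const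
    (fun _ _ => le_rfl) () t
  rw [neg_one_smul, ← sub_eq_add_neg, Ioi_inter_lt] at this
  exact this

/-- In contrast to `eq_bd1`, the integral runs up to the open and possibly infinite end `T`, so
boundedness cannot be drawn from compactness and is part of the uniqueness class. -/
theorem eq_bd2 (hs : 0 ≤ (psi s).re) {f : ℝ → Fin 2 → ℂ} (hc : ContinuousOn f (timeSet T))
    (hb : ∃ C : ℝ, ∀ t ∈ timeSet T, ‖f t‖ ≤ C)
    (hf : ∀ t ∈ timeSet T, f t = unitCol 0 - ∫ τ in {τ : ℝ | t < τ ∧ (τ : EReal) < T},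
      hatExpCol 0 (-psi s * (t - τ)) (B₁ r 0 τ s *ᵥ f τ)) {t : ℝ} (ht : t ∈ timeSet T) :
    f t = bd2 r T s t := by
  obtain ⟨C, hC⟩ := hb
  obtain ⟨C', hC'⟩ := exists_bound_bd2 r T hs
  refine (isColFamily_bd2 r T (P := Unit) (σ := fun _ => s) continuous_const (fun _ => le_rfl)
    (fun _ => hs)).unique (fun a b hab ha => ?_) (-1) () (g := fun _ => unitCol 0) (x₀ := 0)
    (fun t ht ht' => ?_) (fun t ht ht' => ?_) hc (continuous_bd2 r T hs).continuousOn
    (fun t ht ht' => hC t ⟨ht, ht'⟩) (fun t ht ht' => hC' t) ht.1 ht.2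
  · exact lt_of_le_of_lt (EReal.coe_le_coe_iff.2 hab) ha
  · rw [neg_one_smul, ← sub_eq_add_neg, Ioi_inter_lt]
    exact hf t ⟨ht, ht'⟩
  · rw [neg_one_smul, ← sub_eq_add_neg, Ioi_inter_lt]
    exact bd2_eq r T hs t

theorem isH₂_extendZ (hφ : 0 ≤ (phi s).re) (hψ : 0 ≤ (psi s).re) :
    IsH₂ r T s 0 fun z t => extendZ r s t (bd2 r T s t) z := by
  refine ⟨fun t _ => ?_, ?_, ?_, fun z t hz ht => ?_⟩
  · exact ((continuous_extendZ r hφ continuous_const fun _ => le_rfl).comp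
      (Continuous.prodMk_right t)).continuousOn
  · simp only [extendZ_zero r hφ]
    exact (continuous_bd2 r T hψ).continuousOn
  · simp only [extendZ_zero r hφ]
    obtain ⟨C, hC⟩ := exists_bound_bd2 r T hψ
    exact ⟨C, fun t _ => hC t⟩
  · simp only [extendZ_zero r hφ, ← neg_psi_mul]
    conv_lhs => rw [extendZ_eq r hφ t _ hz, bd2_eq r T hψ t, hatExpCol_sub, hatExpCol_unitCol,
      ← bd2_eq r T hψ t]
    simp only [phi]
    abel

variable {r T} in
theorem IsH₂.eq_extendZ (hφ : 0 ≤ (phi s).re) (hψ : 0 ≤ (psi s).re) {f : ℝ → ℝ → Fin 2 → ℂ}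
    (hf : IsH₂ r T s 0 f) {z t : ℝ} (hz : 0 ≤ z) (ht : t ∈ timeSet T) :
    f z t = extendZ r s t (bd2 r T s t) z := by
  have h0 : ∀ t ∈ timeSet T, f 0 t = unitCol 0 - ∫ τ in {τ : ℝ | t < τ ∧ (τ : EReal) < T},
      hatExpCol 0 (-psi s * (t - τ)) (B₁ r 0 τ s *ᵥ f 0 τ) := by
    intro t ht
    have := hf.equation 0 t le_rfl ht
    rw [intervalIntegral.integral_same, add_zero, Complex.ofReal_zero, mul_zero,
      hatExpCol_zero] at this
    simpa only [neg_psi_mul] using this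
  rw [← eq_bd2 r T hψ hf.continuousOn_t hf.bounded_t h0 ht]
  refine CLLNLS.eq_extendZ r hφ (f := fun z => f z t) (hf.continuousOn_z t ht) (fun z hz => ?_) hz
  have := hf.equation z t hz ht
  rw [h0 t ht, hatExpCol_sub, hatExpCol_unitCol]
  simp only [neg_psi_mul]
  rw [this]
  simp only [phi]
  abel

theorem H₂_eq_extendZ (hφ : 0 ≤ (phi s).re) (hψ : 0 ≤ (psi s).re) {z t : ℝ} (hz : 0 ≤ z)
    (ht : t ∈ timeSet T) : H₂ r T z t s 0 = extendZ r s t (bd2 r T s t) z :=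
  (Classical.epsilon_spec ⟨_, isH₂_extendZ r T hφ hψ⟩ : IsH₂ r T s 0 _).eq_extendZ hφ hψ hz ht

theorem differentiableAt_bd2 (hs : 0 < (psi s).re) (t : ℝ) :
    DifferentiableAt ℂ (fun s => bd2 r T s t) s := by
  have hev : ∀ᶠ w in 𝓝 s, 0 < (psi w).re ∧ ‖w‖ < ‖s‖ + 1 :=
    ((Complex.continuous_re.comp differentiable_psi.continuous).continuousAt.eventually
      (lt_mem_nhds hs)).and (continuous_norm.continuousAt.eventually
        (gt_mem_nhds (lt_add_one ‖s‖)))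
  obtain ⟨Ω, hΩ, hopen, hmem⟩ := eventually_nhds_iff.1 hev
  have hfam := isColFamily_bd2 r T (P := Ω) (σ := fun p => (p : ℂ)) (ρ := ‖s‖ + 1)
    continuous_subtype_val (fun p => (hΩ p p.2).2.le) (fun p => (hΩ p p.2).1.le)
  have h := differentiableOn_colSol hopen hfam (-1) (a := fun s => -psi s) differentiable_psi.neg
    (g := fun _ _ => unitCol 0) (C := ‖unitCol 0‖) continuous_const
    (fun _ _ _ => le_rfl) (fun x => differentiableOn_const _) t
  exact h.differentiableAt (hopen.mem_nhds hmem)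

theorem differentiableAt_H₂ (hφ : 0 < (phi s).re) (hψ : 0 < (psi s).re) {z t : ℝ} (hz : 0 ≤ z)
    (ht : t ∈ timeSet T) : DifferentiableAt ℂ (fun s => H₂ r T z t s 0) s := by
  have hφ' := (Complex.continuous_re.comp differentiable_phi.continuous).continuousAt.eventually
    (lt_mem_nhds hφ)
  have hψ' := (Complex.continuous_re.comp differentiable_psi.continuous).continuousAt.eventually
    (lt_mem_nhds hψ)
  refine (differentiableAt_extendZ r hφ (c := fun s => bd2 r T s t)
    (hψ'.mono fun w hw => differentiableAt_bd2 r T hw t) t z).congr_of_eventuallyEq ?_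
  filter_upwards [hφ', hψ'] with w hw hw'
  exact H₂_eq_extendZ r T (le_of_lt hw) (le_of_lt hw') hz ht

end H2

end Existence

/-! ### Linear systems and zero curvature -/

section ZeroCurvature

variable {F : Type*} [NormedAddCommGroup F] [NormedSpace ℝ F] [CompleteSpace F]

theorem eq_add_integral_of_hasDerivWithinAt {f f' : ℝ → F} {a b : ℝ} (hab : a ≤ b)
    (hf : ContinuousOn f (Icc a b)) (hf' : ∀ x ∈ Ico a b, HasDerivWithinAt f (f' x) (Ici x) x)
    (hc : Continuous f') : f b = f a + ∫ x in a..b, f' x := by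
  rw [intervalIntegral.integral_eq_sub_of_hasDeriv_right_of_le hab hf
    (fun x hx => (hf' x ⟨hx.1.le, hx.2⟩).mono Ioi_subset_Ici_self) (hc.intervalIntegrable a b)]
  abel

/-- If a function of two variables solves the `z`-equation for all times and the `t`-equation on
the line `z = 0`, and the curvature vanishes, then it solves the `t`-equation for all `z ≥ 0`. -/
theorem zeroCurvature_propagation {a b a' b' : ℝ × ℝ → F →L[ℝ] F} (ha : Continuous a)
    (hb : Continuous b) (ha' : Continuous a') (hb' : Continuous b')
    (hda : ∀ z t, HasDerivAt (fun t => a (z, t)) (a' (z, t)) t)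
    (hdb : ∀ z t, HasDerivAt (fun z => b (z, t)) (b' (z, t)) z) {t₁ : ℝ} (ht₁ : 0 ≤ t₁)
    (hzc : ∀ z t, 0 ≤ z → t ∈ Icc 0 t₁ →
      a' (z, t) + (a (z, t)).comp (b (z, t)) = b' (z, t) + (b (z, t)).comp (a (z, t)))
    {f : ℝ × ℝ → F} (hf : Continuous f)
    (hfz : ∀ t ∈ Icc 0 t₁, ∀ z, 0 ≤ z →
      HasDerivWithinAt (fun z => f (z, t)) (a (z, t) (f (z, t))) (Ici z) z)
    (hft : ∀ t ∈ Ico 0 t₁, HasDerivWithinAt (fun t => f (0, t)) (b (0, t) (f (0, t))) (Ici t) t)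
    {z t : ℝ} (hz : 0 ≤ z) (ht : t ∈ Icc 0 t₁) :
    f (z, t) = f (z, 0) + ∫ τ in (0 : ℝ)..t, b (z, τ) (f (z, τ)) := by
  have hsec : ∀ {G : ℝ × ℝ → F}, Continuous G → ∀ z, Continuous fun t => G (z, t) := fun h z =>
    h.comp (Continuous.prodMk_right z)
  have hsec' : ∀ {G : ℝ × ℝ → F}, Continuous G → ∀ t, Continuous fun z => G (z, t) := fun h t =>
    h.comp (Continuous.prodMk_left t)
  have haf : Continuous fun p => a p (f p) := ha.clm_apply hf
  have hbf : Continuous fun p => b p (f p) := hb.clm_apply hf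
  -- `P` is what `f` would be if the `t`-equation held, and `N = f - P` is the defect. Off the axis
  -- `f` is only known to be continuous in `t`, whereas `P` is differentiable, so `t`-derivatives
  -- are taken of `P`.
  let P : ℝ → ℝ → F := fun z t => f (z, 0) + ∫ τ in (0 : ℝ)..t, b (z, τ) (f (z, τ))
  have hPc : Continuous fun p : ℝ × ℝ => P p.1 p.2 := by
    refine (hf.comp (continuous_fst.prodMk continuous_const)).add ?_
    refine intervalIntegral.continuous_parametric_intervalIntegral_of_continuous
      (f := fun (p : ℝ × ℝ) τ => b (p.1, τ) (f (p.1, τ))) ?_ continuous_snd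
    exact hbf.comp (f := fun q : (ℝ × ℝ) × ℝ => (q.1.1, q.2)) (by fun_prop)
  have hPd : ∀ z t, HasDerivAt (P z) (b (z, t) (f (z, t))) t := fun z t =>
    ((hsec hbf z).integral_hasStrictDerivAt 0 t).hasDerivAt.const_add _
  let N : ℝ × ℝ → F := fun p => f p - P p.1 p.2
  have hNc : Continuous N := hf.sub hPc
  -- Vanishing curvature replaces `b' f + b a f` by `a' f + a b f`. With `f = P + N` this is the
  -- `t`-derivative of `a P` plus `a' N`, and the first term integrates exactly.
  have hbracket : ∀ z t, 0 ≤ z → t ∈ Icc 0 t₁ →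
      a (z, t) (f (z, t)) - a (z, 0) (f (z, 0)) -
        ∫ τ in (0 : ℝ)..t, (b' (z, τ) (f (z, τ)) + b (z, τ) (a (z, τ) (f (z, τ)))) =
      a (z, t) (N (z, t)) - ∫ τ in (0 : ℝ)..t, a' (z, τ) (N (z, τ)) := by
    intro z t hz ht
    have hd : ∀ τ, HasDerivAt (fun τ => a (z, τ) (P z τ))
        (a' (z, τ) (P z τ) + a (z, τ) (b (z, τ) (f (z, τ)))) τ := fun τ =>
      (hda z τ).clm_apply (hPd z τ)
    have hc1 : Continuous fun τ => a' (z, τ) (P z τ) :=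
      hsec (G := fun p => a' p (P p.1 p.2)) (ha'.clm_apply hPc) z
    have hc2 : Continuous fun τ => a (z, τ) (b (z, τ) (f (z, τ))) :=
      hsec (G := fun p => a p (b p (f p))) (ha.clm_apply hbf) z
    have hc3 : Continuous fun τ => a' (z, τ) (N (z, τ)) :=
      hsec (G := fun p => a' p (N p)) (ha'.clm_apply hNc) z
    have h1 := intervalIntegral.integral_eq_sub_of_hasDerivAt (a := 0) (b := t)
      (fun τ _ => hd τ) ((hc1.add hc2).intervalIntegrable 0 t)
    have h2 : ∫ τ in (0 : ℝ)..t, (b' (z, τ) (f (z, τ)) + b (z, τ) (a (z, τ) (f (z, τ)))) =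
        ∫ τ in (0 : ℝ)..t, ((a' (z, τ) (P z τ) + a (z, τ) (b (z, τ) (f (z, τ)))) +
          a' (z, τ) (N (z, τ))) := by
      refine intervalIntegral.integral_congr fun τ hτ => ?_
      rw [uIcc_of_le ht.1] at hτ
      have h3 := congrArg (fun L => L (f (z, τ))) (hzc z τ hz ⟨hτ.1, hτ.2.trans ht.2⟩)
      simp only [_root_.add_apply, ContinuousLinearMap.comp_apply] at h3
      simp only [N, map_sub]
      rw [← h3]
      abel
    have i12 : IntervalIntegrable
        (fun τ => a' (z, τ) (P z τ) + a (z, τ) (b (z, τ) (f (z, τ)))) volume 0 t :=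
      (hc1.add hc2).intervalIntegrable 0 t
    rw [h2, intervalIntegral.integral_add i12 (hc3.intervalIntegrable 0 t), h1]
    simp only [N, P, map_sub, intervalIntegral.integral_same, add_zero]
    abel
  -- Integrating the `z`-equation at times `0` and `t` and the `t`-equation on the axis, then
  -- exchanging the two integrals, gives a homogeneous Volterra equation in `z` for the defect.
  have hN : ∀ z t, 0 ≤ z → t ∈ Icc 0 t₁ → N (z, t) = ∫ ζ in (0 : ℝ)..z,
      (a (ζ, t) (N (ζ, t)) - ∫ τ in (0 : ℝ)..t, a' (ζ, τ) (N (ζ, τ))) := by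
    intro z t hz ht
    have e1 : ∀ τ ∈ Icc 0 t₁, f (z, τ) = f (0, τ) + ∫ ζ in (0 : ℝ)..z, a (ζ, τ) (f (ζ, τ)) :=
      fun τ hτ => eq_add_integral_of_hasDerivWithinAt hz (hsec' hf τ).continuousOn
        (fun ζ hζ => hfz τ hτ ζ hζ.1) (hsec' haf τ)
    have e2 : f (0, t) = f (0, 0) + ∫ τ in (0 : ℝ)..t, b (0, τ) (f (0, τ)) :=
      eq_add_integral_of_hasDerivWithinAt ht.1 (hsec hf 0).continuousOn
        (fun τ hτ => hft τ ⟨hτ.1, hτ.2.trans_le ht.2⟩) (hsec hbf 0)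
    have hg : Continuous fun p => b' p (f p) + b p (a p (f p)) :=
      (hb'.clm_apply hf).add (hb.clm_apply haf)
    have e3 : ∀ τ ∈ Icc 0 t₁, b (z, τ) (f (z, τ)) = b (0, τ) (f (0, τ)) +
        ∫ ζ in (0 : ℝ)..z, (b' (ζ, τ) (f (ζ, τ)) + b (ζ, τ) (a (ζ, τ) (f (ζ, τ)))) :=
      fun τ hτ => eq_add_integral_of_hasDerivWithinAt (f := fun ζ => b (ζ, τ) (f (ζ, τ))) hz
        (hsec' hbf τ).continuousOn
        (fun ζ hζ => (hdb ζ τ).hasDerivWithinAt.clm_apply (hfz τ hτ ζ hζ.1)) (hsec' hg τ)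
    have e4 : ∫ τ in (0 : ℝ)..t, b (z, τ) (f (z, τ)) = (∫ τ in (0 : ℝ)..t, b (0, τ) (f (0, τ))) +
        ∫ ζ in (0 : ℝ)..z, ∫ τ in (0 : ℝ)..t,
          (b' (ζ, τ) (f (ζ, τ)) + b (ζ, τ) (a (ζ, τ) (f (ζ, τ)))) := by
      rw [intervalIntegral_intervalIntegral_swap, ← intervalIntegral.integral_add]
      · refine intervalIntegral.integral_congr fun τ hτ => ?_
        rw [uIcc_of_le ht.1] at hτ
        exact e3 τ ⟨hτ.1, hτ.2.trans ht.2⟩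
      · exact (hsec hbf 0).intervalIntegrable 0 t
      · refine Continuous.intervalIntegrable ?_ 0 t
        refine intervalIntegral.continuous_parametric_intervalIntegral_of_continuous' ?_ 0 z
        exact hg.comp (f := fun q : ℝ × ℝ => (q.2, q.1)) (by fun_prop)
      · refine IntegrableOn.mono_set (t := uIcc 0 z ×ˢ uIcc 0 t) ?_
          (prod_mono uIoc_subset_uIcc uIoc_subset_uIcc)
        exact hg.continuousOn.integrableOn_compact (isCompact_uIcc.prod isCompact_uIcc)
    have hc4 : Continuous fun ζ => ∫ τ in (0 : ℝ)..t,
        (b' (ζ, τ) (f (ζ, τ)) + b (ζ, τ) (a (ζ, τ) (f (ζ, τ)))) :=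
      intervalIntegral.continuous_parametric_intervalIntegral_of_continuous'
        (f := fun ζ τ => b' (ζ, τ) (f (ζ, τ)) + b (ζ, τ) (a (ζ, τ) (f (ζ, τ)))) hg 0 t
    have e5 : N (z, t) = ∫ ζ in (0 : ℝ)..z, (a (ζ, t) (f (ζ, t)) - a (ζ, 0) (f (ζ, 0)) -
        ∫ τ in (0 : ℝ)..t, (b' (ζ, τ) (f (ζ, τ)) + b (ζ, τ) (a (ζ, τ) (f (ζ, τ))))) := by
      have i1 : IntervalIntegrable (fun ζ => a (ζ, t) (f (ζ, t)) - a (ζ, 0) (f (ζ, 0))) volume 0 z :=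
        ((hsec' haf t).sub (hsec' haf 0)).intervalIntegrable 0 z
      rw [intervalIntegral.integral_sub i1 (hc4.intervalIntegrable 0 z),
        intervalIntegral.integral_sub ((hsec' haf t).intervalIntegrable 0 z)
          ((hsec' haf 0).intervalIntegrable 0 z)]
      simp only [N, P]
      rw [e1 t ht, e1 0 ⟨le_rfl, ht₁⟩, e2, e4]
      abel
    rw [e5]
    refine intervalIntegral.integral_congr fun ζ hζ => ?_
    rw [uIcc_of_le hz] at hζ
    exact hbracket ζ t hζ.1 ht
  -- The rectangle is fixed under a fresh name so that the bounds on it stay constant while `z`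
  -- varies in the induction.
  obtain ⟨Z, hZ⟩ : ∃ Z, z ≤ Z := ⟨z, le_rfl⟩
  have hcompact : IsCompact (Icc (0 : ℝ) Z ×ˢ Icc (0 : ℝ) t₁) := isCompact_Icc.prod isCompact_Icc
  obtain ⟨M, hM⟩ := hcompact.exists_bound_of_continuousOn hNc.continuousOn
  obtain ⟨L, hL⟩ := hcompact.exists_bound_of_continuousOn ha.continuousOn
  obtain ⟨L', hL'⟩ := hcompact.exists_bound_of_continuousOn ha'.continuousOn
  have hmem0 : ((0 : ℝ), (0 : ℝ)) ∈ Icc (0 : ℝ) Z ×ˢ Icc (0 : ℝ) t₁ :=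
    ⟨⟨le_rfl, hz.trans hZ⟩, ⟨le_rfl, ht₁⟩⟩
  have hL0 : 0 ≤ L := (norm_nonneg _).trans (hL _ hmem0)
  have hL0' : 0 ≤ L' := (norm_nonneg _).trans (hL' _ hmem0)
  have hM0 : 0 ≤ M := (norm_nonneg _).trans (hM _ hmem0)
  have key : ∀ (n : ℕ) (z t : ℝ), z ∈ Icc 0 Z → t ∈ Icc 0 t₁ →
      ‖N (z, t)‖ ≤ M * (((L + L' * t₁) * z) ^ n / n.factorial) := by
    intro n
    induction n with
    | zero => intro z t hz ht; simpa using hM (z, t) ⟨hz, ht⟩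
    | succ n ih =>
      intro z t hz ht
      rw [hN z t hz.1 ht]
      have hint : ∫ ζ in (0 : ℝ)..z, (L + L' * t₁) *
          (M * (((L + L' * t₁) * ζ) ^ n / n.factorial)) =
          M * (((L + L' * t₁) * z) ^ (n + 1) / (n + 1).factorial) := by
        have e : (fun ζ : ℝ => (L + L' * t₁) * (M * (((L + L' * t₁) * ζ) ^ n / n.factorial))) =
            fun ζ => (M * (L + L' * t₁) ^ (n + 1) / n.factorial) * ζ ^ n := by
          funext ζ; rw [mul_pow]; ring
        rw [e, intervalIntegral.integral_const_mul, integral_pow, Nat.factorial_succ, mul_pow]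
        push_cast
        field_simp
        simp
      rw [← hint]
      refine intervalIntegral.norm_integral_le_of_norm_le hz.1 (ae_of_all _ fun ζ hζ => ?_)
        (Continuous.intervalIntegrable (by fun_prop) 0 z)
      have hζZ : ζ ∈ Icc 0 Z := ⟨hζ.1.le, hζ.2.trans hz.2⟩
      set X := M * (((L + L' * t₁) * ζ) ^ n / n.factorial) with hX
      have hX0 : 0 ≤ X := (norm_nonneg _).trans (ih ζ t hζZ ht)
      have b1 : ‖a (ζ, t) (N (ζ, t))‖ ≤ L * X := ((a (ζ, t)).le_opNorm _).trans
        (mul_le_mul (hL _ ⟨hζZ, ht⟩) (ih ζ t hζZ ht) (norm_nonneg _) hL0)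
      have b2 : ‖∫ τ in (0 : ℝ)..t, a' (ζ, τ) (N (ζ, τ))‖ ≤ L' * X * |t - 0| := by
        refine intervalIntegral.norm_integral_le_of_norm_le_const fun τ hτ => ?_
        rw [uIoc_of_le ht.1] at hτ
        have hτ' : τ ∈ Icc 0 t₁ := ⟨hτ.1.le, hτ.2.trans ht.2⟩
        exact ((a' (ζ, τ)).le_opNorm _).trans
          (mul_le_mul (hL' _ ⟨hζZ, hτ'⟩) (ih ζ τ hζZ hτ') (norm_nonneg _) hL0')
      rw [sub_zero, abs_of_nonneg ht.1] at b2
      have b3 : L' * X * t ≤ L' * X * t₁ := mul_le_mul_of_nonneg_left ht.2 (mul_nonneg hL0' hX0)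
      calc _ ≤ _ := norm_sub_le _ _
        _ ≤ L * X + L' * X * t₁ := add_le_add b1 (b2.trans b3)
        _ = _ := by ring
  have hlim := (summable_const_mul_pow_div_factorial M ((L + L' * t₁) * z)).tendsto_atTop_zero
  have h0 : N (z, t) = 0 :=
    norm_le_zero_iff.1 (ge_of_tendsto' hlim fun n => key n z t ⟨hz, hZ⟩ ht)
  exact sub_eq_zero.1 h0

end ZeroCurvature

/-! ### The Lax pair -/

section Lax

variable (r : 𝓢(ℝ × ℝ, ℂ))

/-- The matrix `iλσ + A` of the `z`-part of the Lax pair. -/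
def laxA (s : ℂ) (p : ℝ × ℝ) : Matrix (Fin 2) (Fin 2) ℂ := phi s • sigma + A r p.1 p.2 s

/-- The matrix `-2iλ²σ + B` of the `t`-part of the Lax pair. -/
def laxB (s : ℂ) (p : ℝ × ℝ) : Matrix (Fin 2) (Fin 2) ℂ := (-psi s) • sigma + B r p.1 p.2 s

/-- `∂ (|r|²)/∂z`. -/
def nrz (z t : ℝ) : ℂ := rz r z t * conj (r (z, t)) + r (z, t) * conj (rz r z t)

/-- `∂ (|r|²)/∂t`. -/
def nrt (z t : ℝ) : ℂ := rt r z t * conj (r (z, t)) + r (z, t) * conj (rt r z t)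

/-- The `t`-derivative of `laxA`. -/
def laxAt (s : ℂ) (p : ℝ × ℝ) : Matrix (Fin 2) (Fin 2) ℂ :=
  !![-(I / 4) * nrt r p.1 p.2, s * rt r p.1 p.2; -s * conj (rt r p.1 p.2), I / 4 * nrt r p.1 p.2]

/-- The `z`-derivative of `bDiag`. -/
def bDiagz (z t : ℝ) (s : ℂ) : ℂ :=
  I * s ^ 2 * nrz r z t - I / 4 * (nr r z t * nrz r z t)
    + 1 / 4 * (conj (r (z, t)) * rzz r z t - r (z, t) * conj (rzz r z t))

/-- The `z`-derivative of `bOff`. -/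
def bOffz (z t : ℝ) (s : ℂ) : ℂ :=
  -2 * s ^ 3 * rz r z t + s * (rz r z t + I * rzz r z t
    + 1 / 2 * (nrz r z t * r (z, t) + nr r z t * rz r z t))

/-- The `z`-derivative of `bOff'`. -/
def bOffz' (z t : ℝ) (s : ℂ) : ℂ :=
  2 * s ^ 3 * conj (rz r z t) + s * (-conj (rz r z t) + I * conj (rzz r z t)
    - 1 / 2 * (nrz r z t * conj (r (z, t)) + nr r z t * conj (rz r z t)))

/-- The `z`-derivative of `laxB`. -/
def laxBz (s : ℂ) (p : ℝ × ℝ) : Matrix (Fin 2) (Fin 2) ℂ :=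
  !![bDiagz r p.1 p.2 s, bOffz r p.1 p.2 s; bOffz' r p.1 p.2 s, -bDiagz r p.1 p.2 s]

theorem laxA_eq (s : ℂ) (p : ℝ × ℝ) : laxA r s p =
    !![phi s - I / 4 * nr r p.1 p.2, s * r (p.1, p.2);
      -s * conj (r (p.1, p.2)), -phi s + I / 4 * nr r p.1 p.2] := by
  rw [laxA, A_eq]
  ext i j
  fin_cases i <;> fin_cases j <;> simp [sigma]
  ring

theorem laxB_eq (s : ℂ) (p : ℝ × ℝ) : laxB r s p =
    !![-psi s + bDiag r p.1 p.2 s, bOff r p.1 p.2 s;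
      bOff' r p.1 p.2 s, psi s - bDiag r p.1 p.2 s] := by
  rw [laxB, B_eq]
  ext i j
  fin_cases i <;> fin_cases j <;> simp [sigma]
  ring

theorem hasDerivAt_nr_fst (z t : ℝ) : HasDerivAt (fun x => nr r x t) (nrz r z t) z :=
  (hasDerivAt_r_fst r z t).mul (hasDerivAt_conj (hasDerivAt_r_fst r z t))

theorem hasDerivAt_nr_snd (z t : ℝ) : HasDerivAt (fun x => nr r z x) (nrt r z t) t :=
  (hasDerivAt_r_snd r z t).mul (hasDerivAt_conj (hasDerivAt_r_snd r z t))

theorem hasDerivAt_laxA (s : ℂ) (z t : ℝ) (i j : Fin 2) :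
    HasDerivAt (fun t => laxA r s (z, t) i j) (laxAt r s (z, t) i j) t := by
  have h := hasDerivAt_r_snd r z t
  have hc := hasDerivAt_conj h
  have hn := hasDerivAt_nr_snd r z t
  simp only [laxA_eq, laxAt]
  fin_cases i <;> fin_cases j
  · exact ((hn.const_mul (I / 4)).const_sub (phi s)).congr_deriv (by simp)
  · exact h.const_mul s
  · exact hc.const_mul (-s)
  · exact (hn.const_mul (I / 4)).const_add (-phi s)

theorem hasDerivAt_laxB (s : ℂ) (z t : ℝ) (i j : Fin 2) :
    HasDerivAt (fun z => laxB r s (z, t) i j) (laxBz r s (z, t) i j) z := by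
  have h := hasDerivAt_r_fst r z t
  have hz := hasDerivAt_rz_fst r z t
  have hc := hasDerivAt_conj h
  have hzc := hasDerivAt_conj hz
  have hn := hasDerivAt_nr_fst r z t
  have hd : HasDerivAt (fun z => bDiag r z t s) (bDiagz r z t s) z := by
    refine ((((hn.const_mul (I * s ^ 2)).sub ((hn.pow 2).const_mul (I / 8))).add
      (((hc.mul hz).sub (h.mul hzc)).const_mul (1 / 4)))).congr_deriv ?_
    rw [bDiagz]
    ring
  simp only [laxB_eq, laxBz]
  fin_cases i <;> fin_cases j
  · exact hd.const_add _
  · exact (h.const_mul (-2 * s ^ 3)).add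
      ((((h.add (hz.const_mul I)).add ((hn.const_mul (1 / 2)).mul h)).const_mul s).congr_deriv
        (by ring))
  · exact (hc.const_mul (2 * s ^ 3)).add
      ((((hc.neg.add (hzc.const_mul I)).sub ((hn.const_mul (1 / 2)).mul hc)).const_mul
        s).congr_deriv (by ring))
  · exact hd.const_sub _

/-- The equation, solved for `r_t`, on the closure of the domain. -/
theorem IsSolution.rt_eq_of_nonneg {r : 𝓢(ℝ × ℝ, ℂ)} {T : EReal} (hr : IsSolution r T) {z t : ℝ}
    (hz : 0 ≤ z) (ht : t ∈ timeSet T) :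
    rt r z t = I * rzz r z t + I * nr r z t * r (z, t) + nr r z t * rz r z t := by
  -- The boundary is approached along the diagonal, which makes both coordinates positive at once.
  let e : ℝ → ℂ := fun ε => rt r (z + ε) (t + ε) - (I * rzz r (z + ε) (t + ε)
    + I * nr r (z + ε) (t + ε) * r (z + ε, t + ε) + nr r (z + ε) (t + ε) * rz r (z + ε) (t + ε))
  have hcont : Continuous e := by
    have h0 := r.continuous
    have h1 := (rzS r).continuous
    have h2 := (rzzS r).continuous
    have h3 := (rtS r).continuous
    have h4 := Complex.continuous_conj
    simp only [e, rt_eq, rzz_eq, rz_eq, nr]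
    fun_prop
  have hev : ∀ᶠ ε in 𝓝[>] (0 : ℝ), e ε = 0 := by
    have hT : ∀ᶠ ε in 𝓝[>] (0 : ℝ), ((t + ε : ℝ) : EReal) < T := by
      have hc : Continuous fun ε : ℝ => ((t + ε : ℝ) : EReal) :=
        continuous_coe_real_ereal.comp (continuous_const.add continuous_id)
      refine (hc.tendsto 0).mono_left nhdsWithin_le_nhds |>.eventually (gt_mem_nhds ?_)
      simpa using ht.2
    filter_upwards [hT, self_mem_nhdsWithin] with ε hεT hε
    have h := hr (z + ε) (t + ε) (add_pos_of_nonneg_of_pos hz hε)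
      (add_pos_of_nonneg_of_pos ht.1 hε) hεT
    rw [norm_sq_eq_mul_conj] at h
    simp only [e, nr]
    linear_combination (-I) * h + (rt r (z + ε) (t + ε) - r (z + ε, t + ε) *
      conj (r (z + ε, t + ε)) * rz r (z + ε) (t + ε)) * Complex.I_sq
  have h1 : Tendsto e (𝓝[>] 0) (𝓝 (e 0)) := (hcont.tendsto 0).mono_left nhdsWithin_le_nhds
  have h2 : e 0 = 0 := tendsto_nhds_unique_of_eventuallyEq h1 tendsto_const_nhds hev
  simp only [e, add_zero] at h2
  exact sub_eq_zero.1 h2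

/-- Once `r_t` and its conjugate are eliminated by means of the equation, this is a polynomial
identity in `s`, `r`, `r_z`, `r_zz` and their conjugates, all treated as independent variables. -/
theorem IsSolution.zero_curvature {r : 𝓢(ℝ × ℝ, ℂ)} {T : EReal} (hr : IsSolution r T) (s : ℂ)
    {z t : ℝ} (hz : 0 ≤ z) (ht : t ∈ timeSet T) :
    laxAt r s (z, t) + laxA r s (z, t) * laxB r s (z, t) =
      laxBz r s (z, t) + laxB r s (z, t) * laxA r s (z, t) := by
  have h := hr.rt_eq_of_nonneg hz ht
  have hI := Complex.I_sq
  have hc := congrArg conj h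
  simp only [map_add, map_mul, conj_I, nr, conj_conj] at hc h
  simp only [laxA_eq, laxB_eq, laxAt, laxBz, bDiag, bOff, bOff', bDiagz, bOffz, bOffz', nrz, nrt, nr,
    phi, psi, lam] at *
  generalize rt r z t = at_, r (z, t) = a0, rz r z t = a1, rzz r z t = a2, conj (rt r z t) = bt,
    conj (r (z, t)) = b0, conj (rz r z t) = b1, conj (rzz r z t) = b2 at *
  subst h hc
  ext i j
  fin_cases i <;> fin_cases j <;>
    simp <;> ring_nf <;> simp only [hI] <;> ring

/-- Matrices as real continuous linear maps. -/
def matCLMR : (Fin 2 → Fin 2 → ℂ) →L[ℝ] ((Fin 2 → ℂ) →L[ℝ] (Fin 2 → ℂ)) :=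
  (ContinuousLinearMap.restrictScalarsL ℂ (Fin 2 → ℂ) (Fin 2 → ℂ) ℝ ℝ).comp
    (matCLM.restrictScalars ℝ)

theorem matCLMR_mul (M N : Matrix (Fin 2) (Fin 2) ℂ) :
    matCLMR (M * N) = (matCLMR M).comp (matCLMR N) := by
  refine ContinuousLinearMap.ext fun f => ?_
  exact (Matrix.mulVec_mulVec f M N).symm

theorem continuous_matCLMR {M : ℝ × ℝ → Matrix (Fin 2) (Fin 2) ℂ}
    (h : ∀ i j, Continuous fun p => M p i j) : Continuous fun p => matCLMR (M p) :=
  matCLMR.continuous.comp (continuous_pi fun i => continuous_pi fun j => h i j)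

theorem hasDerivAt_matCLMR {M : ℝ → Matrix (Fin 2) (Fin 2) ℂ} {M' : Matrix (Fin 2) (Fin 2) ℂ}
    {x : ℝ} (h : ∀ i j, HasDerivAt (fun x => M x i j) (M' i j) x) :
    HasDerivAt (fun x => matCLMR (M x)) (matCLMR M') x :=
  HasFDerivAt.comp_hasDerivAt (f := fun x => (fun i j => M x i j : Fin 2 → Fin 2 → ℂ))
    (f' := fun i j => M' i j) x matCLMR.hasFDerivAt
    (hasDerivAt_pi.2 fun i => hasDerivAt_pi.2 fun j => h i j)

theorem IsCoeff.continuous_fst {Q : ℝ × ℝ → ℂ → ℂ} (h : IsCoeff Q) (s : ℂ) :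
    Continuous fun p => Q p s :=
  h.continuous.comp (f := fun p => (p, s)) (by fun_prop)

theorem continuous_laxA (s : ℂ) (i j : Fin 2) : Continuous fun p => laxA r s p i j := by
  simp only [laxA, Matrix.add_apply]
  exact continuous_const.add ((isCoeff_A r i j).continuous_fst s)

theorem continuous_laxB (s : ℂ) (i j : Fin 2) : Continuous fun p => laxB r s p i j := by
  simp only [laxB, Matrix.add_apply]
  exact continuous_const.add ((isCoeff_B r i j).continuous_fst s)

theorem continuous_laxAt (s : ℂ) (i j : Fin 2) : Continuous fun p => laxAt r s p i j := by
  have h0 := r.continuous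
  have h1 := (rtS r).continuous
  have h2 := Complex.continuous_conj
  simp only [laxAt, nrt, rt_eq]
  fin_cases i <;> fin_cases j <;> simp <;> fun_prop

theorem continuous_laxBz (s : ℂ) (i j : Fin 2) : Continuous fun p => laxBz r s p i j := by
  have h0 := r.continuous
  have h1 := (rzS r).continuous
  have h2 := (rzzS r).continuous
  have h3 := Complex.continuous_conj
  simp only [laxBz, bDiagz, bOffz, bOffz', nrz, nr, rz_eq, rzz_eq]
  fin_cases i <;> fin_cases j <;> simp <;> fun_prop

/-- A solution of the `z`-part of the Lax pair that solves the `t`-part on the line `z = 0` solves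
the `t`-part everywhere. -/
theorem IsSolution.lax_propagation {r : 𝓢(ℝ × ℝ, ℂ)} {T : EReal} (hr : IsSolution r T) (s : ℂ)
    {t₁ : ℝ} (ht₁ : t₁ ∈ timeSet T) {f : ℝ × ℝ → Fin 2 → ℂ} (hf : Continuous f)
    (hfz : ∀ t ∈ Icc 0 t₁, ∀ z, 0 ≤ z →
      HasDerivWithinAt (fun z => f (z, t)) (laxA r s (z, t) *ᵥ f (z, t)) (Ici z) z)
    (hft : ∀ t ∈ Ico 0 t₁,
      HasDerivWithinAt (fun t => f (0, t)) (laxB r s (0, t) *ᵥ f (0, t)) (Ici t) t)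
    {z t : ℝ} (hz : 0 ≤ z) (ht : t ∈ Icc 0 t₁) :
    f (z, t) = f (z, 0) + ∫ τ in (0 : ℝ)..t, laxB r s (z, τ) *ᵥ f (z, τ) := by
  refine zeroCurvature_propagation (a := fun p => matCLMR (laxA r s p))
    (b := fun p => matCLMR (laxB r s p)) (a' := fun p => matCLMR (laxAt r s p))
    (b' := fun p => matCLMR (laxBz r s p)) (continuous_matCLMR (continuous_laxA r s))
    (continuous_matCLMR (continuous_laxB r s)) (continuous_matCLMR (continuous_laxAt r s))
    (continuous_matCLMR (continuous_laxBz r s))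
    (fun z t => hasDerivAt_matCLMR (hasDerivAt_laxA r s z t))
    (fun z t => hasDerivAt_matCLMR (hasDerivAt_laxB r s z t)) ht₁.1 (fun z t hz ht => ?_) hf hfz
    hft hz ht
  have htT : t ∈ timeSet T := ⟨ht.1, (EReal.coe_le_coe_iff.2 ht.2).trans_lt ht₁.2⟩
  have h := congrArg matCLMR (hr.zero_curvature s hz htT)
  refine Eq.trans ?_ (h.trans ?_)
  · rw [← matCLMR_mul]
    exact (map_add matCLMR _ _).symm
  · rw [← matCLMR_mul]
    exact map_add matCLMR _ _

end Lax

/-! ### Differential equations for the columns -/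

section ColumnODE

/-- The right-hand side `M f + a (σ - σ_kk) f` of the differential equation of a `k`-th column. -/
def colRHS (k : Fin 2) (a : ℂ) (M : Matrix (Fin 2) (Fin 2) ℂ) (f : Fin 2 → ℂ) : Fin 2 → ℂ :=
  fun i => (M *ᵥ f) i + a * (sigma i i - sigma k k) * f i

/-- With the conjugation by `a x` pulled out, the integrand no longer depends on `x` and the product
rule applies. The integral equation is needed only to the right of `y`, which covers the endpoint
`0` and the bound `T`; hence one-sided derivatives. -/
theorem hasDerivWithinAt_of_col_equation {k : Fin 2} {a : ℂ} {M : ℝ → Matrix (Fin 2) (Fin 2) ℂ}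
    {f : ℝ → Fin 2 → ℂ} {C : Fin 2 → ℂ} {y : ℝ} (hM : ∀ i j, Continuous fun x => M x i j)
    (hfc : Continuous f)
    (hf : ∀ᶠ x : ℝ in 𝓝[≥] y, f x = hatExpCol k (a * x)
      (C + ∫ ξ in (0 : ℝ)..x, hatExpCol k (-(a * ξ)) (M ξ *ᵥ f ξ))) :
    HasDerivWithinAt f (colRHS k a (M y) (f y)) (Ici y) y := by
  have hG : Continuous fun ξ : ℝ => hatExpCol k (-(a * ξ)) (M ξ *ᵥ f ξ) := by
    refine continuous_pi fun i => ?_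
    simp only [hatExpCol_apply, Matrix.mulVec, dotProduct, Fin.sum_univ_two]
    have := fun j => (continuous_apply j).comp hfc
    have h0 := (hM i 0).mul ((continuous_apply 0).comp hfc)
    have h1 := (hM i 1).mul ((continuous_apply 1).comp hfc)
    exact Continuous.mul (by fun_prop) (h0.add h1)
  have hJ := hasDerivAt_pi.1 ((hG.integral_hasStrictDerivAt 0 y).hasDerivAt.const_add C)
  have hy := hf.self_of_nhdsWithin (mem_Ici.2 le_rfl)
  refine HasDerivWithinAt.congr_of_eventuallyEq ?_ hf hy
  refine hasDerivWithinAt_pi.2 fun i => HasDerivAt.hasDerivWithinAt ?_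
  simp only [hatExpCol_apply]
  have he : HasDerivAt (fun x : ℝ => exp (a * x * (sigma i i - sigma k k)))
      (exp (a * y * (sigma i i - sigma k k)) * (a * 1 * (sigma i i - sigma k k))) y :=
    (((hasDerivAt_id y).ofReal_comp.const_mul a).mul_const _).cexp
  refine (he.mul (hJ i)).congr_deriv ?_
  have hyi := congrFun hy i
  rw [hatExpCol_apply] at hyi
  rw [colRHS, hatExpCol_apply, hyi, ← mul_assoc (exp _) (exp _), ← Complex.exp_add,
    show a * (y : ℂ) * (sigma i i - sigma k k) + -(a * (y : ℂ)) * (sigma i i - sigma k k) = 0 by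
      ring, Complex.exp_zero, one_mul]
  ring

theorem hatExp_apply (x : ℂ) (M : Matrix (Fin 2) (Fin 2) ℂ) (i j : Fin 2) :
    hatExp x M i j = exp (x * (sigma i i - sigma j j)) * M i j := by
  rw [hatExp_eq]
  fin_cases i <;> fin_cases j <;> simp [sigma] <;> left <;> ring_nf

/-- Passing from a normalized column to a solution of the Lax pair. -/
theorem hasDerivWithinAt_gauge {k : Fin 2} {a b ϑ' : ℂ} {M : Matrix (Fin 2) (Fin 2) ℂ}
    {f : ℝ → Fin 2 → ℂ} {ϑ : ℝ → ℂ} {y : ℝ} (hϑ : HasDerivAt ϑ ϑ' y)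
    (hf : HasDerivWithinAt f
      (colRHS k a (hatExp (-(I * ϑ y)) (M - (I * ϑ') • sigma)) (f y)) (Ici y) y) :
    HasDerivWithinAt
      (fun x i => exp (sigma k k * (a * x + b) + sigma i i * (I * ϑ x)) * f x i)
      ((a • sigma + M) *ᵥ
        fun i => exp (sigma k k * (a * y + b) + sigma i i * (I * ϑ y)) * f y i) (Ici y) y := by
  refine hasDerivWithinAt_pi.2 fun i => ?_
  have he : HasDerivAt (fun x : ℝ => exp (sigma k k * (a * x + b) + sigma i i * (I * ϑ x)))
      (exp (sigma k k * (a * y + b) + sigma i i * (I * ϑ y)) *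
        (sigma k k * (a * 1) + sigma i i * (I * ϑ'))) y :=
    (((((hasDerivAt_id y).ofReal_comp.const_mul a).add_const b).const_mul _).add
      ((hϑ.const_mul I).const_mul _)).cexp
  refine (he.hasDerivWithinAt.mul (hasDerivWithinAt_pi.1 hf i)).congr_deriv ?_
  -- The row factors `exp (σ_ii i ϑ)` undo the conjugation of the coefficient. The term `-i ϑ' σ`
  -- then cancels the derivative of the gauge factor, and `σ_kk a` completes `a (σ_ii - σ_kk)` to `a
  -- σ_ii`.
  have hN : ∀ j, exp (sigma k k * (a * y + b) + sigma i i * (I * ϑ y)) *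
      hatExp (-(I * ϑ y)) (M - (I * ϑ') • sigma) i j =
      (M i j - I * ϑ' * sigma i j) * exp (sigma k k * (a * y + b) + sigma j j * (I * ϑ y)) := by
    intro j
    rw [hatExp_apply, ← mul_assoc, ← Complex.exp_add, mul_comm]
    congr 1
    ring_nf
  simp only [colRHS, Matrix.mulVec, dotProduct, Fin.sum_univ_two, Matrix.add_apply,
    Matrix.smul_apply, smul_eq_mul]
  have s01 : sigma 0 1 = 0 := rfl
  have s10 : sigma 1 0 = 0 := rfl
  fin_cases i
  · have h0 := hN 0
    have h1 := hN 1
    simp only [Fin.zero_eta, s01] at h0 h1 ⊢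
    linear_combination f y 0 * h0 + f y 1 * h1
  · have h0 := hN 0
    have h1 := hN 1
    simp only [Fin.mk_one, s10] at h0 h1 ⊢
    linear_combination f y 0 * h0 + f y 1 * h1

end ColumnODE

/-! ### One-sided equations for the constructed columns, and their non-vanishing. -/

section Matching

variable (r : 𝓢(ℝ × ℝ, ℂ)) (T : EReal) {s : ℂ}

theorem continuous_A₁_fst (s : ℂ) (t : ℝ) (i j : Fin 2) : Continuous fun z => A₁ r z t s i j :=
  ((isCoeff_A₁ r i j).continuous_fst s).comp (f := fun z : ℝ => (z, t)) (by fun_prop)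

theorem continuous_B₁_zero (s : ℂ) (i j : Fin 2) : Continuous fun t => B₁ r 0 t s i j :=
  ((isCoeff_B₁ r i j).continuous_fst s).comp (f := fun t : ℝ => ((0 : ℝ), t)) (by fun_prop)

theorem hatExpCol_mul_sub_integral (k : Fin 2) (a : ℂ) (x : ℝ) (g : ℝ → Fin 2 → ℂ) :
    ∫ ξ in (0 : ℝ)..x, hatExpCol k (a * (x - ξ)) (g ξ) =
      hatExpCol k (a * x) (∫ ξ in (0 : ℝ)..x, hatExpCol k (-(a * ξ)) (g ξ)) := by
  rw [hatExpCol_intervalIntegral]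
  simp only [hatExpCol_hatExpCol, ← sub_eq_add_neg, ← mul_sub]

theorem hasDerivWithinAt_extendZ (hs : 0 ≤ (phi s).re) (t : ℝ) (c : Fin 2 → ℂ) {z : ℝ}
    (hz : 0 ≤ z) : HasDerivWithinAt (extendZ r s t c)
      (colRHS 0 (phi s) (A₁ r z t s) (extendZ r s t c z)) (Ici z) z := by
  have hfc : Continuous (extendZ r s t c) :=
    (continuous_extendZ r hs (c := fun _ => c) continuous_const fun _ => le_rfl).comp
      (f := fun z : ℝ => (t, z)) (by fun_prop)
  refine hasDerivWithinAt_of_col_equation (k := 0) (a := phi s) (M := fun z => A₁ r z t s)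
    (f := extendZ r s t c) (C := c) (y := z) (continuous_A₁_fst r s t) hfc ?_
  filter_upwards [self_mem_nhdsWithin] with x hx
  rw [extendZ_eq r hs t c (hz.trans hx), hatExpCol_add, hatExpCol_mul_sub_integral]

theorem hasDerivWithinAt_bd1 (hs : (psi s).re ≤ 0) {t : ℝ} (ht : 0 ≤ t) :
    HasDerivWithinAt (bd1 r s) (colRHS 0 (-psi s) (B₁ r 0 t s) (bd1 r s t)) (Ici t) t := by
  refine hasDerivWithinAt_of_col_equation (k := 0) (a := -psi s) (M := fun t => B₁ r 0 t s)
    (f := bd1 r s) (C := unitCol 0) (y := t) (continuous_B₁_zero r s) (continuous_bd1 r hs) ?_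
  filter_upwards [self_mem_nhdsWithin] with x hx
  rw [bd1_eq r hs (ht.trans hx), hatExpCol_add, hatExpCol_unitCol, hatExpCol_mul_sub_integral]

/-- It rewrites an integral up to the far end as a constant minus an integral from `0`, the form
demanded by `hasDerivWithinAt_of_col_equation`. -/
theorem setIntegral_Ioi_inter_eq_sub {S : Set ℝ} (hS : IsLowerSet S) (hm : MeasurableSet S)
    {g : ℝ → Fin 2 → ℂ} {x : ℝ} (hx : 0 ≤ x) (hxS : x ∈ S) (hg : IntegrableOn g (Ioi 0 ∩ S)) :
    ∫ ξ in Ioi x ∩ S, g ξ = (∫ ξ in Ioi 0 ∩ S, g ξ) - ∫ ξ in (0 : ℝ)..x, g ξ := by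
  have hunion : Ioi 0 ∩ S = Ioc 0 x ∪ (Ioi x ∩ S) := by
    ext ξ
    constructor
    · rintro ⟨h0, hξ⟩
      rcases le_or_gt ξ x with h | h
      · exact Or.inl ⟨h0, h⟩
      · exact Or.inr ⟨h, hξ⟩
    · rintro (⟨h0, h⟩ | ⟨h, hξ⟩)
      · exact ⟨h0, hS h hxS⟩
      · exact ⟨hx.trans_lt h, hξ⟩
  have hdisj : Disjoint (Ioc 0 x) (Ioi x ∩ S) :=
    Set.disjoint_left.2 fun ξ h h' => absurd h'.1 (not_lt.2 h.2)
  rw [hunion] at hg ⊢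
  rw [setIntegral_union hdisj (measurableSet_Ioi.inter hm) (hg.mono_set subset_union_left)
    (hg.mono_set subset_union_right), intervalIntegral.integral_of_le hx]
  abel

theorem hatExpCol_mul_sub_setIntegral (k : Fin 2) (a : ℂ) (x : ℝ) (S : Set ℝ)
    (g : ℝ → Fin 2 → ℂ) : ∫ ξ in S, hatExpCol k (a * (x - ξ)) (g ξ) =
      hatExpCol k (a * x) (∫ ξ in S, hatExpCol k (-(a * ξ)) (g ξ)) := by
  rw [hatExpCol_integral]
  simp only [hatExpCol_hatExpCol, ← sub_eq_add_neg, ← mul_sub]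

theorem hasDerivWithinAt_bd2 (hs : 0 ≤ (psi s).re) {t : ℝ} (ht : t ∈ timeSet T) :
    HasDerivWithinAt (bd2 r T s) (colRHS 0 (-psi s) (B₁ r 0 t s) (bd2 r T s t)) (Ici t) t := by
  have hfam := isColFamily_bd2 r T (P := Unit) (σ := fun _ => s) continuous_const
    (fun _ => le_rfl) (fun _ => hs)
  obtain ⟨C, hC⟩ := exists_bound_bd2 r T hs
  have hint : IntegrableOn (fun ξ : ℝ => hatExpCol 0 (-(-psi s * ξ))
      (B₁ r 0 ξ s *ᵥ bd2 r T s ξ)) (Ioi 0 ∩ {τ : ℝ | (τ : EReal) < T}) := by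
    have := hfam.integrableOn () (x := 0) (f := bd2 r T s)
      (continuous_bd2 r T hs).continuousOn fun ξ _ => hC ξ
    simp only [Complex.ofReal_zero, zero_sub, mul_neg] at this
    exact this
  have hev : ∀ᶠ x : ℝ in 𝓝[≥] t, (x : EReal) < T :=
    (continuous_coe_real_ereal.continuousAt.eventually (gt_mem_nhds ht.2)).filter_mono
      nhdsWithin_le_nhds
  refine hasDerivWithinAt_of_col_equation (k := 0) (a := -psi s) (M := fun t => B₁ r 0 t s)
    (f := bd2 r T s) (y := t) (C := unitCol 0 - ∫ ξ : ℝ in Ioi 0 ∩ {τ : ℝ | (τ : EReal) < T},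
      hatExpCol 0 (-(-psi s * ξ)) (B₁ r 0 ξ s *ᵥ bd2 r T s ξ)) (continuous_B₁_zero r s)
    (continuous_bd2 r T hs) ?_
  filter_upwards [self_mem_nhdsWithin, hev] with x hx hxT
  rw [bd2_eq r T hs, hatExpCol_mul_sub_setIntegral, ← Ioi_inter_lt,
    setIntegral_Ioi_inter_eq_sub (S := {τ : ℝ | (τ : EReal) < T})
      (fun a b hab ha => lt_of_le_of_lt (EReal.coe_le_coe_iff.2 hab) ha)
      hfam.measurableSet (ht.1.trans hx) hxT hint]
  simp only [hatExpCol_sub, hatExpCol_add, hatExpCol_unitCol]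
  abel

theorem hasDerivWithinAt_sol3 (hs : 0 ≤ (phi s).re) (t : ℝ) {z : ℝ} (hz : 0 ≤ z) :
    HasDerivWithinAt (sol3 r s t) (colRHS 1 (phi s) (A₁ r z t s) (sol3 r s t z)) (Ici z) z := by
  have hfam := isColFamily_sol3 r (P := Unit) (σ := fun _ => s) continuous_const
    (fun _ => le_rfl) (fun _ => hs) t
  obtain ⟨C, hC⟩ := hfam.exists_bound_colSol (-1) (g := fun _ _ => unitCol 1) fun _ _ => le_rfl
  have hint : IntegrableOn (fun ξ : ℝ => hatExpCol 1 (-(phi s * ξ))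
      (A₁ r ξ t s *ᵥ sol3 r s t ξ)) (Ioi 0 ∩ univ) := by
    have := hfam.integrableOn () (x := 0) (f := sol3 r s t)
      (continuous_sol3 r hs t).continuousOn fun ξ _ => hC () ξ
    simp only [Complex.ofReal_zero, zero_sub, mul_neg] at this
    exact this
  refine hasDerivWithinAt_of_col_equation (k := 1) (a := phi s) (M := fun z => A₁ r z t s)
    (f := sol3 r s t) (y := z) (C := unitCol 1 - ∫ ξ : ℝ in Ioi 0 ∩ univ,
      hatExpCol 1 (-(phi s * ξ)) (A₁ r ξ t s *ᵥ sol3 r s t ξ)) (continuous_A₁_fst r s t)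
    (continuous_sol3 r hs t) ?_
  filter_upwards [self_mem_nhdsWithin] with x hx
  have hx0 : 0 ≤ x := hz.trans hx
  have h := (isH₃_sol3 r hs t).equation x hx0
  rw [h, ← inter_univ (Ioi x)]
  change unitCol 1 - ∫ ξ in Ioi x ∩ univ, hatExpCol 1 (phi s * (x - ξ)) _ = _
  rw [hatExpCol_mul_sub_setIntegral,
    setIntegral_Ioi_inter_eq_sub isLowerSet_univ MeasurableSet.univ hx0 (mem_univ x) hint]
  simp only [hatExpCol_sub, hatExpCol_add, hatExpCol_unitCol]
  abel

/-- A linear system with zero initial value has only the zero solution. -/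
theorem linear_ode_eq_zero {M : ℝ → Matrix (Fin 2) (Fin 2) ℂ} (hM : ∀ i j, Continuous fun x => M x i j)
    {d : ℝ → Fin 2 → ℂ} {a b : ℝ} (hc : ContinuousOn d (Icc a b))
    (hd : ∀ x ∈ Ico a b, HasDerivWithinAt d (M x *ᵥ d x) (Ici x) x) (h0 : d a = 0) :
    ∀ x ∈ Icc a b, d x = 0 := by
  choose C hC using fun i j => (isCompact_Icc (a := a) (b := b)).exists_bound_of_continuousOn
    (hM i j).continuousOn
  refine eq_zero_of_abs_deriv_le_mul_abs_self_of_eq_zero_right (K := 2 * ∑ i, ∑ j, |C i j|) hc hd h0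
    fun x hx => norm_mulVec_le (fun i j => ((hC i j x ⟨hx.1, hx.2.le⟩).trans (le_abs_self _)).trans ?_) _
  exact (Finset.single_le_sum (f := fun j => |C i j|) (fun j _ => abs_nonneg _)
    (Finset.mem_univ j)).trans (Finset.single_le_sum (f := fun i => ∑ j, |C i j|)
      (fun i _ => Finset.sum_nonneg fun j _ => abs_nonneg _) (Finset.mem_univ i))

theorem colRHS_eq_mulVec (k : Fin 2) (a : ℂ) (M : Matrix (Fin 2) (Fin 2) ℂ) (f : Fin 2 → ℂ) :
    colRHS k a M f = (M + a • (sigma - sigma k k • 1)) *ᵥ f := by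
  ext i
  have s01 : sigma 0 1 = 0 := rfl
  have s10 : sigma 1 0 = 0 := rfl
  simp only [colRHS, Matrix.mulVec, dotProduct, Fin.sum_univ_two, Matrix.add_apply,
    Matrix.smul_apply, Matrix.sub_apply, smul_eq_mul, Matrix.one_apply]
  fin_cases i <;> simp [s01, s10] <;> ring

/-- A normalized column that vanishes at a point vanishes from there on. -/
theorem col_ode_eq_zero {k : Fin 2} {a : ℂ} {M : ℝ → Matrix (Fin 2) (Fin 2) ℂ}
    (hM : ∀ i j, Continuous fun x => M x i j) {d : ℝ → Fin 2 → ℂ} {x₀ x₁ : ℝ} (hc : Continuous d)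
    (hd : ∀ x ∈ Ico x₀ x₁, HasDerivWithinAt d (colRHS k a (M x) (d x)) (Ici x) x)
    (h0 : d x₀ = 0) : ∀ x ∈ Icc x₀ x₁, d x = 0 := by
  simp only [colRHS_eq_mulVec] at hd
  refine linear_ode_eq_zero (fun i j => ?_) hc.continuousOn hd h0
  simp only [Matrix.add_apply]
  exact (hM i j).add continuous_const

theorem unitCol_ne_zero (k : Fin 2) : unitCol k ≠ 0 := by
  intro h
  have := congrFun h k
  simp [unitCol] at this

/-- By uniqueness for the linear system, a zero at `z` forces zeros from there to infinity. The
integral equation at `z` would then read `0 = unitCol 1`. -/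
theorem sol3_ne_zero (hs : 0 ≤ (phi s).re) (t : ℝ) {z : ℝ} (hz : 0 ≤ z) : sol3 r s t z ≠ 0 := by
  intro h
  have hzero : ∀ ξ ∈ Ioi z, sol3 r s t ξ = 0 := fun ξ hξ =>
    col_ode_eq_zero (M := fun z => A₁ r z t s) (d := sol3 r s t) (k := 1) (a := phi s)
      (continuous_A₁_fst r s t) (continuous_sol3 r hs t) (x₀ := z) (x₁ := ξ)
      (fun x hx => hasDerivWithinAt_sol3 r hs t (hz.trans hx.1)) h ξ ⟨le_of_lt hξ, le_rfl⟩
  have h1 := (isH₃_sol3 r hs t).equation z hz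
  rw [setIntegral_congr_fun (g := fun _ => 0) measurableSet_Ioi fun ξ hξ => by
    ext i; simp [hzero ξ hξ, hatExpCol_apply], integral_zero, sub_zero, h] at h1
  exact unitCol_ne_zero 1 h1.symm

theorem bd2_ne_zero (hs : 0 ≤ (psi s).re) {t : ℝ} (ht : t ∈ timeSet T) : bd2 r T s t ≠ 0 := by
  intro h
  have hzero : ∀ ξ ∈ {τ : ℝ | t < τ ∧ (τ : EReal) < T}, bd2 r T s ξ = 0 := fun ξ hξ =>
    col_ode_eq_zero (M := fun t => B₁ r 0 t s) (d := bd2 r T s) (k := 0) (a := -psi s)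
      (continuous_B₁_zero r s) (continuous_bd2 r T hs) (x₀ := t) (x₁ := ξ)
      (fun x hx => hasDerivWithinAt_bd2 r T hs
        ⟨ht.1.trans hx.1, (EReal.coe_lt_coe_iff.2 hx.2).trans hξ.2⟩) h ξ ⟨le_of_lt hξ.1, le_rfl⟩
  have hm : MeasurableSet {τ : ℝ | t < τ ∧ (τ : EReal) < T} :=
    measurableSet_Ioi.inter (measurableSet_lt measurable_coe_real_ereal measurable_const)
  have h1 := bd2_eq r T hs t
  rw [setIntegral_congr_fun (g := fun _ => 0) hm fun ξ hξ => by
    ext i; simp [hzero ξ hξ, hatExpCol_apply], integral_zero, sub_zero, h] at h1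
  exact unitCol_ne_zero 0 h1.symm

end Matching

/-! ### Asymptotics of the phase -/

section Phase

variable {r : 𝓢(ℝ × ℝ, ℂ)} {T : EReal}

/-- This is the closedness of the 1-form, obtained as the scalar case of
`zeroCurvature_propagation`: the coefficients commute, so zero curvature reduces to `∂_t Θ₁ = ∂_z
Θ₂`, the local conservation law of `|r|²`. -/
theorem IsSolution.exp_theta_eq (hr : IsSolution r T) {z t : ℝ} (hz : 0 ≤ z) (ht : t ∈ timeSet T) :
    exp (I * theta r z t) = exp (I * theta r z 0) +
      ∫ τ in (0 : ℝ)..t, I * Theta2 r z τ * exp (I * theta r z τ) := by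
  have hc0 := r.continuous
  have hc1 := (rzS r).continuous
  have hc2 := (rzzS r).continuous
  have hc3 := (rtS r).continuous
  have hc4 := Complex.continuous_conj
  let m := ContinuousLinearMap.mul ℝ ℂ
  have hm : ∀ {f : ℝ → ℂ} {f' : ℂ} {x : ℝ}, HasDerivAt f f' x →
      HasDerivAt (fun x => m (f x)) (m f') x := fun h => m.hasFDerivAt.comp_hasDerivAt _ h
  refine zeroCurvature_propagation (F := ℂ) (a := fun p => m (I * Theta1 r p.1 p.2))
    (b := fun p => m (I * Theta2 r p.1 p.2)) (a' := fun p => m (I * ((1 / 4) * nrt r p.1 p.2)))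
    (b' := fun p => m (I * ((1 / 4) * (nr r p.1 p.2 * nrz r p.1 p.2) + (I / 4) *
      (conj (r p) * rzz r p.1 p.2 - r p * conj (rzz r p.1 p.2)))))
    (f := fun p => exp (I * theta r p.1 p.2)) (t₁ := t)
    (m.continuous.comp (continuous_const.mul (continuous_Theta1 r)))
    (m.continuous.comp (continuous_const.mul (continuous_Theta2 r)))
    (m.continuous.comp ?_) (m.continuous.comp ?_) (fun z t => hm ?_) (fun z t => hm ?_) ht.1
    (fun z τ hz hτ => ?_) ?_ (fun t _ z _ => ?_) (fun t _ => ?_) hz ⟨ht.1, le_rfl⟩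
  · simp only [nrt, rt_eq]
    fun_prop
  · simp only [nr, nrz, rz_eq, rzz_eq]
    fun_prop
  · simp only [Theta1_eq]
    exact ((hasDerivAt_nr_snd r z t).const_mul (1 / 4)).const_mul I
  · simp only [Theta2_eq]
    have h := hasDerivAt_r_fst r z t
    have h' := hasDerivAt_rz_fst r z t
    refine (((((hasDerivAt_nr_fst r z t).pow 2).const_mul (1 / 8)).add
      ((((hasDerivAt_conj h).mul h').sub (h.mul (hasDerivAt_conj h'))).const_mul
        (I / 4))).const_mul I).congr_deriv ?_
    ring
  · have hτT : τ ∈ timeSet T := ⟨hτ.1, (EReal.coe_le_coe_iff.2 hτ.2).trans_lt ht.2⟩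
    have h := hr.rt_eq_of_nonneg hz hτT
    have hcj := congrArg conj h
    simp only [map_add, map_mul, conj_I, nr, conj_conj] at hcj h
    ext
    simp only [m, _root_.add_apply, ContinuousLinearMap.comp_apply,
      ContinuousLinearMap.mul_apply', nrt, nr, nrz]
    rw [hcj, h]
    ring
  · have := continuous_theta r
    fun_prop
  · exact (((hasDerivAt_theta_fst r z t).const_mul I).cexp.hasDerivWithinAt).congr_deriv
      (by simp [m, mul_comm])
  · exact (((hasDerivAt_theta_zero_snd r t).const_mul I).cexp.hasDerivWithinAt).congr_deriv
      (by simp [m, mul_comm])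

theorem tendsto_inv_one_add_sq_mul (K : ℝ) :
    Tendsto (fun z : ℝ => (1 + z ^ 2)⁻¹ * K) atTop (𝓝 0) := by
  have h : Tendsto (fun z : ℝ => (1 + z ^ 2)⁻¹) atTop (𝓝 0) :=
    tendsto_inv_atTop_zero.comp
      (tendsto_atTop_add_const_left _ _ (tendsto_pow_atTop two_ne_zero))
  simpa using h.mul_const K

/-- The difference is an integral of `Θ₂` over a fixed time interval at position `z`, hence `O(1 /
(1 + z²))`. So the gauge factor at infinity does not depend on time. -/
theorem IsSolution.tendsto_exp_theta (hr : IsSolution r T) {t : ℝ} (ht : t ∈ timeSet T) :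
    Tendsto (fun z => exp (I * theta r z t) - exp (I * theta r z 0)) atTop (𝓝 0) := by
  -- `Θ₂` does not involve the spectral parameter, so the bound at radius `0` suffices.
  obtain ⟨C, hC, hb⟩ := (isCoeff_Theta2 r).bound 0
  refine squeeze_zero_norm' ?_ (tendsto_inv_one_add_sq_mul (C * |t - 0|))
  filter_upwards [eventually_ge_atTop 0] with z hz
  rw [hr.exp_theta_eq hz ht, add_sub_cancel_left]
  refine (intervalIntegral.norm_integral_le_of_norm_le_const (C := (1 + z ^ 2)⁻¹ * C)
    fun τ _ => ?_).trans (mul_assoc _ _ _).le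
  have h1 := norm_exp_I_mul_theta r 1 z τ
  rw [Complex.ofReal_one, one_mul] at h1
  rw [norm_mul, norm_mul, Complex.norm_I, one_mul, h1, mul_one, mul_comm]
  exact (hb (z, τ) 0 (by simp)).trans (mul_le_mul_of_nonneg_left (decay_le_fst z τ) hC)

end Phase

/-! ### Estimates for column equations -/

section Estimates

variable {k : Fin 2} {a : ℂ}

theorem norm_sigma_sub_le (k i : Fin 2) : ‖sigma i i - sigma k k‖ ≤ 2 := by
  fin_cases k <;> fin_cases i <;> norm_num [sigma]

theorem norm_colRHS_le {M : Matrix (Fin 2) (Fin 2) ℂ} {C : ℝ} (hM : ∀ i j, ‖M i j‖ ≤ C)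
    (f : Fin 2 → ℂ) : ‖colRHS k a M f‖ ≤ (2 * C + ‖a‖ * 2) * ‖f‖ := by
  have hC : 0 ≤ C := (norm_nonneg _).trans (hM 0 0)
  refine (pi_norm_le_iff_of_nonneg (by positivity)).2 fun i => ?_
  rw [colRHS, add_mul]
  refine (norm_add_le _ _).trans (add_le_add ((norm_le_pi_norm _ i).trans (norm_mulVec_le hM f)) ?_)
  rw [norm_mul, norm_mul]
  gcongr
  · exact norm_sigma_sub_le k i
  · exact norm_le_pi_norm f i

theorem norm_le_of_col_ode {M : ℝ → Matrix (Fin 2) (Fin 2) ℂ} {C t : ℝ} {q : ℝ → Fin 2 → ℂ}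
    (hM : ∀ τ i j, ‖M τ i j‖ ≤ C) (hc : ContinuousOn q (Icc 0 t))
    (hd : ∀ τ ∈ Ico 0 t, HasDerivWithinAt q (colRHS k a (M τ) (q τ)) (Ici τ) τ) :
    ∀ τ ∈ Icc 0 t, ‖q τ‖ ≤ ‖q 0‖ * Real.exp ((2 * C + ‖a‖ * 2) * t) := by
  intro τ hτ
  have hC : 0 ≤ C := (norm_nonneg _).trans (hM 0 0 0)
  have h := norm_le_gronwallBound_of_norm_deriv_right_le (K := 2 * C + ‖a‖ * 2) (ε := 0) hc hd le_rfl
    (fun τ _ => by rw [add_zero]; exact norm_colRHS_le (hM τ) _) τ hτ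
  rw [gronwallBound_ε0, sub_zero] at h
  refine h.trans ?_
  gcongr
  exact hτ.2

/-- The constant diagonal term drops out in row `k`, so this entry changes only through `M`. When
`M` is small, as it is for large `z`, the entry is almost conserved in time. -/
theorem norm_apply_sub_le_of_col_ode {M : ℝ → Matrix (Fin 2) (Fin 2) ℂ} {B δ t : ℝ}
    {q : ℝ → Fin 2 → ℂ} (hM : ∀ τ i j, ‖M τ i j‖ ≤ δ) (hc : ContinuousOn q (Icc 0 t)) (ht : 0 ≤ t)
    (hd : ∀ τ ∈ Ico 0 t, HasDerivWithinAt q (colRHS k a (M τ) (q τ)) (Ici τ) τ)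
    (hq : ∀ τ ∈ Icc 0 t, ‖q τ‖ ≤ B) : ‖q t k - q 0 k‖ ≤ 2 * δ * B * t := by
  have h := norm_image_sub_le_of_norm_deriv_right_le_segment (f := fun τ => q τ k) (C := 2 * δ * B)
    (f' := fun τ => colRHS k a (M τ) (q τ) k) ((continuous_apply k).comp_continuousOn hc)
    (fun τ hτ => hasDerivWithinAt_pi.1 (hd τ hτ) k) (fun τ hτ => ?_) t ⟨ht, le_rfl⟩
  · simpa using h
  · have hδ : 0 ≤ δ := (norm_nonneg _).trans (hM 0 0 0)
    rw [colRHS, sub_self, mul_zero, zero_mul, add_zero]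
    refine (norm_le_pi_norm _ k).trans ((norm_mulVec_le (hM τ) _).trans ?_)
    exact mul_le_mul_of_nonneg_left (hq τ (Ico_subset_Icc_self hτ)) (by positivity)

theorem hasDerivWithinAt_exp_mul {b c : ℂ} {f : ℝ → Fin 2 → ℂ} {M : Matrix (Fin 2) (Fin 2) ℂ} {y : ℝ}
    (hf : HasDerivWithinAt f (M *ᵥ f y) (Ici y) y) :
    HasDerivWithinAt (fun x : ℝ => exp (b * x + c) • f x)
      ((M + b • 1) *ᵥ (exp (b * y + c) • f y)) (Ici y) y := by
  have he : HasDerivAt (fun x : ℝ => exp (b * x + c)) (exp (b * y + c) * (b * 1)) y :=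
    (((hasDerivAt_id y).ofReal_comp.const_mul b).add_const c).cexp
  refine (he.hasDerivWithinAt.smul hf).congr_deriv ?_
  rw [Matrix.add_mulVec, Matrix.mulVec_smul, Matrix.smul_mulVec, Matrix.one_mulVec, smul_smul,
    mul_one, mul_comm (exp (b * y + c)) b]

end Estimates

/-! ### Characterization of the eigenfunction normalized at infinity -/

section Infinity

variable {r : 𝓢(ℝ × ℝ, ℂ)} {s : ℂ}

theorem hasDerivWithinAt_hatExpCol {k : Fin 2} {a : ℂ} {M : Matrix (Fin 2) (Fin 2) ℂ}
    {h : ℝ → Fin 2 → ℂ} {y : ℝ} (x : ℝ) (hh : HasDerivWithinAt h (colRHS k a M (h y)) (Ici y) y) :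
    HasDerivWithinAt (fun ξ : ℝ => hatExpCol k (a * (x - ξ)) (h ξ))
      (hatExpCol k (a * (x - y)) (M *ᵥ h y)) (Ici y) y := by
  refine hasDerivWithinAt_pi.2 fun i => ?_
  simp only [hatExpCol_apply]
  have he : HasDerivAt (fun ξ : ℝ => exp (a * (x - ξ) * (sigma i i - sigma k k)))
      (exp (a * (x - y) * (sigma i i - sigma k k)) * (a * (-1) * (sigma i i - sigma k k))) y :=
    ((((hasDerivAt_id y).ofReal_comp.const_sub (x : ℂ)).const_mul a).mul_const _).cexp
  refine (he.hasDerivWithinAt.mul (hasDerivWithinAt_pi.1 hh i)).congr_deriv ?_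
  rw [colRHS]
  ring

/-- Variation of constants from `z` to `b`, followed by `b → ∞`. In row `0` the factor `exp (2 φ (z
- b))` decays because `Re φ > 0` strictly, so boundedness alone controls that entry; only row `1`
needs a prescribed limit. -/
theorem isH₃_of_ode (hs : 0 < (phi s).re) {t : ℝ} {h : ℝ → Fin 2 → ℂ} (hc : Continuous h) {C : ℝ}
    (hC : ∀ z, 0 ≤ z → ‖h z‖ ≤ C)
    (hd : ∀ z, 0 ≤ z →
      HasDerivWithinAt h (colRHS 1 (phi s) (A₁ r z t s) (h z)) (Ici z) z)
    (hlim : Tendsto (fun z => h z 1) atTop (𝓝 1)) : IsH₃ r s 1 t h := by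
  refine ⟨hc.continuousOn, ⟨C, hC⟩, fun z hz => ?_⟩
  change h z = unitCol 1 - ∫ ζ : ℝ in Ioi z, hatExpCol 1 (phi s * (z - ζ)) (A₁ r ζ t s *ᵥ h ζ)
  have hfam := isColFamily_sol3 r (P := Unit) (σ := fun _ => s) continuous_const
    (fun _ => le_rfl) (fun _ => hs.le) t
  have hint : IntegrableOn (fun ζ : ℝ => hatExpCol 1 (phi s * (z - ζ)) (A₁ r ζ t s *ᵥ h ζ))
      (Ioi z) := by
    have := hfam.integrableOn () (x := z) (f := h) (C := C) hc.continuousOn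
      fun ξ hξ => hC ξ (hz.trans (le_of_lt hξ.1))
    rwa [inter_univ] at this
  have hexpc : ∀ i, Continuous fun ξ : ℝ => exp (phi s * (z - ξ) * (sigma i i - sigma 1 1)) :=
    fun i => by fun_prop
  have hhc : ∀ i, Continuous fun ξ => h ξ i := fun i => (continuous_apply i).comp hc
  have hyc : Continuous fun ξ : ℝ => hatExpCol 1 (phi s * (z - ξ)) (h ξ) := by
    refine continuous_pi fun i => ?_
    simp only [hatExpCol_apply]
    exact (hexpc i).mul (hhc i)
  have hdc : Continuous fun ζ : ℝ => hatExpCol 1 (phi s * (z - ζ)) (A₁ r ζ t s *ᵥ h ζ) := by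
    refine continuous_pi fun i => ?_
    simp only [hatExpCol_apply, Matrix.mulVec, dotProduct, Fin.sum_univ_two]
    exact (hexpc i).mul (((continuous_A₁_fst r s t i 0).mul (hhc 0)).add
      ((continuous_A₁_fst r s t i 1).mul (hhc 1)))
  have hftc : ∀ b, z ≤ b → hatExpCol 1 (phi s * (z - b)) (h b) = h z +
      ∫ ζ in z..b, hatExpCol 1 (phi s * (z - ζ)) (A₁ r ζ t s *ᵥ h ζ) := by
    intro b hb
    have := eq_add_integral_of_hasDerivWithinAt hb (f := fun ξ : ℝ => hatExpCol 1 (phi s * (z - ξ)) (h ξ))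
      (f' := fun ζ : ℝ => hatExpCol 1 (phi s * (z - ζ)) (A₁ r ζ t s *ᵥ h ζ)) hyc.continuousOn
      (fun x hx => hasDerivWithinAt_hatExpCol z (hd x (hz.trans hx.1))) hdc
    simpa [hatExpCol_zero] using this
  have hlim' : Tendsto (fun b : ℝ => hatExpCol 1 (phi s * (z - b)) (h b)) atTop (𝓝 (unitCol 1)) := by
    refine tendsto_pi_nhds.2 fun i => ?_
    simp only [hatExpCol_apply]
    fin_cases i
    · have hu : unitCol 1 0 = 0 := by simp [unitCol]
      change Tendsto _ _ (𝓝 (unitCol 1 0))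
      rw [hu]
      have hre : Tendsto (fun b : ℝ => Real.exp (2 * (phi s).re * (z - b)) * C) atTop (𝓝 0) := by
        rw [← zero_mul C]
        refine (Real.tendsto_exp_atBot.comp ?_).mul_const C
        exact (tendsto_atBot_add_const_left _ z tendsto_neg_atTop_atBot).const_mul_atBot
          (by positivity)
      refine squeeze_zero_norm' ?_ hre
      filter_upwards [eventually_ge_atTop 0] with b hb
      rw [norm_mul, Complex.norm_exp]
      have hrr : (phi s * (z - b) * (sigma 0 0 - sigma 1 1)).re = 2 * (phi s).re * (z - b) := by
        have : phi s * (z - b) * (sigma 0 0 - sigma 1 1) = phi s * ((2 * (z - b) : ℝ) : ℂ) := by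
          push_cast [sigma]; simp; ring
        rw [this, Complex.re_mul_ofReal]
        ring
      change Real.exp (phi s * (z - b) * (sigma 0 0 - sigma 1 1)).re * ‖h b 0‖ ≤ _
      rw [hrr]
      exact mul_le_mul_of_nonneg_left ((norm_le_pi_norm _ _).trans (hC b hb)) (Real.exp_pos _).le
    · have hu : unitCol 1 1 = 1 := by simp [unitCol]
      change Tendsto (fun b : ℝ => exp (phi s * (z - b) * (sigma 1 1 - sigma 1 1)) * h b 1) _
        (𝓝 (unitCol 1 1))
      simpa [hu] using hlim
  have hlim2 := tendsto_const_nhds (x := h z) |>.add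
    (intervalIntegral_tendsto_integral_Ioi z hint tendsto_id)
  have := tendsto_nhds_unique (hlim'.congr' ?_) hlim2
  · rw [this, add_sub_cancel_right]
  · filter_upwards [eventually_ge_atTop z] with b hb using hftc b hb

end Infinity

/-! ### Proportionality of the eigenfunctions -/

section Proportionality

variable {r : 𝓢(ℝ × ℝ, ℂ)} {T : EReal} {s : ℂ}

/-- Row `1` of a second column carries no exponential, so its deviation from `1` is the tail of a
convergent integral. -/
theorem tendsto_sol3_apply_one (r : 𝓢(ℝ × ℝ, ℂ)) (hs : 0 ≤ (phi s).re) (t : ℝ) :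
    Tendsto (fun z => sol3 r s t z 1) atTop (𝓝 1) := by
  have hfam := isColFamily_sol3 r (P := Unit) (σ := fun _ => s) continuous_const
    (fun _ => le_rfl) (fun _ => hs) t
  obtain ⟨C, hC⟩ := hfam.exists_bound_colSol (-1) (g := fun _ _ => unitCol 1) fun _ _ => le_rfl
  have hint : IntegrableOn (fun ξ : ℝ => hatExpCol 1 (-(phi s * ξ))
      (A₁ r ξ t s *ᵥ sol3 r s t ξ)) (Ioi 0 ∩ univ) := by
    have := hfam.integrableOn () (x := 0) (f := sol3 r s t)
      (continuous_sol3 r hs t).continuousOn fun ξ _ => hC () ξ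
    simp only [Complex.ofReal_zero, zero_sub, mul_neg] at this
    exact this
  have hlim := intervalIntegral_tendsto_integral_Ioi 0 (by rwa [inter_univ] at hint) tendsto_id
  have hlim1 := ((continuous_apply (1 : Fin 2)).tendsto _).comp hlim
  have hlim2 := (hlim1.const_sub ((∫ ξ : ℝ in Ioi 0, hatExpCol 1 (-(phi s * ξ))
      (A₁ r ξ t s *ᵥ sol3 r s t ξ)) 1)).const_sub 1
  rw [sub_self, sub_zero] at hlim2
  refine hlim2.congr' ?_
  filter_upwards [eventually_ge_atTop 0] with z hz
  have h := (isH₃_sol3 r hs t).equation z hz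
  rw [← inter_univ (Ioi z)] at h
  change sol3 r s t z = unitCol 1 - ∫ ξ in Ioi z ∩ univ, hatExpCol 1 (phi s * (z - ξ)) _ at h
  rw [hatExpCol_mul_sub_setIntegral,
    setIntegral_Ioi_inter_eq_sub isLowerSet_univ MeasurableSet.univ hz (mem_univ z) hint] at h
  have hu : unitCol 1 1 = 1 := by simp [unitCol]
  rw [h, Pi.sub_apply, hatExpCol_apply, sub_self, mul_zero, Complex.exp_zero, one_mul, hu,
    inter_univ]
  rfl

/-- If a column on the line `z = 0` solves the `t`-equation and is proportional to the eigenfunction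
normalized at infinity at the origin, then its extension is proportional to it everywhere. -/
theorem IsSolution.extendZ_eq_smul_sol3 (hr : IsSolution r T) (hs : 0 < (phi s).re)
    {c : ℝ → Fin 2 → ℂ} (hc : Continuous c) {K : ℝ} (hK : ∀ t, ‖c t‖ ≤ K)
    (hode : ∀ t ∈ timeSet T, HasDerivWithinAt c (colRHS 0 (-psi s) (B₁ r 0 t s) (c t)) (Ici t) t)
    {κ : ℂ} (hκ : κ ≠ 0) (h0 : c 0 = κ • sol3 r s 0 0) {z t : ℝ} (hz : 0 ≤ z)
    (ht : t ∈ timeSet T) :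
    extendZ r s t (c t) z = (κ * exp (2 * I * η z t s)) • sol3 r s t z := by
  have hs' := hs.le
  have hsub : ∀ τ, τ ∈ Icc 0 t → τ ∈ timeSet T := fun τ hτ =>
    ⟨hτ.1, (EReal.coe_le_coe_iff.2 hτ.2).trans_lt ht.2⟩
  have s00 : sigma 0 0 = 1 := rfl
  have s11 : sigma 1 1 = -1 := rfl
  -- `F` is the ungauged column: it solves the `z`-part of the Lax pair for every time and the
  -- `t`-part on `z = 0`.
  let F : ℝ × ℝ → Fin 2 → ℂ := fun p i =>
    exp (sigma 0 0 * (phi s * p.1 + -psi s * p.2) + sigma i i * (I * theta r p.1 p.2)) *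
      extendZ r s p.2 (c p.2) p.1 i
  have hE : Continuous fun p : ℝ × ℝ => extendZ r s p.2 (c p.2) p.1 :=
    (continuous_extendZ r hs' hc hK).comp (f := fun p : ℝ × ℝ => (p.2, p.1)) (by fun_prop)
  have hF : Continuous F := by
    refine continuous_pi fun i => ?_
    have h1 := continuous_theta r
    have h2 : Continuous fun p : ℝ × ℝ => extendZ r s p.2 (c p.2) p.1 i :=
      (continuous_apply i).comp hE
    exact Continuous.mul (by fun_prop) h2
  have hFz : ∀ τ z, 0 ≤ z →
      HasDerivWithinAt (fun z => F (z, τ)) (laxA r s (z, τ) *ᵥ F (z, τ)) (Ici z) z := by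
    intro τ z hz
    exact hasDerivWithinAt_gauge (k := 0) (a := phi s) (b := -psi s * τ) (M := A r z τ s)
      (f := extendZ r s τ (c τ)) (ϑ := fun z => theta r z τ) (hasDerivAt_theta_fst r z τ)
      (hasDerivWithinAt_extendZ r hs' τ (c τ) hz)
  have hF0 : ∀ τ, (fun i => exp (sigma 0 0 * (-psi s * τ + 0) + sigma i i * (I * theta r 0 τ)) *
      c τ i) = F (0, τ) := by
    intro τ
    funext i
    simp only [F, extendZ_zero r hs', Complex.ofReal_zero, mul_zero, zero_add, add_zero]
  have hFt : ∀ τ ∈ Ico 0 t,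
      HasDerivWithinAt (fun τ => F (0, τ)) (laxB r s (0, τ) *ᵥ F (0, τ)) (Ici τ) τ := by
    intro τ hτ
    have := hasDerivWithinAt_gauge (k := 0) (a := -psi s) (b := 0) (M := B r 0 τ s)
      (f := c) (ϑ := fun τ => theta r 0 τ) (hasDerivAt_theta_zero_snd r τ)
      (hode τ (hsub τ (Ico_subset_Icc_self hτ)))
    have hfun : (fun τ => F (0, τ)) = fun τ i =>
        exp (sigma 0 0 * (-psi s * τ + 0) + sigma i i * (I * theta r 0 τ)) * c τ i :=
      funext fun τ => (hF0 τ).symm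
    rw [hfun, ← hF0 τ]
    exact this
  have hlax : ∀ z, 0 ≤ z → ∀ τ ∈ Icc 0 t,
      F (z, τ) = F (z, 0) + ∫ τ in (0 : ℝ)..τ, laxB r s (z, τ) *ᵥ F (z, τ) := fun z hz τ hτ =>
    hr.lax_propagation s ht hF (fun τ _ z hz => hFz τ z hz) hFt hz hτ
  -- the solution at the initial time
  have hinit : ∀ z, 0 ≤ z → ∀ i, F (z, 0) i =
      exp (-(phi s * z) + sigma i i * (I * theta r z 0)) * (κ * sol3 r s 0 z i) := by
    intro z hz i
    let G : ℝ → Fin 2 → ℂ := fun z i =>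
      exp (sigma 1 1 * (phi s * z + 0) + sigma i i * (I * theta r z 0)) * sol3 r s 0 z i
    have hGc : Continuous G := by
      refine continuous_pi fun i => ?_
      have h1 : Continuous fun z => theta r z 0 :=
        (continuous_theta r).comp (f := fun z : ℝ => (z, (0 : ℝ))) (by fun_prop)
      have h2 : Continuous fun z => sol3 r s 0 z i :=
        (continuous_apply i).comp (continuous_sol3 r hs' 0)
      exact Continuous.mul (by fun_prop) h2
    have hG : ∀ z, 0 ≤ z → HasDerivWithinAt G (laxA r s (z, 0) *ᵥ G z) (Ici z) z := by
      intro z hz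
      exact hasDerivWithinAt_gauge (k := 1) (a := phi s) (b := 0) (M := A r z 0 s)
        (f := sol3 r s 0) (ϑ := fun z => theta r z 0) (hasDerivAt_theta_fst r z 0)
        (hasDerivWithinAt_sol3 r hs' 0 hz)
    -- At time `0` both functions solve the same `z`-system and agree at the origin, where the phase
    -- and all exponents vanish.
    have hdiff := linear_ode_eq_zero (M := fun z => laxA r s (z, 0))
      (d := fun z => F (z, 0) - κ • G z) (a := 0) (b := z)
      (fun i j => (continuous_laxA r s i j).comp (f := fun z : ℝ => (z, (0 : ℝ))) (by fun_prop))
      ((hF.comp (f := fun z : ℝ => (z, (0 : ℝ))) (by fun_prop)).sub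
        (hGc.const_smul κ)).continuousOn
      (fun x hx => by
        rw [Matrix.mulVec_sub, Matrix.mulVec_smul]
        exact (hFz 0 x hx.1).sub ((hG x hx.1).const_smul κ))
      (by
        funext i
        simp only [F, G, extendZ_zero r hs', h0, theta_zero_zero, Pi.sub_apply, Pi.smul_apply,
          smul_eq_mul, Complex.ofReal_zero, mul_zero, add_zero, Complex.exp_zero, one_mul, sub_self,
          Pi.zero_apply])
      z ⟨hz, le_rfl⟩
    have := congrFun (sub_eq_zero.1 hdiff) i
    simp only [Pi.smul_apply, smul_eq_mul, G, s11] at this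
    rw [this]
    ring_nf
  -- the renormalized column
  let g : ℝ → ℝ → Fin 2 → ℂ := fun τ z =>
    exp (2 * (phi s * z + -psi s * τ)) • extendZ r s τ (c τ) z
  -- `q` is `g` with its unimodular gauge factor restored. It has the same norm as `g` but obeys a
  -- `t`-equation with coefficient `B`, in the normalization of a second column.
  let q : ℝ → ℝ → Fin 2 → ℂ := fun z τ => exp (-psi s * τ + phi s * z) • F (z, τ)
  have hqg : ∀ z τ i, q z τ i = exp (sigma i i * (I * theta r z τ)) * g τ z i := by
    intro z τ i
    simp only [q, g, F, Pi.smul_apply, smul_eq_mul, ← mul_assoc, ← Complex.exp_add, s00]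
    ring_nf
  have hnorm : ∀ z τ, ‖q z τ‖ = ‖g τ z‖ := by
    intro z τ
    have h1 : ∀ i, ‖exp (sigma i i * (I * theta r z τ))‖ = 1 := by
      intro i
      fin_cases i
      · simpa [s00] using norm_exp_I_mul_theta r 1 z τ
      · simpa [s11] using norm_exp_I_mul_theta r (-1) z τ
    simp only [Pi.norm_def]
    congr 1
    refine Finset.sup_congr rfl fun i _ => ?_
    rw [← NNReal.coe_inj, coe_nnnorm, coe_nnnorm, hqg, norm_mul, h1, one_mul]
  have hg0 : ∀ z, 0 ≤ z → g 0 z = κ • sol3 r s 0 z := by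
    intro z hz
    funext i
    have h1 := hqg z 0 i
    simp only [q, Pi.smul_apply, hinit z hz, smul_eq_mul, Complex.ofReal_zero, mul_zero,
      zero_add] at h1
    rw [← mul_assoc, ← Complex.exp_add, add_neg_cancel_left] at h1
    exact (mul_left_cancel₀ (Complex.exp_ne_zero _) h1).symm
  obtain ⟨Cb, hCb, hB⟩ := exists_forall_bound (M := fun p s => B r p.1 p.2 s) (isCoeff_B r) ‖s‖
  have hBz : ∀ z τ i j, ‖B r z τ s i j‖ ≤ Cb * (1 + z ^ 2)⁻¹ := fun z τ i j =>
    (hB (z, τ) s le_rfl i j).trans (mul_le_mul_of_nonneg_left (decay_le_fst z τ) hCb)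
  have hBc : ∀ z τ i j, ‖B r z τ s i j‖ ≤ Cb := fun z τ i j =>
    (hB (z, τ) s le_rfl i j).trans (mul_le_of_le_one_right hCb (decay_le_one _))
  have hqc : ∀ z, Continuous (q z) := fun z =>
    Continuous.smul (f := fun τ : ℝ => exp (-psi s * τ + phi s * z)) (by fun_prop) (hF.comp (f := fun τ : ℝ => (z, τ)) (by fun_prop))
  have hqd : ∀ z, 0 ≤ z → ∀ τ ∈ Ico 0 t,
      HasDerivWithinAt (q z) (colRHS 1 (-psi s) (B r z τ s) (q z τ)) (Ici τ) τ := by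
    intro z hz τ hτ
    have hFc : Continuous fun τ => laxB r s (z, τ) *ᵥ F (z, τ) := by
      refine continuous_pi fun i => ?_
      simp only [Matrix.mulVec, dotProduct, Fin.sum_univ_two]
      have hl : ∀ j, Continuous fun τ => laxB r s (z, τ) i j := fun j =>
        (continuous_laxB r s i j).comp (f := fun τ : ℝ => (z, τ)) (by fun_prop)
      have hf : ∀ j, Continuous fun τ => F (z, τ) j := fun j =>
        ((continuous_apply j).comp hF).comp (f := fun τ : ℝ => (z, τ)) (by fun_prop)
      exact ((hl 0).mul (hf 0)).add ((hl 1).mul (hf 1))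
    -- Propagation delivers the `t`-equation in integrated form up to time `t`; its derivative is
    -- recovered to the right of `τ < t`.
    have hev : ∀ᶠ x in 𝓝[≥] τ, F (z, x) = F (z, 0) +
        ∫ τ in (0 : ℝ)..x, laxB r s (z, τ) *ᵥ F (z, τ) := by
      have : ∀ᶠ x in 𝓝[≥] τ, x < t :=
        (gt_mem_nhds hτ.2 : ∀ᶠ x in 𝓝 τ, x < t).filter_mono nhdsWithin_le_nhds
      filter_upwards [self_mem_nhdsWithin, this] with x hx hxt
      exact hlax z hz x ⟨hτ.1.trans hx, hxt.le⟩
    have hFd : HasDerivWithinAt (fun τ => F (z, τ)) (laxB r s (z, τ) *ᵥ F (z, τ)) (Ici τ) τ :=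
      (((hFc.integral_hasStrictDerivAt 0 τ).hasDerivAt.const_add
        (F (z, 0))).hasDerivWithinAt).congr_of_eventuallyEq hev
        (hev.self_of_nhdsWithin (mem_Ici.2 le_rfl))
    have := hasDerivWithinAt_exp_mul (b := -psi s) (c := phi s * z) (f := fun τ => F (z, τ)) hFd
    refine this.congr_deriv ?_
    rw [colRHS_eq_mulVec]
    congr 1
    rw [laxB, s11, smul_sub]
    simp only [neg_smul, one_smul]
    module
  obtain ⟨C3, hC3⟩ := (isH₃_sol3 r hs' 0).bounded_z
  -- The Gronwall factor times a bound for the initial value `κ • sol3`; the point is that it does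
  -- not depend on `z`.
  let K' : ℝ := ‖κ‖ * C3 * Real.exp ((2 * Cb + ‖-psi s‖ * 2) * t)
  have hqb : ∀ z, 0 ≤ z → ∀ τ ∈ Icc 0 t, ‖q z τ‖ ≤ K' := by
    intro z hz τ hτ
    refine (norm_le_of_col_ode (hBc z) (hqc z).continuousOn (hqd z hz) τ hτ).trans ?_
    rw [hnorm, hg0 z hz, norm_smul]
    exact mul_le_mul_of_nonneg_right (mul_le_mul_of_nonneg_left (hC3 z hz) (norm_nonneg _))
      (Real.exp_pos _).le
  have hqlim : Tendsto (fun z => q z t 1 - q z 0 1) atTop (𝓝 0) := by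
    refine squeeze_zero_norm' ?_ (tendsto_inv_one_add_sq_mul (2 * Cb * K' * t))
    filter_upwards [eventually_ge_atTop 0] with z hz
    refine (norm_apply_sub_le_of_col_ode (hBz z) (hqc z).continuousOn ht.1 (hqd z hz)
      (hqb z hz)).trans (le_of_eq ?_)
    ring
  -- The entry at time `t` differs from the one at time `0` by the drift of `q` and the drift of the
  -- gauge factor. Both vanish at infinity, and at time `0` the limit is `κ`.
  have hglim : Tendsto (fun z => g t z 1) atTop (𝓝 κ) := by
    have hn : ∀ z τ, ‖exp (I * theta r z τ)‖ = 1 := fun z τ => by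
      simpa using norm_exp_I_mul_theta r 1 z τ
    have h1 : Tendsto (fun z => exp (I * theta r z t) * (q z t 1 - q z 0 1)) atTop (𝓝 0) := by
      refine tendsto_zero_iff_norm_tendsto_zero.2 ?_
      simpa only [norm_mul, hn, one_mul] using tendsto_zero_iff_norm_tendsto_zero.1 hqlim
    have h2 : Tendsto (fun z => (exp (I * theta r z t) - exp (I * theta r z 0)) * q z 0 1) atTop
        (𝓝 0) := by
      refine squeeze_zero_norm' (a := fun z =>
        ‖exp (I * theta r z t) - exp (I * theta r z 0)‖ * K') ?_ ?_
      · filter_upwards [eventually_ge_atTop 0] with z hz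
        rw [norm_mul]
        exact mul_le_mul_of_nonneg_left
          ((norm_le_pi_norm _ 1).trans (hqb z hz 0 ⟨le_rfl, ht.1⟩)) (norm_nonneg _)
      · simpa using (hr.tendsto_exp_theta ht).norm.mul_const K'
    have h3 := ((h1.add h2).add ((tendsto_sol3_apply_one r hs' 0).const_mul κ))
    rw [add_zero, zero_add, mul_one] at h3
    refine h3.congr' ?_
    filter_upwards [eventually_ge_atTop 0] with z hz
    have e0 : κ * sol3 r s 0 z 1 = exp (I * theta r z 0) * q z 0 1 := by
      rw [hqg, s11, ← mul_assoc, ← Complex.exp_add, hg0 z hz, Pi.smul_apply, smul_eq_mul,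
        neg_one_mul, add_neg_cancel, Complex.exp_zero, one_mul]
    have et : g t z 1 = exp (I * theta r z t) * q z t 1 := by
      rw [hqg, s11, ← mul_assoc, ← Complex.exp_add, neg_one_mul, add_neg_cancel, Complex.exp_zero,
        one_mul]
    rw [e0, et]
    ring
  have hgd : ∀ z, 0 ≤ z → HasDerivWithinAt (fun z => κ⁻¹ • g t z)
      (colRHS 1 (phi s) (A₁ r z t s) (κ⁻¹ • g t z)) (Ici z) z := by
    intro z hz
    have h1 := hasDerivWithinAt_extendZ r hs' t (c t) hz
    rw [colRHS_eq_mulVec] at h1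
    have h2 := (hasDerivWithinAt_exp_mul (b := 2 * phi s) (c := 2 * (-psi s * t)) h1).const_smul κ⁻¹
    have hfun : (fun z => κ⁻¹ • g t z) = fun z : ℝ =>
        κ⁻¹ • exp (2 * phi s * z + 2 * (-psi s * t)) • extendZ r s t (c t) z := by
      funext z
      simp only [g]
      ring_nf
    rw [hfun, congrFun hfun z]
    refine h2.congr_deriv ?_
    rw [colRHS_eq_mulVec, ← Matrix.mulVec_smul, s00, s11]
    -- The scalar factor adds `2φ` to the diagonal, which is exactly the passage from `σ - 1` to `σ
    -- + 1`, from the first-column to the second-column normalization.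
    congr 1
    module
  have hgc : Continuous fun z => κ⁻¹ • g t z := by
    have hEt : Continuous (extendZ r s t (c t)) :=
      hE.comp (f := fun z : ℝ => (z, t)) (by fun_prop)
    simp only [g]
    fun_prop
  have hH := isH₃_of_ode hs (t := t) (h := fun z => κ⁻¹ • g t z) (C := ‖κ⁻¹‖ * K') hgc
    (fun z hz => by
      rw [norm_smul, ← hnorm]
      exact mul_le_mul_of_nonneg_left (hqb z hz t ⟨ht.1, le_rfl⟩) (norm_nonneg _)) hgd
    (by simpa [hκ] using hglim.const_mul κ⁻¹)
  have hfin : κ⁻¹ • exp (2 * (phi s * z + -psi s * t)) • extendZ r s t (c t) z = sol3 r s t z :=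
    IsH₃.eq_sol3 hs' hH hz
  rw [← hfin, smul_smul, mul_comm κ, mul_assoc, mul_inv_cancel₀ hκ, mul_one, smul_smul,
    ← Complex.exp_add]
  have : 2 * I * η z t s + 2 * (phi s * z + -psi s * t) = 0 := by
    rw [η, phi, psi]
    ring
  rw [this, Complex.exp_zero, one_smul]

end Proportionality

/-! ### Reflection of the spectral parameter -/

section Symmetry

/-- The map `f ↦ ±(-conj f₁, conj f₀)` from `k`-th columns at `s` to the other columns at
`conj s`. -/
def reflectCol (k : Fin 2) : (Fin 2 → ℂ) ≃L[ℝ] (Fin 2 → ℂ) :=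
  LinearEquiv.toContinuousLinearEquiv
    { toFun := fun f => sigma k k • ![-conj (f 1), conj (f 0)]
      map_add' := fun f g => by ext i; fin_cases i <;> simp <;> ring
      map_smul' := fun c f => by ext i; fin_cases i <;> simp <;> ring
      invFun := fun f => sigma (k + 1) (k + 1) • ![-conj (f 1), conj (f 0)]
      left_inv := fun f => by
        ext i; fin_cases k <;> fin_cases i <;> simp [sigma]
      right_inv := fun f => by
        ext i; fin_cases k <;> fin_cases i <;> simp [sigma] }

theorem reflectCol_apply (k : Fin 2) (f : Fin 2 → ℂ) :
    reflectCol k f = sigma k k • ![-conj (f 1), conj (f 0)] := rfl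

theorem reflectCol_reflectCol (k : Fin 2) (f : Fin 2 → ℂ) :
    reflectCol (k + 1) (reflectCol k f) = f := (reflectCol k).symm_apply_apply f

theorem reflectCol_zero_apply_zero (f : Fin 2 → ℂ) : reflectCol 0 f 0 = -conj (f 1) := by
  simp [reflectCol_apply, sigma]

theorem reflectCol_zero_apply_one (f : Fin 2 → ℂ) : reflectCol 0 f 1 = conj (f 0) := by
  simp [reflectCol_apply, sigma]

theorem reflectCol_one (f : Fin 2 → ℂ) : reflectCol 1 f = -reflectCol 0 f := by
  simp [reflectCol_apply, sigma]

theorem reflectCol_zero_smul (c : ℂ) (f : Fin 2 → ℂ) :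
    reflectCol 0 (c • f) = conj c • reflectCol 0 f := by
  ext i
  fin_cases i <;> simp [reflectCol_apply, sigma]

theorem reflectCol_unitCol (k : Fin 2) : reflectCol k (unitCol k) = unitCol (k + 1) := by
  ext i
  fin_cases k <;> fin_cases i <;> simp [reflectCol_apply, sigma, unitCol]

theorem reflectCol_hatExpCol (k : Fin 2) (x : ℂ) (f : Fin 2 → ℂ) :
    reflectCol k (hatExpCol k x f) = hatExpCol (k + 1) (-conj x) (reflectCol k f) := by
  ext i
  fin_cases k <;> fin_cases i <;>
    simp [reflectCol_apply, hatExpCol_apply, sigma, ← Complex.exp_conj] <;> left <;> ring_nf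

theorem reflectCol_setIntegral (k : Fin 2) (S : Set ℝ) (f : ℝ → Fin 2 → ℂ) :
    reflectCol k (∫ x in S, f x) = ∫ x in S, reflectCol k (f x) :=
  ((reflectCol k).integral_comp_comm f).symm

theorem reflectCol_intervalIntegral (k : Fin 2) (a b : ℝ) (f : ℝ → Fin 2 → ℂ) :
    reflectCol k (∫ x in a..b, f x) = ∫ x in a..b, reflectCol k (f x) := by
  simp only [intervalIntegral, map_sub, reflectCol_setIntegral]

/-- `M' = J conj M J⁻¹` with `J` the rotation by a right angle. -/
structure IsReflected (M M' : Matrix (Fin 2) (Fin 2) ℂ) : Prop where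
  eq00 : M' 0 0 = conj (M 1 1)
  eq01 : M' 0 1 = -conj (M 1 0)
  eq10 : M' 1 0 = -conj (M 0 1)
  eq11 : M' 1 1 = conj (M 0 0)

theorem IsReflected.mulVec {M M' : Matrix (Fin 2) (Fin 2) ℂ} (h : IsReflected M M') (k : Fin 2)
    (f : Fin 2 → ℂ) : reflectCol k (M *ᵥ f) = M' *ᵥ reflectCol k f := by
  ext i
  simp only [reflectCol_apply, Matrix.mulVec_smul]
  fin_cases i
  · simp [Matrix.mulVec, dotProduct, Fin.sum_univ_two, h.eq00, h.eq01]
  · simp [Matrix.mulVec, dotProduct, Fin.sum_univ_two, h.eq10, h.eq11]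
    ring_nf
    simp

/-- The symmetry survives the gauge transformation because the phase and the coefficients of its
differential are real. -/
theorem IsReflected.gauge {M M' : Matrix (Fin 2) (Fin 2) ℂ} (h : IsReflected M M') {θ Θ : ℂ}
    (hθ : conj θ = θ) (hΘ : conj Θ = Θ) :
    IsReflected (hatExp (-(I * θ)) (M - (I * Θ) • sigma))
      (hatExp (-(I * θ)) (M' - (I * Θ) • sigma)) := by
  constructor <;> simp only [hatExp_apply, map_mul, ← Complex.exp_conj] <;>
    simp [sigma, h.eq00, h.eq01, h.eq10, h.eq11, hθ, hΘ]
  · ring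
  · left
    ring_nf
  · left
    ring_nf

variable (r : 𝓢(ℝ × ℝ, ℂ)) (T : EReal)

theorem conj_nr (z t : ℝ) : conj (nr r z t) = nr r z t := by
  simp [nr, mul_comm]

theorem isReflected_A (z t : ℝ) (s : ℂ) : IsReflected (A r z t s) (A r z t (conj s)) := by
  constructor <;> simp [A_eq, conj_nr, map_ofNat] <;> ring

theorem isReflected_B (z t : ℝ) (s : ℂ) : IsReflected (B r z t s) (B r z t (conj s)) := by
  constructor <;> simp [B_eq, bDiag, bOff, bOff', conj_nr, map_ofNat] <;> ring

theorem reflectCol_A₁_mulVec (k : Fin 2) (z t : ℝ) (s : ℂ) (f : Fin 2 → ℂ) :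
    reflectCol k (A₁ r z t s *ᵥ f) = A₁ r z t (conj s) *ᵥ reflectCol k f :=
  ((isReflected_A r z t s).gauge (conj_theta r z t) (conj_Theta1 r z t)).mulVec k f

theorem reflectCol_B₁_mulVec (k : Fin 2) (z t : ℝ) (s : ℂ) (f : Fin 2 → ℂ) :
    reflectCol k (B₁ r z t s *ᵥ f) = B₁ r z t (conj s) *ᵥ reflectCol k f :=
  ((isReflected_B r z t s).gauge (conj_theta r z t) (conj_Theta2 r z t)).mulVec k f

theorem lam_conj (s : ℂ) : lam (conj s) = conj (lam s) := by
  simp [lam, map_ofNat]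

theorem neg_conj_I_lam_mul (s : ℂ) (x y : ℝ) :
    -conj (I * lam s * (x - y)) = I * lam (conj s) * (x - y) := by
  simp [lam_conj]

theorem neg_conj_I_lam_mul' (s : ℂ) (x : ℝ) : -conj (I * lam s * x) = I * lam (conj s) * x := by
  simp [lam_conj]

theorem neg_conj_I_lam_sq_mul (s : ℂ) (x y : ℝ) :
    -conj (-(2 * I * lam s ^ 2 * (x - y))) = -(2 * I * lam (conj s) ^ 2 * (x - y)) := by
  simp [lam_conj, map_ofNat]

variable {r T} {s : ℂ} {k : Fin 2}

theorem IsH₁.reflect {f : ℝ → ℝ → Fin 2 → ℂ} (h : IsH₁ r s k f) :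
    IsH₁ r (conj s) (k + 1) fun z t => reflectCol k (f z t) where
  continuousOn_z t ht := (reflectCol k).continuous.comp_continuousOn (h.continuousOn_z t ht)
  continuousOn_t := (reflectCol k).continuous.comp_continuousOn h.continuousOn_t
  equation z t hz ht := by
    rw [h.equation z t hz ht]
    simp only [map_add, reflectCol_unitCol, reflectCol_hatExpCol, reflectCol_intervalIntegral,
      reflectCol_A₁_mulVec, reflectCol_B₁_mulVec, neg_conj_I_lam_mul, neg_conj_I_lam_mul',
      neg_conj_I_lam_sq_mul]

theorem IsH₂.reflect {f : ℝ → ℝ → Fin 2 → ℂ} (h : IsH₂ r T s k f) :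
    IsH₂ r T (conj s) (k + 1) fun z t => reflectCol k (f z t) where
  continuousOn_z t ht := (reflectCol k).continuous.comp_continuousOn (h.continuousOn_z t ht)
  continuousOn_t := (reflectCol k).continuous.comp_continuousOn h.continuousOn_t
  bounded_t := by
    obtain ⟨C, hC⟩ := h.bounded_t
    exact ⟨‖((reflectCol k) : (Fin 2 → ℂ) →L[ℝ] (Fin 2 → ℂ))‖ * C, fun t ht =>
      (((reflectCol k) : (Fin 2 → ℂ) →L[ℝ] (Fin 2 → ℂ)).le_opNorm _).trans
        (mul_le_mul_of_nonneg_left (hC t ht) (norm_nonneg _))⟩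
  equation z t hz ht := by
    rw [h.equation z t hz ht]
    simp only [map_add, map_sub, reflectCol_unitCol, reflectCol_hatExpCol,
      reflectCol_intervalIntegral, reflectCol_setIntegral, reflectCol_A₁_mulVec,
      reflectCol_B₁_mulVec, neg_conj_I_lam_mul, neg_conj_I_lam_mul', neg_conj_I_lam_sq_mul]

theorem IsH₃.reflect {t : ℝ} {f : ℝ → Fin 2 → ℂ} (h : IsH₃ r s k t f) :
    IsH₃ r (conj s) (k + 1) t fun z => reflectCol k (f z) where
  continuousOn_z := (reflectCol k).continuous.comp_continuousOn h.continuousOn_z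
  bounded_z := by
    obtain ⟨C, hC⟩ := h.bounded_z
    exact ⟨‖((reflectCol k) : (Fin 2 → ℂ) →L[ℝ] (Fin 2 → ℂ))‖ * C, fun t ht =>
      (((reflectCol k) : (Fin 2 → ℂ) →L[ℝ] (Fin 2 → ℂ)).le_opNorm _).trans
        (mul_le_mul_of_nonneg_left (hC t ht) (norm_nonneg _))⟩
  equation z hz := by
    rw [h.equation z hz]
    simp only [map_sub, reflectCol_unitCol, reflectCol_hatExpCol, reflectCol_setIntegral,
      reflectCol_A₁_mulVec, neg_conj_I_lam_mul]

variable (r T)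

/-- Uniqueness is available for first columns only. The chosen second column at `conj s` is
therefore reflected back to a first column at `s`, identified there, and reflected again. -/
theorem H₁_conj (hφ : 0 ≤ (phi s).re) (hψ : (psi s).re ≤ 0) {z t : ℝ} (hz : 0 ≤ z) (ht : 0 ≤ t) :
    H₁ r z t (conj s) 1 = reflectCol 0 (H₁ r z t s 0) := by
  have h : IsH₁ r (conj s) 1 (Classical.epsilon (IsH₁ r (conj s) 1)) :=
    Classical.epsilon_spec ⟨_, (isH₁_extendZ r hφ hψ).reflect⟩
  have h' : IsH₁ r s 0 _ := conj_conj s ▸ h.reflect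
  rw [H₁_eq_extendZ r hφ hψ hz ht, ← h'.eq_extendZ hφ hψ hz ht]
  exact (reflectCol_reflectCol 1 _).symm

theorem H₂_conj (hφ : 0 ≤ (phi s).re) (hψ : 0 ≤ (psi s).re) {z t : ℝ} (hz : 0 ≤ z)
    (ht : t ∈ timeSet T) : H₂ r T z t (conj s) 1 = reflectCol 0 (H₂ r T z t s 0) := by
  have h : IsH₂ r T (conj s) 1 (Classical.epsilon (IsH₂ r T (conj s) 1)) :=
    Classical.epsilon_spec ⟨_, (isH₂_extendZ r T hφ hψ).reflect⟩
  have h' : IsH₂ r T s 0 _ := conj_conj s ▸ h.reflect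
  rw [H₂_eq_extendZ r T hφ hψ hz ht, ← h'.eq_extendZ hφ hψ hz ht]
  exact (reflectCol_reflectCol 1 _).symm

theorem H₃_conj (hφ : 0 ≤ (phi s).re) {z : ℝ} (hz : 0 ≤ z) (t : ℝ) :
    H₃ r z t (conj s) 0 = reflectCol 1 (H₃ r z t s 1) := by
  have h : IsH₃ r (conj s) 0 t (Classical.epsilon (IsH₃ r (conj s) 0 t)) :=
    Classical.epsilon_spec ⟨_, (isH₃_sol3 r hφ t).reflect⟩
  have h' : IsH₃ r s 1 t _ := conj_conj s ▸ h.reflect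
  rw [H₃_eq_sol3 r hφ hz, ← h'.eq_sol3 hφ hz]
  exact (reflectCol_reflectCol 0 _).symm

end Symmetry

/-! ### Simple poles -/

section Poles

/-- The divided difference `dslope g p` is analytic and equals the nonzero `g'(p)` at `p`. Dividing
`h` by it leaves `f` as `(s - p)⁻¹` times an analytic function not vanishing at `p`. -/
theorem hasSimplePoleWithResidue_of_eventuallyEq {f h : ℂ → Fin 2 → ℂ} {g : ℂ → ℂ} {p : ℂ}
    (hg : ∀ᶠ s in 𝓝 p, DifferentiableAt ℂ g s) (hh : ∀ᶠ s in 𝓝 p, DifferentiableAt ℂ h s)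
    (hgp : g p = 0) (hg' : deriv g p ≠ 0) (hhp : h p ≠ 0)
    (hf : ∀ᶠ s in 𝓝[≠] p, f s = (g s)⁻¹ • h s) :
    HasSimplePoleWithResidue f p ((deriv g p)⁻¹ • h p) := by
  have hga := analyticAt_iff_eventually_differentiableAt.2 hg
  have hha := analyticAt_iff_eventually_differentiableAt.2 hh
  obtain ⟨P, hP⟩ := hga
  have hda : AnalyticAt ℂ (dslope g p) p := ⟨_, hP.has_fpower_series_dslope_fslope⟩
  have hdp : dslope g p p = deriv g p := dslope_same g p
  have hka : AnalyticAt ℂ (fun s => (dslope g p s)⁻¹ • h s) p :=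
    (hda.inv (by rwa [hdp])).smul hha
  have hfk : ∀ᶠ s in 𝓝[≠] p, f s = (s - p) ^ (-1 : ℤ) • ((dslope g p s)⁻¹ • h s) := by
    filter_upwards [hf, self_mem_nhdsWithin] with s hs hsp
    rw [hs, dslope_of_ne _ hsp, slope_def_field, hgp, sub_zero, smul_smul]
    congr 1
    have : s - p ≠ 0 := sub_ne_zero.2 hsp
    rw [_root_.zpow_neg_one, inv_div]
    field_simp
  have hm : MeromorphicAt f p := by
    have h1 : MeromorphicAt (fun s => (s - p) ^ (-1 : ℤ) • ((dslope g p s)⁻¹ • h s)) p := by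
      have h2 : MeromorphicAt (fun s : ℂ => (s - p) ^ (-1 : ℤ)) p := by fun_prop
      exact h2.smul hka.meromorphicAt
    exact h1.congr (hfk.mono fun s hs => hs.symm)
  refine ⟨hm, (meromorphicOrderAt_eq_int_iff hm).2 ⟨_, hka, ?_, hfk⟩, ?_⟩
  · rw [hdp]
    exact smul_ne_zero (inv_ne_zero hg') hhp
  · have hc := hka.continuousAt.tendsto
    rw [hdp] at hc
    refine (hc.mono_left nhdsWithin_le_nhds).congr' ?_
    filter_upwards [hfk, self_mem_nhdsWithin] with s hs hsp
    have : s - p ≠ 0 := sub_ne_zero.2 hsp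
    rw [hs, smul_smul (s - p), _root_.zpow_neg_one, mul_inv_cancel₀ this, one_smul]

theorem differentiableAt_reflectCol_conj {h : ℂ → Fin 2 → ℂ} {p : ℂ}
    (hh : DifferentiableAt ℂ h p) :
    DifferentiableAt ℂ (fun s => reflectCol 0 (h (conj s))) (conj p) := by
  have h' := fun i => (differentiableAt_pi.1 hh i).conj_conj
  refine differentiableAt_pi.2 fun i => ?_
  fin_cases i
  · change DifferentiableAt ℂ (fun s => reflectCol 0 (h (conj s)) 0) (conj p)
    simp only [reflectCol_zero_apply_zero]
    exact (h' 1).neg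
  · change DifferentiableAt ℂ (fun s => reflectCol 0 (h (conj s)) 1) (conj p)
    simp only [reflectCol_zero_apply_one]
    exact h' 0

theorem tendsto_conj_nhdsNE (p : ℂ) : Tendsto (fun s => conj s) (𝓝[≠] (conj p)) (𝓝[≠] p) := by
  refine tendsto_nhdsWithin_iff.2 ⟨?_, ?_⟩
  · have := (Complex.continuous_conj.tendsto (conj p)).mono_left
      (nhdsWithin_le_nhds (s := {conj p}ᶜ))
    simpa using this
  · filter_upwards [self_mem_nhdsWithin] with s hs h
    exact hs (by rw [mem_singleton_iff, ← mem_singleton_iff.1 h, conj_conj])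

theorem tendsto_conj_nhds (p : ℂ) : Tendsto (fun s => conj s) (𝓝 (conj p)) (𝓝 p) := by
  simpa using Complex.continuous_conj.tendsto (conj p)

/-- Conjugating both argument and value preserves holomorphy, so the pole criterion applies at `conj
p` to the reflected data. -/
theorem hasSimplePoleWithResidue_reflect {f h : ℂ → Fin 2 → ℂ} {g : ℂ → ℂ} {p : ℂ}
    (hg : ∀ᶠ s in 𝓝 p, DifferentiableAt ℂ g s) (hh : ∀ᶠ s in 𝓝 p, DifferentiableAt ℂ h s)
    (hgp : g p = 0) (hg' : deriv g p ≠ 0) (hhp : h p ≠ 0)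
    (hf : ∀ᶠ s in 𝓝[≠] p, f (conj s) = (conj (g s))⁻¹ • reflectCol 0 (h s)) :
    HasSimplePoleWithResidue f (conj p) ((conj (deriv g p))⁻¹ • reflectCol 0 (h p)) := by
  have hd : deriv (fun s => conj (g (conj s))) (conj p) = conj (deriv g p) := by
    have h1 := hg.self_of_nhds.hasDerivAt.conj_conj
    exact h1.deriv
  have := hasSimplePoleWithResidue_of_eventuallyEq (f := f) (g := fun s => conj (g (conj s)))
    (h := fun s => reflectCol 0 (h (conj s))) (p := conj p)
    (((tendsto_conj_nhds p).eventually hg).mono fun s hs => by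
      have h1 := hs.conj_conj
      rw [conj_conj] at h1
      exact h1)
    (((tendsto_conj_nhds p).eventually hh).mono fun s hs => by
      simpa using differentiableAt_reflectCol_conj hs)
    (by simp [hgp]) (by rw [hd]; simpa using hg') (by simpa using hhp)
    (((tendsto_conj_nhdsNE p).eventually hf).mono fun s hs => by simpa using hs)
  rw [hd, conj_conj] at this
  exact this

end Poles

/-! ### The sectionally meromorphic matrix -/

section Sectional

variable (r : 𝓢(ℝ × ℝ, ℂ)) (T : EReal) (z t : ℝ) {s : ℂ}

theorem ofCols_col_zero (a b : Fin 2 → ℂ) : (ofCols a b).col 0 = a := rfl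

theorem ofCols_col_one (a b : Fin 2 → ℂ) : (ofCols a b).col 1 = b := rfl

theorem re_phi_conj (s : ℂ) : (phi (conj s)).re = -(phi s).re := by
  simp [phi, lam_conj]

theorem re_psi_conj (s : ℂ) : (psi (conj s)).re = -(psi s).re := by
  have h : psi (conj s) = -conj (psi s) := by
    simp [psi, lam_conj, map_ofNat]
  rw [h, Complex.neg_re, Complex.conj_re]

theorem conj_mem_D₁ (hs : s ∈ D₃) : conj s ∈ D₁ := by
  refine ⟨?_, ?_⟩
  · rw [re_phi_conj]; exact neg_neg_of_pos hs.1
  · rw [re_psi_conj]; exact neg_neg_of_pos hs.2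

theorem conj_mem_D₂ (hs : s ∈ D₄) : conj s ∈ D₂ := by
  refine ⟨?_, ?_⟩
  · rw [re_phi_conj]; exact neg_neg_of_pos hs.1
  · rw [re_psi_conj]; exact neg_pos_of_neg hs.2

theorem isOpen_D₃ : IsOpen D₃ :=
  (isOpen_lt continuous_const (Complex.continuous_re.comp differentiable_phi.continuous)).inter
    (isOpen_lt continuous_const (Complex.continuous_re.comp differentiable_psi.continuous))

theorem isOpen_D₄ : IsOpen D₄ :=
  (isOpen_lt continuous_const (Complex.continuous_re.comp differentiable_phi.continuous)).inter
    (isOpen_lt (Complex.continuous_re.comp differentiable_psi.continuous) continuous_const)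

theorem E_of_mem_D₁ (hs : s ∈ D₁) : E r T z t s =
    ofCols (H₃ r z t s 0) ((conj (β r T (conj s)))⁻¹ • H₂ r T z t s 1) := if_pos hs

theorem E_of_mem_D₂ (hs : s ∈ D₂) : E r T z t s =
    ofCols (H₃ r z t s 0) ((conj (u r (conj s)))⁻¹ • H₁ r z t s 1) := by
  have h1 : s ∉ D₁ := fun h => lt_asymm h.2 hs.2
  rw [E, if_neg h1, if_pos hs]

theorem E_of_mem_D₃ (hs : s ∈ D₃) : E r T z t s =
    ofCols ((β r T s)⁻¹ • H₂ r T z t s 0) (H₃ r z t s 1) := by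
  have h1 : s ∉ D₁ := fun h => lt_asymm h.1 hs.1
  have h2 : s ∉ D₂ := fun h => lt_asymm h.1 hs.1
  rw [E, if_neg h1, if_neg h2, if_pos hs]

theorem E_of_mem_D₄ (hs : s ∈ D₄) : E r T z t s =
    ofCols ((u r s)⁻¹ • H₁ r z t s 0) (H₃ r z t s 1) := by
  have h1 : s ∉ D₁ := fun h => lt_asymm h.1 hs.1
  have h2 : s ∉ D₂ := fun h => lt_asymm h.1 hs.1
  have h3 : s ∉ D₃ := fun h => lt_asymm h.2 hs.2
  rw [E, if_neg h1, if_neg h2, if_neg h3, if_pos hs]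

theorem u_eq_sol3 (hs : 0 ≤ (phi s).re) : u r s = sol3 r s 0 0 1 := by
  rw [u, H₃_eq_sol3 r hs le_rfl]

theorem v_eq_sol3 (hs : 0 ≤ (phi s).re) : v r s = sol3 r s 0 0 0 := by
  rw [v, H₃_eq_sol3 r hs le_rfl]

theorem differentiableAt_u (hs : 0 < (phi s).re) : DifferentiableAt ℂ (u r) s := by
  have hev := (Complex.continuous_re.comp differentiable_phi.continuous).continuousAt.eventually
    (lt_mem_nhds hs)
  exact (differentiableAt_pi.1 (differentiableAt_sol3 r hs 0 0) 1).congr_of_eventuallyEq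
    (hev.mono fun w hw => u_eq_sol3 r (le_of_lt hw))

theorem differentiableAt_v (hs : 0 < (phi s).re) : DifferentiableAt ℂ (v r) s := by
  have hev := (Complex.continuous_re.comp differentiable_phi.continuous).continuousAt.eventually
    (lt_mem_nhds hs)
  exact (differentiableAt_pi.1 (differentiableAt_sol3 r hs 0 0) 0).congr_of_eventuallyEq
    (hev.mono fun w hw => v_eq_sol3 r (le_of_lt hw))

variable {T}

theorem conj_V_conj (hs : s ∈ D₃) (hT : 0 ∈ timeSet T) :
    conj (V r T (conj s)) = -H₂ r T 0 0 s 0 1 := by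
  rw [V, H₂_conj r T hs.1.le hs.2.le le_rfl hT, reflectCol_zero_apply_zero, map_neg, conj_conj]

theorem conj_U_conj (hs : s ∈ D₃) (hT : 0 ∈ timeSet T) :
    conj (U r T (conj s)) = H₂ r T 0 0 s 0 0 := by
  rw [U, H₂_conj r T hs.1.le hs.2.le le_rfl hT, reflectCol_zero_apply_one, conj_conj]

/-- In this form `β` is the determinant, at the origin, of the first column of `H₂` and the second
column of `H₃`. It is thus holomorphic in `D₃`, and its zeros are the points where the two columns
are parallel. -/
theorem β_eq (hs : s ∈ D₃) (hT : 0 ∈ timeSet T) :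
    β r T s = u r s * H₂ r T 0 0 s 0 0 - v r s * H₂ r T 0 0 s 0 1 := by
  rw [β, conj_V_conj r hs hT, conj_U_conj r hs hT]
  ring

theorem differentiableAt_β (hs : s ∈ D₃) (hT : 0 ∈ timeSet T) :
    DifferentiableAt ℂ (β r T) s := by
  have h := fun i => differentiableAt_pi.1 (differentiableAt_H₂ r T hs.1 hs.2 le_rfl hT (z := 0)) i
  exact (((differentiableAt_u r hs.1).mul (h 0)).sub
    ((differentiableAt_v r hs.1).mul (h 1))).congr_of_eventuallyEq
    ((isOpen_D₃.eventually_mem hs).mono fun w hw => β_eq r hw hT)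

theorem conj_exp_η (z t : ℝ) (s : ℂ) :
    conj (exp (2 * I * η z t s)) = exp (-(2 * I * η z t (conj s))) := by
  rw [← Complex.exp_conj]
  congr 1
  simp [η, lam_conj, map_ofNat]

/-- Both residues come from the one relation `h p = c • w`. The opposite sign at `conj p` arises
because the first column of `H₃` is `reflectCol 1` of the second, whereas `H₁` and `H₂` reflect by
`reflectCol 0`. -/
theorem hasSimplePoleWithResidue_pair {f f' h : ℂ → Fin 2 → ℂ} {g : ℂ → ℂ} {p c : ℂ} {w : Fin 2 → ℂ}
    (hg : ∀ᶠ s in 𝓝 p, DifferentiableAt ℂ g s) (hh : ∀ᶠ s in 𝓝 p, DifferentiableAt ℂ h s)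
    (hgp : g p = 0) (hg' : deriv g p ≠ 0) (hhp : h p = c • w) (hc : c ≠ 0) (hw : w ≠ 0)
    (hf : ∀ᶠ s in 𝓝[≠] p, f s = (g s)⁻¹ • h s)
    (hf' : ∀ᶠ s in 𝓝[≠] p, f' (conj s) = (conj (g s))⁻¹ • reflectCol 0 (h s)) :
    HasSimplePoleWithResidue f p (((deriv g p)⁻¹ * c) • w) ∧
      HasSimplePoleWithResidue f' (conj p)
        ((-((conj (deriv g p))⁻¹ * conj c)) • reflectCol 1 w) := by
  have hne : h p ≠ 0 := hhp ▸ smul_ne_zero hc hw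
  have h1 := hasSimplePoleWithResidue_of_eventuallyEq hg hh hgp hg' hne hf
  have h2 := hasSimplePoleWithResidue_reflect hg hh hgp hg' hne hf'
  rw [hhp, smul_smul] at h1
  rw [hhp, reflectCol_zero_smul, smul_smul] at h2
  refine ⟨h1, ?_⟩
  rwa [reflectCol_one, neg_smul_neg]

end Sectional

/-! ### The residues -/

section Residues

variable {r : 𝓢(ℝ × ℝ, ℂ)} {T : EReal} {z t : ℝ}

/-- At the origin the columns are `(1, 0)` and `(v, 0)`, and `v` cannot vanish along with `u`. Hence
`κ = v⁻¹` in `IsSolution.extendZ_eq_smul_sol3`. -/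
theorem IsSolution.H₁_eq_smul_H₃ (hr : IsSolution r T) (hz : 0 ≤ z) (ht : t ∈ timeSet T) {ξ : ℂ}
    (hξ : ξ ∈ D₄) (hu : u r ξ = 0) :
    v r ξ ≠ 0 ∧ H₁ r z t ξ 0 = ((v r ξ)⁻¹ * exp (2 * I * η z t ξ)) • H₃ r z t ξ 1 := by
  have hφ := hξ.1.le
  have hψ := hξ.2.le
  have hv : v r ξ ≠ 0 := by
    intro hv
    refine sol3_ne_zero r hφ 0 le_rfl (z := 0) ?_
    ext i
    fin_cases i
    · exact (v_eq_sol3 r hφ).symm.trans hv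
    · exact (u_eq_sol3 r hφ).symm.trans hu
  refine ⟨hv, ?_⟩
  obtain ⟨K, hK⟩ := exists_bound_bd1 r hψ
  rw [H₁_eq_extendZ r hφ hψ hz ht.1, H₃_eq_sol3 r hφ hz]
  refine hr.extendZ_eq_smul_sol3 hξ.1 (continuous_bd1 r hψ) hK
    (fun t ht => hasDerivWithinAt_bd1 r hψ ht.1) (inv_ne_zero hv) ?_ hz ht
  rw [bd1_eq r hψ le_rfl, intervalIntegral.integral_same, add_zero]
  ext i
  fin_cases i
  · change unitCol 0 0 = (v r ξ)⁻¹ * sol3 r ξ 0 0 0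
    rw [← v_eq_sol3 r hφ, inv_mul_cancel₀ hv]
    simp [unitCol]
  · change unitCol 0 1 = (v r ξ)⁻¹ * sol3 r ξ 0 0 1
    rw [← u_eq_sol3 r hφ, hu, mul_zero]
    simp [unitCol]

/-- The determinant `β` vanishes and `u` does not, so the column of `H₂` at the origin is a multiple
of `(v, u)`. Comparing second entries, which for `H₂` is `-conj (V (conj μ))`, gives the factor. -/
theorem IsSolution.H₂_eq_smul_H₃ (hr : IsSolution r T) (hz : 0 ≤ z) (ht : t ∈ timeSet T) {μ : ℂ}
    (hμ : μ ∈ D₃) (hβ : β r T μ = 0) (hu : u r μ ≠ 0) :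
    V r T (conj μ) ≠ 0 ∧ H₂ r T z t μ 0 =
      (-(conj (V r T (conj μ)) / u r μ) * exp (2 * I * η z t μ)) • H₃ r z t μ 1 := by
  have hφ := hμ.1.le
  have hψ := hμ.2.le
  have hT : (0 : ℝ) ∈ timeSet T := ⟨le_rfl, (EReal.coe_le_coe_iff.2 ht.1).trans_lt ht.2⟩
  have hf : H₂ r T 0 0 μ 0 = bd2 r T μ 0 := by
    rw [H₂_eq_extendZ r T hφ hψ le_rfl hT, extendZ_zero r hφ]
  have hne := bd2_ne_zero r T hψ hT
  have hrel := β_eq r hμ hT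
  rw [hβ, hf] at hrel
  have hV := conj_V_conj r hμ hT
  rw [hf] at hV
  have hf0 : bd2 r T μ 0 0 = bd2 r T μ 0 1 / u r μ * v r μ := by
    field_simp
    linear_combination -hrel
  -- If the second entry vanished, so would the first by proportionality, against `bd2_ne_zero`.
  -- This is what makes `V (conj μ)` nonzero and the pole genuine.
  have hf1 : bd2 r T μ 0 1 ≠ 0 := by
    intro h1
    refine hne ?_
    ext i
    fin_cases i
    · change bd2 r T μ 0 0 = 0
      rw [hf0, h1, zero_div, zero_mul]
    · exact h1
  refine ⟨fun h => hf1 ?_, ?_⟩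
  · rw [h, map_zero] at hV
    exact neg_eq_zero.1 hV.symm
  obtain ⟨K, hK⟩ := exists_bound_bd2 r T hψ
  rw [H₂_eq_extendZ r T hφ hψ hz ht, H₃_eq_sol3 r hφ hz, hV, neg_div, neg_neg]
  refine hr.extendZ_eq_smul_sol3 hμ.1 (continuous_bd2 r T hψ) hK
    (fun t ht => hasDerivWithinAt_bd2 r T hψ ht) (div_ne_zero hf1 hu) ?_ hz ht
  ext i
  fin_cases i
  · change bd2 r T μ 0 0 = bd2 r T μ 0 1 / u r μ * sol3 r μ 0 0 0
    rw [← v_eq_sol3 r hφ, hf0]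
  · change bd2 r T μ 0 1 = bd2 r T μ 0 1 / u r μ * sol3 r μ 0 0 1
    rw [← u_eq_sol3 r hφ, div_mul_cancel₀ _ hu]

end Residues

end CLLNLS

end

theorem proposition2p5 (r : 𝓢(ℝ × ℝ, ℂ)) (T : EReal) (hr : IsSolution r T)
    (hzeros : SimpleZeros r T) (z t : ℝ) (hz : 0 < z) (ht : 0 < t) (htT : (t : EReal) < T) :
    (∀ ξ ∈ D₄, u r ξ = 0 →
      HasSimplePoleWithResidue (fun s => (E r T z t s).col 0) ξ
        ((1 / (v r ξ * deriv (u r) ξ) * Complex.exp (2 * Complex.I * η z t ξ)) •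
          (E r T z t ξ).col 1) ∧
      HasSimplePoleWithResidue (fun s => (E r T z t s).col 1) (conj ξ)
        ((-(1 / (conj (v r ξ) * conj (deriv (u r) ξ))) *
            Complex.exp (-(2 * Complex.I * η z t (conj ξ)))) •
          (E r T z t (conj ξ)).col 0)) ∧
    (∀ μ ∈ D₃, β r T μ = 0 →
      HasSimplePoleWithResidue (fun s => (E r T z t s).col 0) μ
        ((-(conj (V r T (conj μ)) / (u r μ * deriv (β r T) μ)) *
            Complex.exp (2 * Complex.I * η z t μ)) •
          (E r T z t μ).col 1) ∧
      HasSimplePoleWithResidue (fun s => (E r T z t s).col 1) (conj μ)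
        ((V r T (conj μ) / (conj (u r μ) * conj (deriv (β r T) μ)) *
            Complex.exp (-(2 * Complex.I * η z t (conj μ)))) •
          (E r T z t (conj μ)).col 0)) := by
  have htT' : t ∈ timeSet T := ⟨ht.le, htT⟩
  have hT : (0 : ℝ) ∈ timeSet T := ⟨le_rfl, (EReal.coe_le_coe_iff.2 ht.le).trans_lt htT⟩
  -- Non-vanishing at the given `(z, t)` excludes a removable singularity there.
  have hw : ∀ s : ℂ, 0 < (phi s).re → H₃ r z t s 1 ≠ 0 := fun s hs => by
    rw [H₃_eq_sol3 r hs.le hz.le]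
    exact sol3_ne_zero r hs.le t hz.le
  refine ⟨fun ξ hξ hu => ?_, fun μ hμ hβ => ?_⟩
  · obtain ⟨hv, hH⟩ := hr.H₁_eq_smul_H₃ hz.le htT' hξ hu
    have hev := isOpen_D₄.eventually_mem hξ
    have hev' : ∀ᶠ s in 𝓝[≠] ξ, s ∈ D₄ := hev.filter_mono nhdsWithin_le_nhds
    obtain ⟨h1, h2⟩ := hasSimplePoleWithResidue_pair (f := fun s => (E r T z t s).col 0)
      (f' := fun s => (E r T z t s).col 1) (g := u r) (h := fun s => H₁ r z t s 0) (p := ξ)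
      (hev.mono fun s hs => differentiableAt_u r hs.1)
      (hev.mono fun s hs => differentiableAt_H₁ r hs.1 hs.2 hz.le ht.le) hu
      (hzeros.u_simple ξ hξ hu) hH
      (mul_ne_zero (inv_ne_zero hv) (Complex.exp_ne_zero _)) (hw ξ hξ.1)
      (hev'.mono fun s hs => by simp only [E_of_mem_D₄ r T z t hs, ofCols_col_zero])
      (hev'.mono fun s hs => by
        simp only [E_of_mem_D₂ r T z t (conj_mem_D₂ hs), ofCols_col_one, conj_conj,
          H₁_conj r hs.1.le hs.2.le hz.le ht.le])
    rw [E_of_mem_D₄ r T z t hξ, E_of_mem_D₂ r T z t (conj_mem_D₂ hξ), ofCols_col_zero,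
      ofCols_col_one, H₃_conj r hξ.1.le hz.le]
    refine ⟨?_, ?_⟩
    · convert h1 using 2
      rw [one_div, mul_inv]
      ring
    · convert h2 using 2
      rw [map_mul, conj_exp_η, map_inv₀, one_div, mul_inv]
      ring
  · have hu := hzeros.disjoint μ hμ hβ
    obtain ⟨hV, hH⟩ := hr.H₂_eq_smul_H₃ hz.le htT' hμ hβ hu
    have hV' : conj (V r T (conj μ)) ≠ 0 := (map_ne_zero _).2 hV
    have hev := isOpen_D₃.eventually_mem hμ
    have hev' : ∀ᶠ s in 𝓝[≠] μ, s ∈ D₃ := hev.filter_mono nhdsWithin_le_nhds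
    obtain ⟨h1, h2⟩ := hasSimplePoleWithResidue_pair (f := fun s => (E r T z t s).col 0)
      (f' := fun s => (E r T z t s).col 1) (g := β r T) (h := fun s => H₂ r T z t s 0) (p := μ)
      (hev.mono fun s hs => differentiableAt_β r hs hT)
      (hev.mono fun s hs => differentiableAt_H₂ r T hs.1 hs.2 hz.le htT') hβ
      (hzeros.β_simple μ hμ hβ) hH
      (mul_ne_zero (neg_ne_zero.2 (div_ne_zero hV' hu)) (Complex.exp_ne_zero _)) (hw μ hμ.1)
      (hev'.mono fun s hs => by simp only [E_of_mem_D₃ r T z t hs, ofCols_col_zero])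
      (hev'.mono fun s hs => by
        simp only [E_of_mem_D₁ r T z t (conj_mem_D₁ hs), ofCols_col_one, conj_conj,
          H₂_conj r T hs.1.le hs.2.le hz.le htT'])
    rw [E_of_mem_D₃ r T z t hμ, E_of_mem_D₁ r T z t (conj_mem_D₁ hμ), ofCols_col_zero,
      ofCols_col_one, H₃_conj r hμ.1.le hz.le]
    refine ⟨?_, ?_⟩
    · convert h1 using 2
      rw [div_mul_eq_div_div, div_eq_mul_inv _ (deriv _ _)]
      ring
    · convert h2 using 2
      rw [map_mul, conj_exp_η, map_neg, map_div₀, conj_conj, div_mul_eq_div_div,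
        div_eq_mul_inv _ (conj (deriv _ _))]
      ring
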